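/- \textbf{Setting.} Let $X$ be a smooth projective (connected) curve over $\mathbb C$ with canonical bundle $K_X$. Let $Q$ be a finite quiver with vertex set $Q_0$, arrow set $Q_1$, head and tail maps $h,t$ and a distinguished vertex $0$, and let $\overline Q$ be the quiver obtained by adding an opposite arrow $\bar a$ for each $a\in Q_1$; put $\bar{\bar a}=a$, $|a|=0$ for $a\in Q_1$ and $|a|=1$ for the added arrows. Fix a line bundle $M_a$ on $X$ for each $a\in\overline Q_1$ and an isomorphism $M_a\otimes M_{\bar a}\to K_X^{-1}$ for each $a\in Q_1$. A \emph{framed twisted quiver sheaf with the moment map relation} is a pair $E=(E_i,\phi_a)$ of coherent sheaves $E_i$ ($i\in Q_0$) on $X$, with $E_0\cong\mathcal O_X^{\oplus r}$ for some $r\ge 0$, and $\mathcal O_X$-homomorphisms $\phi_a:M_a\otimes E_{t(a)}\to E_{h(a)}$ ($a\in\overline Q_1$), such that for each $i\neq 0$ $$\sum_{a\in\overline Q_1:\,h(a)=i}(-1)^{|a|}\,\phi_a\circ(\mathrm{Id}_{M_a}\otimes\phi_{\bar a})=0\quad\text{in }\mathrm{Hom}(K_X^{-1}\otimes E_i,E_i).$$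 With the evident morphisms these form a category $\mathcal A$. For a real number $\tau>0$ put $$Z_\tau(E)=\sum_{i\ne0}\mathrm{rk}\,E_i+\sqrt{-1}\Big(\sum_{i\neq0}\deg E_i+\tau\,\mathrm{rk}\,E_0\Big).$$ A nonzero $E$ is \emph{$\tau$-stable} (resp. \emph{$\tau$-semistable}) if $\mathrm{Arg}\,Z_\tau(E')<\mathrm{Arg}\,Z_\tau(E)$ (resp. $\le$) for every nonzero proper subobject $E'$ of $E$ in $\mathcal A$. It has \emph{type} $(v,d)$, where $v\in\mathbb N^{Q_0}$ and $d\in\mathbb Z^{Q_0}$, if $\mathrm{rk}\,E_i=v_i$ and $\deg E_i=d_i$ for all $i$. Let $V=\bigoplus_{a\in\overline Q_1}\mathrm{Hom}(\mathbb C^{v_{t(a)}},\mathbb C^{v_{h(a)}})$, let $G=\prod_{i\ne0}GL_{v_i}$ act on $V$ in the natural way, and let $\theta=(1,\dots,1)$ stand for the character $\theta(g)=\prod_{i\neq0}\det g_i$. A (geometric) point $p$ of $V$ is \emph{$\theta$-stable} if for every one-parameter subgroup of $G$ its orbit through $(p,1)$ is closed in $V\times\mathbb A^1$, where $g\in G$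 acts on $\mathbb A^1$ by $\theta(g)^{-1}$. A quiver sheaf $E$ of type $(v,d)$ is \emph{stable as a twisted quasimap to the Nakajima quiver variety $V/\!\!/\!\!/_{0,\theta}G$} if all $E_i$ are locally free and, after trivializing the $E_i$ and the $M_a$ at the generic point of $X$, the geometric point of $V$ over the generic point of $X$ given by $(\phi_a)$ is $\theta$-stable (this does not depend on the trivializations). \textbf{Proposition.} Fix $v\in\mathbb N^{Q_0}$ with $v_0=1$ and $d\in\mathbb Z^{Q_0}$, and assume that $v_i\ne0$ for some $i\ne0$, or that $d_i=0$ for all $i\neq0$. Then there is $\tau_0>0$ such that for every $\tau\ge\tau_0$ and every framed twisted quiver sheaf $E$ with the moment map relation of type $(v,d)$, the following are equivalent: (1) $E$ is $\tau$-semistable; (2) $E$ is $\tau$-stable; (3) $E$ is stable as a twisted quasimap to the Nakajima quiver variety with $\theta=(1,\dots,1)$. -/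

import Mathlib

open CategoryTheory AlgebraicGeometry Opposite TopologicalSpace
open scoped TensorProduct

noncomputable section

namespace TwistedQuiver

section Sheaves

variable {X : Scheme.{0}}

/-- The presheaf `U ↦ M(U) ⊗ E(U)`. -/
def tensorPresheaf (M E : X.Modules) : X.PresheafOfModules :=
  PresheafOfModules.Monoidal.tensorObj (R := X.presheaf) M.val E.val

/-- The tensor product `M ⊗ E` of sheaves of `𝒪_X`-modules: the sheaf associated to
`U ↦ M(U) ⊗ E(U)`. -/
def tensor (M E : X.Modules) : X.Modules :=
  (PresheafOfModules.sheafification (𝟙 X.ringCatSheaf.obj)).obj (tensorPresheaf M E)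

/-- `Id_M ⊗ f : M ⊗ E ⟶ M ⊗ E'`. -/
def tensorMap (M : X.Modules) {E E' : X.Modules} (f : E ⟶ E') : tensor M E ⟶ tensor M E' :=
  (PresheafOfModules.sheafification (𝟙 X.ringCatSheaf.obj)).map
    (PresheafOfModules.Monoidal.tensorHom (R := X.presheaf) (𝟙 M.val) f.val :
      tensorPresheaf M E ⟶ tensorPresheaf M E')

lemma tensorMap_id (M E : X.Modules) : tensorMap M (𝟙 E) = 𝟙 (tensor M E) := by
  have : (PresheafOfModules.Monoidal.tensorHom (R := X.presheaf) (𝟙 M.val) (𝟙 E.val)) =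
      𝟙 (tensorPresheaf M E) :=
    MonoidalCategory.id_tensorHom_id (C := PresheafOfModules (X.presheaf ⋙ forget₂ _ _)) _ _
  exact (congrArg _ this).trans (CategoryTheory.Functor.map_id _ _)

lemma tensorMap_comp (M : X.Modules) {E E' E'' : X.Modules} (f : E ⟶ E') (g : E' ⟶ E'') :
    tensorMap M (f ≫ g) = tensorMap M f ≫ tensorMap M g := by
  have : (PresheafOfModules.Monoidal.tensorHom (R := X.presheaf) (𝟙 M.val) (f.val ≫ g.val)) =
      (PresheafOfModules.Monoidal.tensorHom (R := X.presheaf) (𝟙 M.val) f.val :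
        tensorPresheaf M E ⟶ tensorPresheaf M E') ≫
      (PresheafOfModules.Monoidal.tensorHom (R := X.presheaf) (𝟙 M.val) g.val :
        tensorPresheaf M E' ⟶ tensorPresheaf M E'') :=
    MonoidalCategory.whiskerLeft_comp (C := PresheafOfModules (X.presheaf ⋙ forget₂ _ _))
      M.val f.val g.val
  exact (congrArg _ this).trans (CategoryTheory.Functor.map_comp _ _ _)

/-- The section `m ⊗ e` of `M ⊗ E` over `U`. -/
def tmul {M E : X.Modules} {U : X.Opens} (m : Γ(M, U)) (e : Γ(E, U)) : Γ(tensor M E, U) :=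
  (CategoryTheory.toSheafify (Opens.grothendieckTopology X)
    (tensorPresheaf M E).presheaf).app (op U)
      (m ⊗ₜ[Γ(X, U)] e : Γ(M, U) ⊗[Γ(X, U)] Γ(E, U))

lemma map_tmul {M E : X.Modules} {U V : X.Opens} (i : V ⟶ U) (m : Γ(M, U)) (e : Γ(E, U)) :
    (tensor M E).presheaf.map i.op (tmul m e) =
      tmul (M.presheaf.map i.op m) (E.presheaf.map i.op e) := by
  have := ConcreteCategory.congr_hom ((CategoryTheory.toSheafify (Opens.grothendieckTopology X)
    (tensorPresheaf M E).presheaf).naturality i.op)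
      (m ⊗ₜ[Γ(X, U)] e : Γ(M, U) ⊗[Γ(X, U)] Γ(E, U))
  exact this.symm

lemma tensorMap_tmul (M : X.Modules) {E E' : X.Modules} (f : E ⟶ E') {U : X.Opens}
    (m : Γ(M, U)) (e : Γ(E, U)) :
    (tensorMap M f).app U (tmul m e) = tmul m (f.app U e) := by
  let g : tensorPresheaf M E ⟶ tensorPresheaf M E' :=
    PresheafOfModules.Monoidal.tensorHom (R := X.presheaf) (𝟙 M.val) f.val
  have h1 := CategoryTheory.toSheafify_naturality (Opens.grothendieckTopology X)
    ((PresheafOfModules.toPresheaf _).map g)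
  have h2 := ConcreteCategory.congr_hom (congr_app h1 (op U))
      (m ⊗ₜ[Γ(X, U)] e : Γ(M, U) ⊗[Γ(X, U)] Γ(E, U))
  exact h2.symm

instance stalkModule (M : X.Modules) (x : X) :
    Module (X.presheaf.stalk x) (M.presheaf.stalk x) :=
  PresheafOfModules.instModuleCarrierStalkCommRingCatCarrierAbPresheafOpensCarrier
    (R := X.presheaf) M.val x

lemma germ_smul (M : X.Modules) {U : X.Opens} (x : X) (hx : x ∈ U) (r : Γ(X, U)) (m : Γ(M, U)) :
    M.presheaf.germ U x hx (r • m) = X.presheaf.germ U x hx r • M.presheaf.germ U x hx m :=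
  PresheafOfModules.germ_smul (R := X.presheaf) M.val x U hx r m

/-- The germ at `x` of the section `m ⊗ e`, for germs `m ∈ M_x` and `e ∈ E_x`. -/
def stalkTmul {M E : X.Modules} {x : X} (m : M.presheaf.stalk x) (e : E.presheaf.stalk x) :
    (tensor M E).presheaf.stalk x :=
  let hm := M.presheaf.exists_germ_eq m
  let he := E.presheaf.exists_germ_eq e
  (tensor M E).presheaf.germ (hm.choose ⊓ he.choose) x
    ⟨hm.choose_spec.choose, he.choose_spec.choose⟩
    (tmul (M.presheaf.map (homOfLE inf_le_left).op hm.choose_spec.choose_spec.choose)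
      (E.presheaf.map (homOfLE inf_le_right).op he.choose_spec.choose_spec.choose))

lemma stalkTmul_germ {M E : X.Modules} {U : X.Opens} (x : X) (hx : x ∈ U)
    (m : Γ(M, U)) (e : Γ(E, U)) :
    stalkTmul (M.presheaf.germ U x hx m) (E.presheaf.germ U x hx e) =
      (tensor M E).presheaf.germ U x hx (tmul m e) := by
  generalize hm' : M.presheaf.germ U x hx m = m'
  generalize he' : E.presheaf.germ U x hx e = e'
  have hm := M.presheaf.exists_germ_eq m'
  have he := E.presheaf.exists_germ_eq e'
  have h1 := hm.choose_spec.choose_spec.choose_spec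
  have h2 := he.choose_spec.choose_spec.choose_spec
  obtain ⟨W, hxW, i1, i2, e1⟩ := M.presheaf.germ_eq x hm.choose_spec.choose hx _ _
    (h1.trans hm'.symm)
  obtain ⟨W', hxW', j1, j2, e2⟩ := E.presheaf.germ_eq x he.choose_spec.choose hx _ _
    (h2.trans he'.symm)
  have hle : W ⊓ W' ≤ hm.choose ⊓ he.choose :=
    le_inf (inf_le_left.trans i1.le) (inf_le_right.trans j1.le)
  have hle' : W ⊓ W' ≤ U := inf_le_left.trans i2.le
  rw [← (tensor M E).presheaf.germ_res_apply (homOfLE hle') x ⟨hxW, hxW'⟩, map_tmul]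
  unfold stalkTmul
  dsimp only
  rw [← (tensor M E).presheaf.germ_res_apply (homOfLE hle) x ⟨hxW, hxW'⟩, map_tmul]
  congr 2
  · rw [← ConcreteCategory.comp_apply, ← Functor.map_comp]
    have := congrArg (M.presheaf.map (homOfLE (inf_le_left : W ⊓ W' ≤ W)).op) e1
    rw [← ConcreteCategory.comp_apply, ← ConcreteCategory.comp_apply, ← Functor.map_comp,
      ← Functor.map_comp] at this
    exact this
  · rw [← ConcreteCategory.comp_apply, ← Functor.map_comp]
    have := congrArg (E.presheaf.map (homOfLE (inf_le_right : W ⊓ W' ≤ W')).op) e2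
    rw [← ConcreteCategory.comp_apply, ← ConcreteCategory.comp_apply, ← Functor.map_comp,
      ← Functor.map_comp] at this
    exact this

/-- The map `E_x ⟶ E'_x` on stalks induced by `f : E ⟶ E'`. -/
def stalkMap {E E' : X.Modules} (f : E ⟶ E') (x : X) :
    E.presheaf.stalk x ⟶ E'.presheaf.stalk x :=
  (TopCat.Presheaf.stalkFunctor Ab x).map f.mapPresheaf

/-- A coherent sheaf of modules (on the locally noetherian schemes considered here this is the same
as a sheaf of modules locally of finite presentation). -/
def IsCoherent (E : X.Modules) : Prop := SheafOfModules.IsFinitePresentation E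

/-- Locally free sheaves. -/
def IsLocallyFree (E : X.Modules) : Prop := SheafOfModules.IsLocallyFree E

/-- The structure sheaf, as a sheaf of modules. -/
def structureSheaf (X : Scheme.{0}) : X.Modules := SheafOfModules.unit X.ringCatSheaf

/-- The free sheaf `𝒪_X^{⊕ r}`. -/
def freeSheaf (X : Scheme.{0}) (r : ℕ) : X.Modules :=
  SheafOfModules.free (R := X.ringCatSheaf) (Fin r)

section Integral

variable [IsIntegral X]

/-- The stalk of `E` at the generic point, a vector space over the function field. -/
abbrev genericStalk (E : X.Modules) : Ab := E.presheaf.stalk (genericPoint X)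

instance (E : X.Modules) : Module X.functionField (genericStalk E) :=
  stalkModule E (genericPoint X)

/-- The rank of `E`: the dimension of its generic stalk. -/
def rank (E : X.Modules) : ℕ := Module.finrank X.functionField (genericStalk E)

/-- A line bundle: a locally free sheaf of rank one. -/
def IsLineBundle (M : X.Modules) : Prop := IsLocallyFree M ∧ rank M = 1

/-- The map `E_x → E_η` from the stalk at `x` to the stalk at the generic point `η`. -/
def toGeneric (E : X.Modules) (x : X) : E.presheaf.stalk x ⟶ genericStalk E :=
  E.presheaf.stalkSpecializes ((genericPoint_spec X).specializes trivial)

lemma toGeneric_smul (E : X.Modules) (x : X) (r : X.presheaf.stalk x) (e : E.presheaf.stalk x) :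
    toGeneric E x (r • e) = algebraMap (X.presheaf.stalk x) X.functionField r • toGeneric E x e := by
  obtain ⟨U, hU, s, rfl⟩ := X.presheaf.exists_germ_eq r
  obtain ⟨V, hV, t, rfl⟩ := E.presheaf.exists_germ_eq e
  let W := U ⊓ V
  have hW : x ∈ W := ⟨hU, hV⟩
  rw [← X.presheaf.germ_res_apply (homOfLE (inf_le_left : W ≤ U)) x hW,
    ← E.presheaf.germ_res_apply (homOfLE (inf_le_right : W ≤ V)) x hW, ← germ_smul]
  have hs := (genericPoint_spec X).specializes (Set.mem_univ x)
  unfold toGeneric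
  have key : ∀ t : Γ(E, W), E.presheaf.stalkSpecializes hs (E.presheaf.germ W x hW t) =
      E.presheaf.germ W _ (hs.mem_open W.isOpen hW) t := fun t ↦ by
    rw [← ConcreteCategory.comp_apply, E.presheaf.germ_stalkSpecializes]
  rw [key, key, germ_smul]
  congr 1
  rw [RingHom.algebraMap_toAlgebra]
  exact (ConcreteCategory.congr_hom (X.presheaf.germ_stalkSpecializes (U := W) hW hs) _).symm

/-- Let `s : M → V` be a linear map from a module over a local ring `O` to a vector space `V` over
its fraction field `K`, and `b` a basis of `V`. With `L = s(M)` and `Λ = ∑ O bᵢ`, this is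
`length (ker s) + length (L / L ∩ Λ) - length (Λ / L ∩ Λ)`. -/
def relativeLength {O M V ι : Type*} [CommRing O] [AddCommGroup M] [Module O M] [AddCommGroup V]
    [Module O V] (s : M →ₗ[O] V) (b : ι → V) : ℤ :=
  let L := LinearMap.range s
  let Λ := Submodule.span O (Set.range b)
  ((Module.length O (LinearMap.ker s)).toNat : ℤ) + (Module.length O (L ⧸ Λ.submoduleOf L)).toNat
    - (Module.length O (Λ ⧸ L.submoduleOf Λ)).toNat

/-- The contribution at `x` to the degree of `E`, measured with respect to the family `b` of
rational sections: the length of the torsion of `E_x`, plus the (signed) relative length of the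
lattices `E_x / torsion` and `∑ 𝒪_{X,x} bᵢ` in the generic stalk. For a line bundle and a rational
section `b` this is the order of `b` at `x`. -/
def localDegree (E : X.Modules) {ι : Type*} (b : ι → genericStalk E) (x : X) : ℤ :=
  letI : Module (X.presheaf.stalk x) (genericStalk E) :=
    Module.compHom _ (algebraMap (X.presheaf.stalk x) X.functionField)
  relativeLength (O := X.presheaf.stalk x)
    { toFun := toGeneric E x
      map_add' := map_add _
      map_smul' := toGeneric_smul E x : E.presheaf.stalk x →ₗ[X.presheaf.stalk x] genericStalk E } b

/-- The degree of a coherent sheaf `E` on a smooth projective curve over `ℂ`: choose a basis of the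
generic stalk and add up the local contributions of all closed points. As principal divisors have
degree zero, this does not depend on the basis; it is the length for a torsion sheaf, the degree of
the divisor of a rational section for a line bundle, and equals `χ(E) - rk(E) χ(𝒪_X)`. -/
def degree (E : X.Modules) : ℤ :=
  ∑ᶠ x : {x : X // IsClosed {x}},
    localDegree E (Module.Free.chooseBasis X.functionField (genericStalk E)) x.1

end Integral

/-- The constant presheaf `ℂ` on a scheme over `ℂ`, mapping to the structure sheaf. -/
def constantsTo (f : X ⟶ Spec (.of ℂ)) :
    (Functor.const (X.Opens)ᵒᵖ).obj (CommRingCat.of ℂ) ⟶ X.presheaf where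
  app U := (Scheme.ΓSpecIso (.of ℂ)).inv ≫ f.appTop ≫ X.presheaf.map (homOfLE le_top).op
  naturality U V i := by
    simp only [Functor.const_obj_map, Category.assoc, ← Functor.map_comp]
    rfl

/-- The canonical sheaf `K_X = Ω_{X/ℂ}` of a smooth curve `X` over `ℂ`: the sheaf associated to the
presheaf of Kähler differentials `U ↦ Ω_{𝒪_X(U)/ℂ}`. -/
def canonicalSheaf (f : X ⟶ Spec (.of ℂ)) : X.Modules :=
  (PresheafOfModules.sheafification (𝟙 X.ringCatSheaf.obj)).obj
    (PresheafOfModules.DifferentialsConstruction.relativeDifferentials' (constantsTo f))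

end Sheaves

section Quiver

variable {I : Type} [Quiver.{0} I]

/-- The arrows `i → j` of the doubled quiver: the arrows `a : i → j` of the quiver (as `inl a`), and
an opposite arrow `ā : i → j` (as `inr a`) for each arrow `a : j → i`. -/
abbrev DArrow (i j : I) : Type := (i ⟶ j) ⊕ (j ⟶ i)

/-- The involution `a ↦ ā`. -/
abbrev bar {i j : I} (a : DArrow i j) : DArrow j i := a.swap

/-- The sign `(-1)^{|a|}`: `1` on the original arrows, `-1` on the added ones. -/
def sign {i j : I} (a : DArrow i j) : ℤ := Sum.elim (fun _ ↦ 1) (fun _ ↦ -1) a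

end Quiver

/-- The twisting data on a curve `X`: a line bundle `M_a` for each arrow of the doubled quiver, an
inverse `K_X^{-1}` of the canonical bundle, and an isomorphism `M_a ⊗ M_ā ≅ K_X^{-1}` for each arrow
of the original quiver. -/
structure Twist {X : Scheme.{0}} [IsIntegral X] (f : X ⟶ Spec (.of ℂ)) (I : Type)
    [Quiver.{0} I] where
  M : ∀ {i j : I}, DArrow i j → X.Modules
  isLineBundle : ∀ {i j : I} (a : DArrow i j), IsLineBundle (M a)
  Kinv : X.Modules
  kinvIso : tensor Kinv (canonicalSheaf f) ≅ structureSheaf X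
  contract : ∀ {i j : I} (a : i ⟶ j),
    tensor (M (.inl a : DArrow i j)) (M (.inr a : DArrow j i)) ≅ Kinv

variable {X : Scheme.{0}} [IsIntegral X] {f : X ⟶ Spec (.of ℂ)} {I : Type} [Quiver.{0} I]

/-- The local section of `K_X^{-1}` given by sections `m` of `M_a` and `m'` of `M_ā`, for an arrow
`a` of the doubled quiver. -/
def Twist.pair (T : Twist f I) {U : X.Opens} :
    ∀ {i j : I} (a : DArrow i j), Γ(T.M a, U) → Γ(T.M (bar a), U) → Γ(T.Kinv, U)
  | _, _, .inl a, m, m' => (T.contract a).hom.app U (tmul m m')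
  | _, _, .inr a, m, m' => (T.contract a).hom.app U (tmul m' m)

/-- The moment map relation at the vertex `i`, that is
`∑_{a : h(a) = i} (-1)^{|a|} φ_a ∘ (Id_{M_a} ⊗ φ_ā) = 0` as a morphism `K_X^{-1} ⊗ E_i ⟶ E_i`, where
the source `M_a ⊗ M_ā ⊗ E_i` of each summand is identified with `K_X^{-1} ⊗ E_i`. It is expressed on
local sections: as the `M_a` are line bundles, each section `κ` of `K_X^{-1}` is, locally, the image
of a section `m_a ⊗ m_ā` of `M_a ⊗ M_ā` for all the arrows `a` at once, and then the left hand side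
maps `κ ⊗ e` to `∑ (-1)^{|a|} φ_a (m_a ⊗ φ_ā (m_ā ⊗ e))`. -/
def MomentMapRelation [Fintype I] [∀ i j : I, Fintype (i ⟶ j)] (T : Twist f I) (E : I → X.Modules)
    (φ : ∀ {i j : I} (a : DArrow i j), tensor (T.M a) (E i) ⟶ E j) (i : I) : Prop :=
  ∀ (U : X.Opens) (κ : Γ(T.Kinv, U)) (e : Γ(E i, U))
    (m : ∀ (j : I) (a : DArrow j i), Γ(T.M a, U))
    (m' : ∀ (j : I) (a : DArrow j i), Γ(T.M (bar a), U)),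
    (∀ j a, T.pair a (m j a) (m' j a) = κ) →
    ∑ j, ∑ a : DArrow j i,
      sign a • (φ a).app U (tmul (m j a) ((φ (bar a)).app U (tmul (m' j a) e))) = 0

/-- Framed twisted quiver sheaves on `X` with the moment map relation, with framing vertex `o`. -/
structure QuiverSheaf [Fintype I] [∀ i j : I, Fintype (i ⟶ j)] (T : Twist f I) (o : I) where
  E : I → X.Modules
  coherent : ∀ i, IsCoherent (E i)
  φ : ∀ {i j : I} (a : DArrow i j), tensor (T.M a) (E i) ⟶ E j
  moment : ∀ i, i ≠ o → MomentMapRelation T E φ i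
  framed : ∃ r : ℕ, Nonempty (E o ≅ freeSheaf X r)

namespace QuiverSheaf

variable [Fintype I] [∀ i j : I, Fintype (i ⟶ j)] {T : Twist f I} {o : I}

/-- Morphisms of quiver sheaves: families of `𝒪_X`-homomorphisms compatible with the `φ_a`. -/
@[ext]
structure Hom (F G : QuiverSheaf T o) where
  app : ∀ i, F.E i ⟶ G.E i
  comm : ∀ {i j : I} (a : DArrow i j), F.φ a ≫ app j = tensorMap (T.M a) (app i) ≫ G.φ a

/-- The category `𝒜` of quiver sheaves. -/
instance : Category (QuiverSheaf T o) where
  Hom := Hom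
  id F := ⟨fun i ↦ 𝟙 _, fun a ↦ by rw [tensorMap_id, Category.comp_id, Category.id_comp]⟩
  comp g h := ⟨fun i ↦ g.app i ≫ h.app i, fun a ↦ by
    rw [tensorMap_comp, ← Category.assoc, g.comm, Category.assoc, h.comm, Category.assoc]⟩
  id_comp _ := Hom.ext (funext fun _ ↦ Category.id_comp _)
  comp_id _ := Hom.ext (funext fun _ ↦ Category.comp_id _)
  assoc _ _ _ := Hom.ext (funext fun _ ↦ Category.assoc _ _ _)

/-- The quiver sheaf `F` has dimension vector `v` and degree vector `d`. -/
def HasType (F : QuiverSheaf T o) (v : I → ℕ) (d : I → ℤ) : Prop :=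
  ∀ i, rank (F.E i) = v i ∧ degree (F.E i) = d i

variable [DecidableEq I]

/-- The stability function
`Z(F) = ∑_{i ≠ o} rk E_i + √-1 (∑_{i ≠ o} deg E_i + τ rk E_o)`. -/
def Z (τ : ℝ) (F : QuiverSheaf T o) : ℂ :=
  (∑ i ∈ Finset.univ.erase o, (rank (F.E i) : ℂ)) +
    Complex.I * ((∑ i ∈ Finset.univ.erase o, (degree (F.E i) : ℂ)) + τ * rank (F.E o))

/-- `τ`-stability: `F` is nonzero and `Arg Z(F') < Arg Z(F)` for all nonzero proper subobjects
`F'`. -/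
def IsStable (τ : ℝ) (F : QuiverSheaf T o) : Prop :=
  ¬ Limits.IsZero F ∧ ∀ (F' : QuiverSheaf T o) (ι : F' ⟶ F), Mono ι → ¬ IsIso ι →
    ¬ Limits.IsZero F' → (Z τ F').arg < (Z τ F).arg

/-- `τ`-semistability: `F` is nonzero and `Arg Z(F') ≤ Arg Z(F)` for all nonzero proper subobjects
`F'`. -/
def IsSemistable (τ : ℝ) (F : QuiverSheaf T o) : Prop :=
  ¬ Limits.IsZero F ∧ ∀ (F' : QuiverSheaf T o) (ι : F' ⟶ F), Mono ι → ¬ IsIso ι →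
    ¬ Limits.IsZero F' → (Z τ F').arg ≤ (Z τ F).arg

end QuiverSheaf

/-! ### Stability of points of the representation space -/

section GIT

variable {k : Type} [Field k] {n : I → ℕ} {o : I}

/-- The `k`-points of `V = ⨁_a Hom(k^{n(t(a))}, k^{n(h(a))})`, the sum over all arrows of the doubled
quiver. -/
abbrev Rep (I : Type) [Quiver.{0} I] (n : I → ℕ) (k : Type) : Type :=
  ∀ (i j : I), DArrow i j → Matrix (Fin (n j)) (Fin (n i)) k

/-- The `k`-points of `G = ∏_{i ≠ o} GL_{n(i)}`. -/
abbrev Gauge {I : Type} (o : I) (n : I → ℕ) (k : Type) [Field k] : Type :=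
  ∀ i : {i : I // i ≠ o}, GL (Fin (n i.1)) k

variable [DecidableEq I]

/-- The component of `g` at any vertex, which is `1` at the framing vertex. -/
def Gauge.at (g : Gauge o n k) (i : I) : GL (Fin (n i)) k :=
  if h : i ≠ o then g ⟨i, h⟩ else 1

/-- The action of `G` on `V`. -/
def Gauge.act (g : Gauge o n k) (x : Rep I n k) : Rep I n k :=
  fun i j a ↦ (g.at j).val * x i j a * (g.at i)⁻¹.val

variable [Fintype I]

/-- The character `g ↦ ∏ det(g_i) ^ θ_i` of `G`. -/
def Gauge.character (θ : {i : I // i ≠ o} → ℤ) (g : Gauge o n k) : kˣ :=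
  ∏ i, Matrix.GeneralLinearGroup.det (g i) ^ θ i

/-- The coordinates of the affine space `V × 𝔸¹`; `none` is the one of the factor `𝔸¹`. -/
abbrev Coord (I : Type) [Quiver.{0} I] (n : I → ℕ) : Type :=
  Option (Σ (i j : I) (_ : DArrow i j), Fin (n j) × Fin (n i))

/-- The point `(x, z)` of `V × 𝔸¹`, in coordinates. -/
def affinePoint (x : Rep I n k) (z : k) : Coord I n → k
  | none => z
  | some ⟨i, j, a, r, s⟩ => x i j a r s

/-- A homomorphism `kˣ → G(k)` is algebraic if its matrix entries are Laurent polynomials. -/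
def IsOneParameterSubgroup (c : kˣ →* Gauge o n k) : Prop :=
  ∃ P : ∀ i : {i : I // i ≠ o}, Matrix (Fin (n i.1)) (Fin (n i.1)) (LaurentPolynomial k),
    ∀ (t : kˣ) (i) (r s), (c t i : Matrix _ _ k) r s = LaurentPolynomial.eval₂ (RingHom.id k) t (P i r s)

/-- Zariski closed subsets of an affine space. -/
def IsZariskiClosed {σ : Type} (S : Set (σ → k)) : Prop :=
  ∃ J : Set (MvPolynomial σ k), S = {p | ∀ q ∈ J, MvPolynomial.eval p q = 0}

/-- `θ`-stability of a point `x` of `V` over an algebraically closed field `k`: for every one-parameter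
subgroup `c` of `G`, the orbit of `(x, 1)` under `c` is closed in `V × 𝔸¹`, where `G` acts on the
factor `𝔸¹` through the inverse of the character `θ`. -/
def IsThetaStable (o : I) (θ : {i : I // i ≠ o} → ℤ) (x : Rep I n k) : Prop :=
  ∀ c : kˣ →* Gauge o n k, IsOneParameterSubgroup c →
    IsZariskiClosed
      (Set.range fun t ↦ affinePoint ((c t).act x) (((c t).character θ)⁻¹ : kˣ))

end GIT

namespace QuiverSheaf

variable [Fintype I] [∀ i j : I, Fintype (i ⟶ j)] {T : Twist f I} {o : I}

/-- The point of `V` over the function field given by the quiver sheaf `F` at the generic point of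
`X`, after a choice of a basis `b i` of each generic stalk of `E_i` and of a trivialization of each
line bundle `M_a` near the generic point, by a nonzero germ `m a`. -/
def genericRep (F : QuiverSheaf T o) {n : I → ℕ}
    (b : ∀ i, Module.Basis (Fin (n i)) X.functionField (genericStalk (F.E i)))
    (m : ∀ (i j : I) (a : DArrow i j), genericStalk (T.M a)) : Rep I n X.functionField :=
  fun i j a ↦ Matrix.of fun r s ↦
    (b j).repr (stalkMap (F.φ a) (genericPoint X) (stalkTmul (m i j a) (b i s))) r

variable [DecidableEq I]

/-- Stability of `F` as a twisted quasimap to the quiver variety of the parameter `θ`: all the `E_i`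
are vector bundles, and the generic point of `X` lands in the `θ`-stable locus, whatever the
trivializations. The latter is tested on the geometric point of `V` over the generic point. -/
def IsStableQuasimap (θ : {i : I // i ≠ o} → ℤ) (F : QuiverSheaf T o) : Prop :=
  (∀ i, IsLocallyFree (F.E i)) ∧
    ∀ (b : ∀ i, Module.Basis (Fin (rank (F.E i))) X.functionField (genericStalk (F.E i)))
      (m : ∀ (i j : I) (a : DArrow i j), genericStalk (T.M a)), (∀ i j a, m i j a ≠ 0) →
      IsThetaStable o θ fun i j a ↦
        (F.genericRep b m i j a).map (algebraMap X.functionField (AlgebraicClosure X.functionField))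

end QuiverSheaf

end TwistedQuiver

end
open TwistedQuiver

/-!
Let `K` be the function field of the curve `X`. A quiver sheaf `F` has, after rational sections of
the twists `M_a` have been chosen, a representation of the doubled quiver on the generic stalks of
the `E_i`. All three conditions turn out to be equivalent to the following one: `F` is torsion-free,
hence locally free, and its representation over `K` is generated by the framing, i.e. no proper
subrepresentation contains the generic stalk of `E_o` (`IsGenericallyGenerated`).

*Quasimaps.* For the character `∏ det`, a point of the representation space over an algebraically
closed field is stable if and only if it is generated by the framing. If a subrepresentation
contains the framing, then the one-parameter subgroup scaling a complement of it contracts the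
point, and the limit is not on the orbit. If there is no such subrepresentation, then the orbit map
of a nontrivial one-parameter subgroup has a pole at `0` and one at `∞`, and its coordinates make
`k[T, T⁻¹]` integral over the coordinate ring of the closure of the orbit, so that the orbit is
closed. Generation is insensitive to the passage from `K` to its algebraic closure
(`isThetaStable_map_iff`), and the stable quasimaps are as claimed (`isStableQuasimap_iff`).

*Subobjects.* Subrepresentations over `K` correspond to saturated subobjects: `genericSub E W`
consists of the sections of `E` lying in `W` generically. The framing of a subobject has to be a
free sheaf. This is automatic for the kernel of a morphism, because the global functions on `X` form
a field (`exists_iso_genericSub_ker`), and therefore monomorphisms are injective on all stalks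
(`stalkMap_injective_of_mono`).

*Bounds.* If `F` is generated by the framing, then the generic stalks are spanned by the images of
one vector under paths of length at most the total rank (`pathSpan_eq_top`). The poles of these
images are bounded in terms of the twists `M_a` alone, and a sheaf generically generated by sections
with bounded poles has degree bounded below (`le_degree_of_isGenericallyGenerated`). As the total
degree is fixed, this also bounds the degrees of subsheaves from above
(`degree_le_of_isGenericallyGenerated`). Bounds on degrees rest on the comparison of lattices in the
generic stalk at all closed points, and the degree does not depend on the basis used to compute it
by the product formula (`finsum_ordZ_stalk_eq_zero`).

*Semistability implies generation.* The torsion of `F` is a subobject of phase `π / 2`, or zero, so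
it vanishes if `F` is semistable (`toGeneric_injective_of_isSemistable`). The saturated subobject
generated by the framing has degree bounded below and the same framing as `F`; if its rank is
smaller, then its slope exceeds that of `F` for large `τ`
(`isGenericallyGenerated_of_isSemistable`).

*Generation implies stability.* The slope of a subobject with zero framing is bounded independently
of `τ`, while that of `F` grows with `τ`. A subobject with nonzero framing contains the generic
stalk of `E_o`, so that it has full rank, and its degree is smaller unless it is all of `F`
(`isStable_of_isGenericallyGenerated`).
-/

noncomputable section

set_option linter.unusedSectionVars false

namespace TwistedQuiver

/-! ### Sections of coherent and locally free sheaves over affine opens -/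

section Free

universe u v₁ v₂ u₁ u₂

variable {C : Type u₁} [Category.{v₁} C] {J : GrothendieckTopology C} {R : Sheaf J RingCat.{u}}
  [HasWeakSheafify J AddCommGrpCat.{u}] [J.WEqualsLocallyBijective AddCommGrpCat.{u}]
  {C' : Type u₂} [Category.{v₂} C'] {J' : GrothendieckTopology C'} {S : Sheaf J' RingCat.{u}}
  [HasSheafify J' AddCommGrpCat.{u}] [J'.WEqualsLocallyBijective AddCommGrpCat.{u}]
  [HasSheafify J AddCommGrpCat.{u}]

lemma exists_generatingSections_of_iso {M : SheafOfModules.{u} R} {κ : Type u}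
    (e : SheafOfModules.free κ ≅ M) : ∃ σ : M.GeneratingSections, IsIso σ.π := by
  refine ⟨(SheafOfModules.free.generatingSections (R := R) κ).ofEpi e.hom, ?_⟩
  rw [SheafOfModules.GeneratingSections.ofEpi_π, SheafOfModules.free.generatingSections_π]
  exact (inferInstance : IsIso (𝟙 _ ≫ e.hom))

/-- A cocontinuous functor which preserves the unit maps free sheaves to free sheaves. -/
def freeIsoMap {M : SheafOfModules.{u} R} {κ : Type u}
    (F : SheafOfModules.{u} R ⥤ SheafOfModules.{u} S)
    (hF : Limits.PreservesColimitsOfSize.{u, u} F)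
    (η : SheafOfModules.unit S ≅ F.obj (SheafOfModules.unit R))
    (e : SheafOfModules.free κ ≅ M) : SheafOfModules.free κ ≅ F.obj M :=
  SheafOfModules.mapFreeIso F κ η ≪≫ F.mapIso e

end Free

section AffineLocal

variable {X : Scheme.{0}}

lemma res_smul (E : X.Modules) {U V : X.Opens} (h : V ≤ U) (r : Γ(X, U)) (s : Γ(E, U)) :
    E.presheaf.map (homOfLE h).op (r • s) =
      X.presheaf.map (homOfLE h).op r • E.presheaf.map (homOfLE h).op s :=
  Scheme.Modules.map_smul E (homOfLE h) r s

lemma res_res (E : X.Modules) {U V W : X.Opens} (h : V ≤ U) (h' : W ≤ V) (s : Γ(E, U)) :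
    E.presheaf.map (homOfLE h').op (E.presheaf.map (homOfLE h).op s) =
      E.presheaf.map (homOfLE (h'.trans h)).op s := by
  rw [← ConcreteCategory.comp_apply, ← Functor.map_comp]; rfl

/-- Sections of `E` over the basic opens of `U` are fractions of sections over `U`. -/
def LocalizesOn (E : X.Modules) (U : X.Opens) : Prop :=
  ∀ f : Γ(X, U),
    (∀ s : Γ(E, X.basicOpen f), ∃ (n : ℕ) (t : Γ(E, U)),
      E.presheaf.map (homOfLE (X.basicOpen_le f)).op t =
        X.presheaf.map (homOfLE (X.basicOpen_le f)).op (f ^ n) • s) ∧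
    (∀ t : Γ(E, U), E.presheaf.map (homOfLE (X.basicOpen_le f)).op t = 0 → ∃ n : ℕ, f ^ n • t = 0)

variable {U : X.Opens} (hU : IsAffineOpen U)

lemma smul_restrict_fromSpec (E : X.Modules) (V : (Spec Γ(X, U)).Opens) (r : Γ(X, U))
    (s : Γ(E.restrict hU.fromSpec, V)) (h : hU.fromSpec ''ᵁ V ≤ U) :
    (E.restrictAppIso hU.fromSpec V).hom (r • s) =
      X.presheaf.map (homOfLE h).op r • (E.restrictAppIso hU.fromSpec V).hom s := by
  rw [Scheme.Modules.smul_Spec_def]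
  have := Scheme.Modules.smul_restrictAppIso_hom_apply hU.fromSpec E V
    (((Spec Γ(X, U)).presheaf.map V.leTop.op) ((Scheme.ΓSpecIso Γ(X, U)).inv r)) s
  refine this.trans ?_
  have key : (Scheme.ΓSpecIso Γ(X, U)).inv ≫ (Spec Γ(X, U)).presheaf.map V.leTop.op ≫
      (hU.fromSpec.appIso V).inv = X.presheaf.map (homOfLE h).op := by
    rw [← Category.assoc, Iso.comp_inv_eq, Scheme.Hom.appIso_hom', Scheme.Hom.map_appLE,
      Scheme.Hom.appLE, IsAffineOpen.fromSpec_app_self, Category.assoc, ← Functor.map_comp]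
    rfl
  have k2 := congr($(key) r)
  rw [← k2]
  rfl

/-- A restatement of `LocalizesOn` in terms of opens `A` and `B f` which are only propositionally
equal to `U` and to its basic opens, such as the images of opens of the spectrum. -/
lemma localizesOn_iff_of_eq (E : X.Modules) (A : X.Opens) (B : Γ(X, U) → X.Opens) (hA : A = U)
    (hB : ∀ f, B f = X.basicOpen f) (hBA : ∀ f, B f ≤ A) :
    LocalizesOn E U ↔ ∀ f : Γ(X, U),
    (∀ s : Γ(E, B f), ∃ (n : ℕ) (t : Γ(E, A)),
      E.presheaf.map (homOfLE (hBA f)).op t =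
        X.presheaf.map (homOfLE ((hBA f).trans hA.le)).op (f ^ n) • s) ∧
    (∀ t : Γ(E, A), E.presheaf.map (homOfLE (hBA f)).op t = 0 →
      ∃ n : ℕ, X.presheaf.map (homOfLE hA.le).op (f ^ n) • t = 0) := by
  subst hA
  obtain rfl : B = fun f ↦ X.basicOpen f := funext hB
  have : X.presheaf.map (homOfLE (le_refl A)).op = 𝟙 _ := X.presheaf.map_id _
  simp only [this]
  rfl

/-- `LocalizesOn E U` says that the restriction of `E` to `Spec 𝒪(U)` is the sheaf associated to its
module of global sections. -/
lemma localizesOn_iff (E : X.Modules) :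
    LocalizesOn E U ↔ IsLocalizing (modulesSpecToSheaf.obj (E.restrict hU.fromSpec)) := by
  rw [localizesOn_iff_of_eq E (hU.fromSpec ''ᵁ ⊤)
    (fun f ↦ hU.fromSpec ''ᵁ (PrimeSpectrum.basicOpen f))
    (by rw [Scheme.Hom.image_top_eq_opensRange, hU.opensRange_fromSpec])
    (fun f ↦ hU.fromSpec_image_basicOpen f) (fun f ↦ Scheme.Hom.image_mono _ le_top)]
  have hle (V) : hU.fromSpec ''ᵁ V ≤ U :=
    (Scheme.Hom.image_le_opensRange hU.fromSpec V).trans hU.opensRange_fromSpec.le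
  have e1 (V) (r : Γ(X, U)) (s : Γ(E.restrict hU.fromSpec, V)) :
      (E.restrictAppIso hU.fromSpec V).hom (r • s) =
        X.presheaf.map (homOfLE (hle V)).op r • (E.restrictAppIso hU.fromSpec V).hom s :=
    smul_restrict_fromSpec hU E V r s (hle V)
  refine ⟨fun h f ↦ ?_, fun h f ↦ ?_⟩
  · refine IsLocalizedModule.Away.mk_of_addCommGroup ?_ ?_ ?_
    · exact Scheme.Modules.isUnit_algebraMap_end_of_le_basicOpen f le_rfl
    · intro s
      obtain ⟨n, t, ht⟩ := (h f).1 s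
      exact ⟨n, t, (e1 _ _ _).trans ht.symm⟩
    · intro t ht
      obtain ⟨n, hn⟩ := (h f).2 t ht
      exact ⟨n, (e1 _ _ _).trans hn⟩
  · refine ⟨fun s ↦ ?_, fun t ht ↦ ?_⟩
    · obtain ⟨⟨t, _, n, rfl⟩, ht⟩ := (h f).surj s
      exact ⟨n, t, ht.symm.trans (e1 _ _ _)⟩
    · obtain ⟨⟨_, n, rfl⟩, hn⟩ := (IsLocalizedModule.eq_zero_iff (.powers f)
        ((modulesSpecToSheaf.obj (E.restrict hU.fromSpec)).obj.map
          (PrimeSpectrum.basicOpen f).leTop.op).hom).mp ht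
      exact ⟨n, (e1 _ _ _).symm.trans hn⟩

include hU in
lemma localizesOn_of_isQuasicoherent (E : X.Modules) [SheafOfModules.IsQuasicoherent E] :
    LocalizesOn E U := by
  have : (E.restrict hU.fromSpec).IsQuasicoherent :=
    Scheme.Modules.isQuasicoherent_restrictFunctor hU.fromSpec E
  rw [localizesOn_iff hU, ← isIso_fromTildeΓ_iff_isLocalizing]
  infer_instance

/-- Restriction of modules over `W` to an affine open `U ≤ W`, viewed as the spectrum of
its ring of sections. -/
def overRestrict {W : X.Opens} (hUW : U ≤ W) :
    SheafOfModules (X.ringCatSheaf.over W) ⥤ SheafOfModules (Spec Γ(X, U)).ringCatSheaf :=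
  (Scheme.Modules.overEquiv W).functor ⋙
    Scheme.Modules.restrictFunctor (hU.isoSpec.inv ≫ X.homOfLE hUW)

instance overRestrict_preservesColimits {W : X.Opens} (hUW : U ≤ W) :
    Limits.PreservesColimitsOfSize.{0, 0} (overRestrict hU hUW) := by
  have : Limits.PreservesColimitsOfSize.{0, 0}
    (Scheme.Modules.restrictFunctor (hU.isoSpec.inv ≫ X.homOfLE hUW)) := inferInstance
  exact @Limits.comp_preservesColimits _ _ _ _ _ _ _ _ (by infer_instance) this

/-- The two ways of restricting `E` to an affine open `U ≤ W` agree. -/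
def overRestrictIso (E : X.Modules) {W : X.Opens} (hUW : U ≤ W) :
    (overRestrict hU hUW).obj (SheafOfModules.over E W) ≅
      (show SheafOfModules (Spec Γ(X, U)).ringCatSheaf from E.restrict hU.fromSpec) :=
  let iso : SheafOfModules.overFunctor X.ringCatSheaf W ⋙ overRestrict hU hUW ≅
        Scheme.Modules.restrictFunctor hU.fromSpec :=
    (Functor.associator _ _ _).symm ≪≫
        Functor.isoWhiskerRight (Scheme.Modules.overFunctorEquiv _) _ ≪≫
        (Scheme.Modules.restrictFunctorComp _ _).symm ≪≫
        (Scheme.Modules.restrictFunctorCongr (by simp [IsAffineOpen.isoSpec_inv_ι]))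
  iso.app E

/-- The structure sheaf restricts to the structure sheaf. -/
def overRestrictUnitIso {W : X.Opens} (hUW : U ≤ W) :
    SheafOfModules.unit (Spec Γ(X, U)).ringCatSheaf ≅
      (overRestrict hU hUW).obj (SheafOfModules.unit (X.ringCatSheaf.over W)) :=
  (Scheme.Modules.restrictUnitIso _).symm

lemma exists_affine_le {x : X} {W : X.Opens} (hx : x ∈ W) :
    ∃ U : X.Opens, IsAffineOpen U ∧ x ∈ U ∧ U ≤ W := by
  obtain ⟨_, ⟨A, hA, rfl⟩, hxA, hAU⟩ := X.isBasis_affineOpens.exists_subset_of_mem_open hx W.isOpen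
  exact ⟨A, hA, hxA, hAU⟩

/-- The associated sheaf functor on an affine scheme is full and reflects epimorphisms, so that
finitely many sections which generate a quasi-coherent sheaf generate its module of global sections.
-/
lemma finite_of_generatingSections {R : CommRingCat.{0}} (M : (Spec R).Modules) [M.IsQuasicoherent]
    (σ : SheafOfModules.GeneratingSections M) [σ.IsFiniteType] :
    Module.Finite R Γ(M, ⊤) := by
  have := SheafOfModules.GeneratingSections.IsFiniteType.finite (σ := σ)
  have hq : IsIso M.fromTildeΓ := Scheme.Modules.isIso_fromTildeΓ_of_isQuasicoherent M
  let N := (modulesSpecToSheaf.obj M).presheaf.obj (.op ⊤)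
  let p : (SheafOfModules.free σ.I : (Spec R).Modules) ⟶ M := σ.π
  have hp : Epi p := σ.epi
  let e : tilde (ModuleCat.of R (σ.I →₀ R)) ≅ (SheafOfModules.free σ.I : (Spec R).Modules) :=
    tildeFinsupp σ.I
  let g : tilde (ModuleCat.of R (σ.I →₀ R)) ⟶ tilde N :=
    e.hom ≫ p ≫ inv M.fromTildeΓ
  have he : IsIso e.hom := ⟨⟨e.inv, e.hom_inv_id, e.inv_hom_id⟩⟩
  have he' : Epi e.hom := @IsIso.epi_of_iso _ _ _ _ e.hom he
  have hi : Epi (inv M.fromTildeΓ) := @IsIso.epi_of_iso _ _ _ _ _ (@IsIso.inv_isIso _ _ _ _ _ hq)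
  have hg : Epi g := @epi_comp _ _ _ _ _ e.hom he' _ (@epi_comp _ _ _ _ _ p hp _ hi)
  obtain ⟨h, hh⟩ := (tilde.functor R).map_surjective g
  have h2 : Epi ((tilde.functor R).map h) := by rw [hh]; exact hg
  have h3 : Epi h := (tilde.functor R).epi_of_epi_map h2
  have hs := (ModuleCat.epi_iff_surjective h).mp h3
  exact Module.Finite.of_surjective h.hom hs

/-- The global sections of the restriction of `E` to `Spec 𝒪(U)` are the sections of `E` over `U`,
as modules over `𝒪(U)`. -/
lemma nonempty_sections_restrict_equiv (E : X.Modules) :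
    Nonempty (Γ(E.restrict hU.fromSpec, ⊤) ≃ₗ[Γ(X, U)] Γ(E, U)) := by
  have gen : ∀ (A : X.Opens) (hA : A = U) (_ : Module Γ(X, U) Γ(E, A))
      (_ : ∀ (r : Γ(X, U)) (s : Γ(E, A)), r • s = X.presheaf.map (homOfLE hA.le).op r • s),
      Nonempty (Γ(E, A) ≃ₗ[Γ(X, U)] Γ(E, U)) := by
    intro A hA m h2
    subst hA
    have : X.presheaf.map (homOfLE (le_refl A)).op = 𝟙 _ := X.presheaf.map_id _
    simp only [this] at h2
    have hm := Module.ext' m _ fun r s ↦ h2 r s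
    subst hm
    exact ⟨LinearEquiv.refl _ _⟩
  have hA : hU.fromSpec ''ᵁ ⊤ = U := by
    rw [Scheme.Hom.image_top_eq_opensRange, hU.opensRange_fromSpec]
  exact gen (hU.fromSpec ''ᵁ ⊤) hA
    (inferInstanceAs (Module Γ(X, U) Γ(E.restrict hU.fromSpec, ⊤)))
    (fun r s ↦ smul_restrict_fromSpec hU E ⊤ r s hA.le)

/-- A coherent sheaf has finitely generated modules of sections over small affine opens. -/
lemma exists_affine_finite (E : X.Modules) (hE : IsCoherent E) (x : X) :
    ∃ U : X.Opens, IsAffineOpen U ∧ x ∈ U ∧ Module.Finite Γ(X, U) Γ(E, U) := by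
  have hE' : SheafOfModules.IsFinitePresentation E := hE
  obtain ⟨σ, hσ⟩ := hE'.exists_quasicoherentData
  have hcov := σ.coversTop
  have hqE : SheafOfModules.IsQuasicoherent E := ⟨⟨σ⟩⟩
  obtain ⟨i, hi⟩ : ∃ i, x ∈ σ.X i := by
    have := ((Opens.coversTop_iff X σ.X).mp hcov).exists_mem x
    exact this
  obtain ⟨U, hU, hxU, hUW⟩ := exists_affine_le hi
  refine ⟨U, hU, hxU, ?_⟩
  let P := (σ.presentation i).map (overRestrict hU hUW) (overRestrictUnitIso hU hUW)
  let P' := SheafOfModules.GeneratingSections.ofEpi P.generators (overRestrictIso hU E hUW).hom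
  have : P'.IsFiniteType := by
    constructor
    change Finite (σ.presentation i).generators.I
    exact (hσ.isFinite_presentation i).isFiniteType_generators.finite
  have hq : (E.restrict hU.fromSpec).IsQuasicoherent :=
    Scheme.Modules.isQuasicoherent_restrictFunctor hU.fromSpec E
  have := finite_of_generatingSections (E.restrict hU.fromSpec) P'
  obtain ⟨e⟩ := nonempty_sections_restrict_equiv hU E
  exact Module.Finite.equiv e

/-- Extension of modules on the spectrum of `𝒪(U)` to modules on the site of opens of `U`. -/
def overExtend :
    SheafOfModules (Spec Γ(X, U)).ringCatSheaf ⥤ SheafOfModules (X.ringCatSheaf.over U) :=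
  Scheme.Modules.restrictFunctor hU.isoSpec.hom ⋙ (Scheme.Modules.overEquiv U).inverse

instance overExtend_preservesColimits :
    Limits.PreservesColimitsOfSize.{0, 0} (overExtend hU) := by
  have : Limits.PreservesColimitsOfSize.{0, 0}
    (Scheme.Modules.restrictFunctor hU.isoSpec.hom) := inferInstance
  exact @Limits.comp_preservesColimits _ _ _ _ _ _ _ _ this (by infer_instance)

/-- Extending the restriction of `E` to `Spec 𝒪(U)` gives back the restriction of `E` to `U`. -/
def overExtendIso (E : X.Modules) :
    (overExtend hU).obj (E.restrict hU.fromSpec) ≅ SheafOfModules.over E U :=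
  (Scheme.Modules.overEquiv U).inverse.mapIso
    ((Scheme.Modules.restrictFunctorComp hU.isoSpec.hom hU.fromSpec).symm.app E ≪≫
      (Scheme.Modules.restrictFunctorCongr (by simp)).app E ≪≫
      (Scheme.Modules.overFunctorEquiv U).symm.app E) ≪≫
    ((Scheme.Modules.overEquiv U).unitIso.app (SheafOfModules.over E U)).symm

/-- The structure sheaf extends to the structure sheaf. -/
def overExtendUnitIso :
    SheafOfModules.unit (X.ringCatSheaf.over U) ≅
      (overExtend hU).obj (SheafOfModules.unit (Spec Γ(X, U)).ringCatSheaf) :=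
  (Scheme.Modules.overEquiv U).unitIso.app (SheafOfModules.unit (X.ringCatSheaf.over U)) ≪≫
    (Scheme.Modules.overEquiv U).inverse.mapIso
      (Scheme.Modules.restrictUnitIso hU.isoSpec.hom).symm

/-- A finitely generated module over a noetherian ring has a finite presentation of its sheaf. -/
lemma exists_finite_presentation_tilde {R : CommRingCat.{0}} [IsNoetherianRing R]
    (N : ModuleCat.{0} R) [Module.Finite R N] :
    ∃ P : SheafOfModules.Presentation (tilde N), P.IsFinite := by
  obtain ⟨s, hsf, hs⟩ := Submodule.fg_def.mp
    ((Module.finite_def (R := R) (M := N)).mp inferInstance)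
  have : Finite s := hsf
  obtain ⟨t, htf, ht⟩ := Submodule.fg_def.mp ((inferInstance : IsNoetherian R (s →₀ R)).noetherian
    (LinearMap.ker (Finsupp.linearCombination R ((↑) : s → N))))
  exact ⟨presentationTilde N s hs t ht, ⟨⟨hsf⟩, ⟨htf⟩⟩⟩

/-- A sheaf is coherent if, near every point, it is the sheaf associated to a finitely generated
module over a noetherian ring. -/
lemma isCoherent_of_affine (E : X.Modules)
    (h : ∀ x : X, ∃ U : X.Opens, IsAffineOpen U ∧ x ∈ U ∧ IsNoetherianRing Γ(X, U) ∧
      LocalizesOn E U ∧ Module.Finite Γ(X, U) Γ(E, U)) : IsCoherent E := by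
  choose U hU hx hN hL hF using h
  have hP : ∀ x, ∃ P : SheafOfModules.Presentation (SheafOfModules.over E (U x)), P.IsFinite := by
    intro x
    obtain ⟨e⟩ := nonempty_sections_restrict_equiv (hU x) E
    have := hN x
    have := hF x
    let M := E.restrict (hU x).fromSpec
    have : Module.Finite Γ(X, U x) Γ(M, ⊤) := Module.Finite.equiv e.symm
    have hiso : IsIso M.fromTildeΓ := by
      rw [isIso_fromTildeΓ_iff_isLocalizing]
      exact (localizesOn_iff (hU x) E).mp (hL x)
    have : Module.Finite Γ(X, U x) ((modulesSpecToSheaf.obj M).presheaf.obj (.op ⊤)) := this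
    obtain ⟨P, hP⟩ := exists_finite_presentation_tilde
      ((modulesSpecToSheaf.obj M).presheaf.obj (.op ⊤))
    let P1 := @SheafOfModules.Presentation.ofIsIso _ _ _ _ _ _ _ _ M.fromTildeΓ hiso P
    let P2 := @SheafOfModules.Presentation.map _ _ _ _ _ _ _ _ _ _ _ _ _ P1 (overExtend (hU x))
      (overExtend_preservesColimits (hU x)) (overExtendUnitIso (hU x))
    refine ⟨P2.ofIsIso (overExtendIso (hU x) E).hom, ⟨⟨?_⟩, ⟨?_⟩⟩⟩
    · change Finite P.generators.I
      exact hP.isFiniteType_generators.finite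
    · change Finite P.relations.I
      exact hP.isFiniteType_relations.finite
  choose P hP using hP
  refine ⟨⟨⟨X, U, ?_, P⟩, ⟨hP⟩⟩⟩
  rw [Opens.coversTop_iff]
  exact IsOpenCover.mk (by
    rw [eq_top_iff]; intro x _
    exact Opens.mem_iSup.mpr ⟨x, hx x⟩)

lemma free_of_iso_free {R : CommRingCat.{0}} (M : (Spec R).Modules) (κ : Type)
    (e' : (SheafOfModules.free κ : (Spec R).Modules) ≅ M) :
    Module.Free R Γ(M, ⊤) := by
  let e : tilde (ModuleCat.of R (κ →₀ R)) ≅ (SheafOfModules.free κ : (Spec R).Modules) :=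
    tildeFinsupp κ
  let e2 := (modulesSpecToSheaf ⋙ TopCat.Sheaf.forget _ _ ⋙ (evaluation _ _).obj (.op ⊤)).mapIso
    (e ≪≫ e')
  let e3 := (tilde.isoTop (ModuleCat.of R (κ →₀ R)) ≪≫ e2).toLinearEquiv
  exact Module.Free.of_equiv e3

/-- A locally free sheaf has free modules of sections on small affine opens. -/
lemma exists_affine_free (E : X.Modules) (hE : IsLocallyFree E) (x : X) :
    ∃ U : X.Opens, IsAffineOpen U ∧ x ∈ U ∧ Module.Free Γ(X, U) Γ(E, U) := by
  obtain ⟨q, hq⟩ := hE.exists_isLocallyFreeData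
  obtain ⟨i, hi⟩ : ∃ i, x ∈ q.X i := ((Opens.coversTop_iff X q.X).mp q.coversTop).exists_mem x
  obtain ⟨U, hU, hxU, hUW⟩ := exists_affine_le hi
  refine ⟨U, hU, hxU, ?_⟩
  have hiso : IsIso (q.generators i).π := hq.isIso i
  let e1 := freeIsoMap (overRestrict hU hUW) (overRestrict_preservesColimits hU hUW)
    (overRestrictUnitIso hU hUW) (asIso (q.generators i).π) ≪≫ overRestrictIso hU E hUW
  have := free_of_iso_free (E.restrict hU.fromSpec) _ e1
  obtain ⟨e⟩ := nonempty_sections_restrict_equiv hU E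
  exact Module.Free.of_equiv e

/-- A sheaf which is quasi-coherent with free modules of sections on small affine opens is locally
free. -/
lemma isLocallyFree_of_affine (E : X.Modules)
    (h : ∀ x : X, ∃ U : X.Opens, IsAffineOpen U ∧ x ∈ U ∧
      LocalizesOn E U ∧ Module.Free Γ(X, U) Γ(E, U)) : IsLocallyFree E := by
  choose U hU hx hL hF using h
  have hP : ∀ x, ∃ σ : SheafOfModules.GeneratingSections (SheafOfModules.over E (U x)),
      IsIso σ.π := by
    intro x
    obtain ⟨e⟩ := nonempty_sections_restrict_equiv (hU x) E
    have := hF x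
    let M := E.restrict (hU x).fromSpec
    have : Module.Free Γ(X, U x) Γ(M, ⊤) := Module.Free.of_equiv e.symm
    have hiso : IsIso M.fromTildeΓ := by
      rw [isIso_fromTildeΓ_iff_isLocalizing]
      exact (localizesOn_iff (hU x) E).mp (hL x)
    have : Module.Free Γ(X, U x) ((modulesSpecToSheaf.obj M).presheaf.obj (.op ⊤)) := this
    obtain ⟨⟨κ, b⟩⟩ := this.exists_basis
    let e1 : (SheafOfModules.free κ : (Spec Γ(X, U x)).Modules) ≅
      tilde (ModuleCat.of Γ(X, U x) (κ →₀ Γ(X, U x))) := (tildeFinsupp κ).symm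
    let e2 := (tilde.functor Γ(X, U x)).mapIso b.repr.toModuleIso.symm
    let e3 : (SheafOfModules.free κ : (Spec Γ(X, U x)).Modules) ≅ M :=
      e1 ≪≫ e2 ≪≫ @asIso _ _ _ _ M.fromTildeΓ hiso
    exact exists_generatingSections_of_iso (freeIsoMap (overExtend (hU x))
      (overExtend_preservesColimits (hU x)) (overExtendUnitIso (hU x)) e3 ≪≫
      overExtendIso (hU x) E)
  choose P hP using hP
  refine ⟨⟨⟨X, U, ?_, P⟩, ⟨hP⟩⟩⟩
  rw [Opens.coversTop_iff]
  exact IsOpenCover.mk (by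
    rw [eq_top_iff]; intro x _
    exact Opens.mem_iSup.mpr ⟨x, hx x⟩)

end AffineLocal

/-! ### Germs of sections and maps of stalks -/

section Germs

variable {X : Scheme.{0}}

lemma germ_res (E : X.Modules) {U V : X.Opens} (h : V ≤ U) (x : X) (hx : x ∈ V) (s : Γ(E, U)) :
    E.presheaf.germ V x hx (E.presheaf.map (homOfLE h).op s) = E.presheaf.germ U x (h hx) s :=
  E.presheaf.germ_res_apply (homOfLE h) x hx s

lemma germ_res_ring {U V : X.Opens} (h : V ≤ U) (x : X) (hx : x ∈ V) (s : Γ(X, U)) :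
    X.presheaf.germ V x hx (X.presheaf.map (homOfLE h).op s) = X.presheaf.germ U x (h hx) s :=
  X.presheaf.germ_res_apply (homOfLE h) x hx s

lemma stalkMap_germ {E E' : X.Modules} (f : E ⟶ E') {U : X.Opens} (x : X) (hx : x ∈ U)
    (s : Γ(E, U)) :
    stalkMap f x (E.presheaf.germ U x hx s) = E'.presheaf.germ U x hx (f.app U s) :=
  TopCat.Presheaf.stalkFunctor_map_germ_apply U x hx f.mapPresheaf s

lemma app_res {E E' : X.Modules} (f : E ⟶ E') {U V : X.Opens} (h : V ≤ U) (s : Γ(E, U)) :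
    f.app V (E.presheaf.map (homOfLE h).op s) = E'.presheaf.map (homOfLE h).op (f.app U s) :=
  ConcreteCategory.congr_hom (f.mapPresheaf.naturality (homOfLE h).op) s

/-- Sections with the same germs are equal. -/
lemma section_ext (E : X.Modules) {U : X.Opens} {s t : Γ(E, U)}
    (h : ∀ x (hx : x ∈ U), E.presheaf.germ U x hx s = E.presheaf.germ U x hx t) : s = t :=
  TopCat.Presheaf.section_ext ⟨E.presheaf, E.isSheaf⟩ U s t h

/-- Two germs at `x` come from sections over a common neighbourhood. -/
lemma exists_germ_eq₂ (E E' : X.Modules) {x : X} (e : E.presheaf.stalk x)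
    (e' : E'.presheaf.stalk x) : ∃ (U : X.Opens) (hx : x ∈ U) (s : Γ(E, U)) (s' : Γ(E', U)),
      E.presheaf.germ U x hx s = e ∧ E'.presheaf.germ U x hx s' = e' := by
  obtain ⟨U, hU, s, rfl⟩ := E.presheaf.exists_germ_eq e
  obtain ⟨V, hV, t, rfl⟩ := E'.presheaf.exists_germ_eq e'
  exact ⟨U ⊓ V, ⟨hU, hV⟩, _, _, germ_res E inf_le_left x ⟨hU, hV⟩ s,
    germ_res E' inf_le_right x ⟨hU, hV⟩ t⟩

/-- A germ of a module and a germ of a function come from sections over a common neighbourhood. -/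
lemma exists_germ_eq_smul (E : X.Modules) {x : X} (r : X.presheaf.stalk x)
    (e : E.presheaf.stalk x) : ∃ (U : X.Opens) (hx : x ∈ U) (r' : Γ(X, U)) (s : Γ(E, U)),
      X.presheaf.germ U x hx r' = r ∧ E.presheaf.germ U x hx s = e := by
  obtain ⟨U, hU, s, rfl⟩ := X.presheaf.exists_germ_eq r
  obtain ⟨V, hV, t, rfl⟩ := E.presheaf.exists_germ_eq e
  exact ⟨U ⊓ V, ⟨hU, hV⟩, _, _, germ_res_ring inf_le_left x ⟨hU, hV⟩ s,
    germ_res E inf_le_right x ⟨hU, hV⟩ t⟩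

lemma stalkMap_smul {E E' : X.Modules} (f : E ⟶ E') (x : X) (r : X.presheaf.stalk x)
    (e : E.presheaf.stalk x) : stalkMap f x (r • e) = r • stalkMap f x e := by
  obtain ⟨U, hx, r, s, rfl, rfl⟩ := exists_germ_eq_smul E r e
  rw [← germ_smul, stalkMap_germ, stalkMap_germ, Scheme.Modules.Hom.app_smul, germ_smul]

lemma stalkMap_comp {E E' E'' : X.Modules} (f : E ⟶ E') (g : E' ⟶ E'') (x : X)
    (e : E.presheaf.stalk x) : stalkMap (f ≫ g) x e = stalkMap g x (stalkMap f x e) := by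
  obtain ⟨U, hx, s, rfl⟩ := E.presheaf.exists_germ_eq e
  rw [stalkMap_germ, stalkMap_germ, stalkMap_germ]
  rfl

lemma stalkMap_id (E : X.Modules) (x : X) (e : E.presheaf.stalk x) : stalkMap (𝟙 E) x e = e := by
  obtain ⟨U, hx, s, rfl⟩ := E.presheaf.exists_germ_eq e
  rw [stalkMap_germ]
  rfl

/-- The stalk map as a linear map. -/
def stalkMapₗ {E E' : X.Modules} (f : E ⟶ E') (x : X) :
    E.presheaf.stalk x →ₗ[X.presheaf.stalk x] E'.presheaf.stalk x where
  toFun := stalkMap f x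
  map_add' := map_add _
  map_smul' := stalkMap_smul f x

lemma hom_ext_stalk {E E' : X.Modules} {f g : E ⟶ E'}
    (h : ∀ x e, stalkMap f x e = stalkMap g x e) : f = g := by
  refine Scheme.Modules.hom_ext _ _ fun U ↦ ?_
  ext s
  refine section_ext E' fun x hx ↦ ?_
  rw [← stalkMap_germ, ← stalkMap_germ, h]

lemma stalkMap_injective_of_app {E E' : X.Modules} {f : E ⟶ E'}
    (h : ∀ U : X.Opens, Function.Injective (f.app U)) (x : X) :
    Function.Injective (stalkMap f x) := by
  rw [injective_iff_map_eq_zero]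
  intro e he
  obtain ⟨U, hx, s, rfl⟩ := E.presheaf.exists_germ_eq e
  rw [stalkMap_germ, ← map_zero (E'.presheaf.germ U x hx).hom] at he
  obtain ⟨W, hxW, i1, i2, e1⟩ := E'.presheaf.germ_eq x hx hx _ _ he
  rw [← germ_res E i1.le x hxW]
  have : E.presheaf.map (homOfLE i1.le).op s = 0 := by
    apply h W
    rw [app_res, map_zero]
    exact e1.trans (map_zero _)
  rw [this, map_zero]

lemma isIso_of_stalkMap_bijective {E E' : X.Modules} {f : E ⟶ E'}
    (h : ∀ x, Function.Bijective (stalkMap f x)) : IsIso f := by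
  rw [← isIso_iff_of_reflects_iso _ (Scheme.Modules.toPresheaf X)]
  let F : TopCat.Sheaf Ab X := ⟨E.presheaf, E.isSheaf⟩
  let G : TopCat.Sheaf Ab X := ⟨E'.presheaf, E'.isSheaf⟩
  let g : F ⟶ G := ⟨f.mapPresheaf⟩
  have : ∀ x : X, IsIso ((TopCat.Presheaf.stalkFunctor Ab x).map g.1) := fun x ↦
    (ConcreteCategory.isIso_iff_bijective _).mpr (h x)
  have hg : IsIso g := TopCat.Presheaf.isIso_of_stalkFunctor_map_iso g
  exact (TopCat.Sheaf.forget Ab X).map_isIso g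

lemma isZero_of_stalk {E : X.Modules} (h : ∀ x (e : E.presheaf.stalk x), e = 0) :
    Limits.IsZero E := by
  rw [Limits.IsZero.iff_id_eq_zero]
  refine hom_ext_stalk fun x e ↦ ?_
  rw [h x e, map_zero, map_zero]

variable {U : X.Opens}

/-- If `E` localizes on `U`, then a section over `U` with germ zero at `x` is killed by a function
which is invertible at `x`. -/
lemma exists_basicOpen_of_germ_eq_zero (hU : IsAffineOpen U) {E : X.Modules}
    (hE : LocalizesOn E U) {x : X} (hx : x ∈ U) {t : Γ(E, U)} (ht : E.presheaf.germ U x hx t = 0) :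
    ∃ f : Γ(X, U), x ∈ X.basicOpen f ∧ f • t = 0 := by
  rw [← map_zero (E.presheaf.germ U x hx).hom] at ht
  obtain ⟨W, hxW, i1, i2, e1⟩ := E.presheaf.germ_eq x hx hx _ _ ht
  obtain ⟨f, hf, hxf⟩ := hU.exists_basicOpen_le ⟨x, hxW⟩ hx
  have h0 : E.presheaf.map (homOfLE (X.basicOpen_le f)).op t = 0 := by
    rw [← res_res E i1.le hf]
    have : E.presheaf.map (homOfLE i1.le).op t = 0 := e1.trans (map_zero _)
    rw [this, map_zero]
  obtain ⟨n, hn⟩ := (hE f).2 t h0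
  refine ⟨f ^ (n + 1), ?_, ?_⟩
  · rw [X.basicOpen_pow f (Nat.succ_pos n)]
    exact hxf
  · rw [pow_succ', mul_smul, hn, smul_zero]

/-- If `E` localizes on `U`, then the germs at a point of `U` are fractions of sections over `U`. -/
lemma exists_smul_germ_eq (hU : IsAffineOpen U) {E : X.Modules}
    (hE : LocalizesOn E U) {x : X} (hx : x ∈ U) (e : E.presheaf.stalk x) :
    ∃ (f : Γ(X, U)) (t : Γ(E, U)), x ∈ X.basicOpen f ∧
      X.presheaf.germ U x hx f • e = E.presheaf.germ U x hx t := by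
  obtain ⟨W, hxW, s, rfl⟩ := E.presheaf.exists_germ_eq e
  obtain ⟨f, hf, hxf⟩ := hU.exists_basicOpen_le ⟨x, hxW⟩ hx
  obtain ⟨n, t, ht⟩ := (hE f).1 (E.presheaf.map (homOfLE hf).op s)
  obtain ⟨n, t, ht⟩ : ∃ (n : ℕ) (t : Γ(E, U)), E.presheaf.map (homOfLE (X.basicOpen_le f)).op t =
        X.presheaf.map (homOfLE (X.basicOpen_le f)).op (f ^ (n + 1)) •
          E.presheaf.map (homOfLE hf).op s := by
    refine ⟨n, f • t, ?_⟩
    rw [res_smul, ht, pow_succ', map_mul, mul_smul]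
  refine ⟨f ^ (n + 1), t, ?_, ?_⟩
  · rw [X.basicOpen_pow f (Nat.succ_pos n)]
    exact hxf
  · rw [← germ_res E (X.basicOpen_le f) x hxf t, ht, germ_smul, germ_res_ring, germ_res]

end Germs

/-! ### Stalks of tensor products -/

section Tensor

variable {X : Scheme.{0}} {M E G : X.Modules} {U : X.Opens}

lemma tmul_add (m : Γ(M, U)) (e e' : Γ(E, U)) : tmul m (e + e') = tmul m e + tmul m e' := by
  unfold tmul
  rw [TensorProduct.tmul_add]
  exact map_add _ _ _

lemma add_tmul (m m' : Γ(M, U)) (e : Γ(E, U)) : tmul (m + m') e = tmul m e + tmul m' e := by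
  unfold tmul
  rw [TensorProduct.add_tmul]
  exact map_add _ _ _

lemma smul_tmul (r : Γ(X, U)) (m : Γ(M, U)) (e : Γ(E, U)) :
    tmul (r • m) e = r • tmul m e :=
  ((PresheafOfModules.toSheafify (𝟙 X.ringCatSheaf.obj)
    (CategoryTheory.toSheafify (Opens.grothendieckTopology X)
      (tensorPresheaf M E).presheaf)).app (op U)).hom.map_smul r
        (m ⊗ₜ[Γ(X, U)] e : Γ(M, U) ⊗[Γ(X, U)] Γ(E, U))

lemma tmul_smul (r : Γ(X, U)) (m : Γ(M, U)) (e : Γ(E, U)) :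
    tmul m (r • e) = r • tmul m e := by
  rw [← smul_tmul]
  unfold tmul
  rw [TensorProduct.smul_tmul]

/-- Sections of `M ⊗ E` are locally in the image of `M(V) ⊗ E(V)`. -/
lemma exists_res_eq_toSheafify (s : Γ(tensor M E, U)) {x : X} (hx : x ∈ U) :
    ∃ (V : X.Opens) (h : V ≤ U) (_ : x ∈ V) (t : Γ(M, V) ⊗[Γ(X, V)] Γ(E, V)),
      (tensor M E).presheaf.map (homOfLE h).op s =
        (CategoryTheory.toSheafify (Opens.grothendieckTopology X)
          (tensorPresheaf M E).presheaf).app (op V) t := by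
  have := Presheaf.imageSieve_mem (Opens.grothendieckTopology X)
    (CategoryTheory.toSheafify (Opens.grothendieckTopology X) (tensorPresheaf M E).presheaf) s
  obtain ⟨V, i, ⟨t, ht⟩, hV⟩ := this x hx
  exact ⟨V, i.le, hV, t, ht.symm⟩

/-- The germs `m ⊗ e` generate the stalk of `M ⊗ E` as an abelian group. -/
lemma stalk_tensor_induction {x : X} {p : (tensor M E).presheaf.stalk x → Prop} (h0 : p 0)
    (hadd : ∀ a b, p a → p b → p (a + b)) (ht : ∀ m e, p (stalkTmul m e)) (t) : p t := by
  obtain ⟨U, hx, s, rfl⟩ := (tensor M E).presheaf.exists_germ_eq t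
  obtain ⟨V, hV, hxV, t, hst⟩ := exists_res_eq_toSheafify s hx
  rw [← germ_res _ hV x hxV, hst]
  clear hst
  induction t using TensorProduct.induction_on with
  | zero =>
    refine (congrArg p ?_).mp h0
    exact ((congrArg _ (map_zero ((CategoryTheory.toSheafify (Opens.grothendieckTopology X)
      (tensorPresheaf M E).presheaf).app (op V)).hom)).trans
        (map_zero ((tensor M E).presheaf.germ V x hxV).hom)).symm
  | tmul m e =>
    have := ht (M.presheaf.germ V x hxV m) (E.presheaf.germ V x hxV e)
    rwa [stalkTmul_germ] at this
  | add a b ha hb =>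
    refine (congrArg p ?_).mp (hadd _ _ ha hb)
    exact ((congrArg _ (map_add ((CategoryTheory.toSheafify (Opens.grothendieckTopology X)
      (tensorPresheaf M E).presheaf).app (op V)).hom a b)).trans
        (map_add ((tensor M E).presheaf.germ V x hxV).hom _ _)).symm

lemma tensor_hom_ext {f g : tensor M E ⟶ G}
    (h : ∀ x m e, stalkMap f x (stalkTmul m e) = stalkMap g x (stalkTmul m e)) : f = g := by
  refine hom_ext_stalk fun x t ↦ ?_
  induction t using stalk_tensor_induction with
  | h0 => rw [map_zero, map_zero]
  | hadd a b ha hb => rw [map_add, map_add, ha, hb]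
  | ht m e => exact h x m e

lemma stalkTmul_add {x : X} (m : M.presheaf.stalk x) (e e' : E.presheaf.stalk x) :
    stalkTmul m (e + e') = stalkTmul m e + stalkTmul m e' := by
  obtain ⟨U, hx, s, t, rfl, rfl⟩ := exists_germ_eq₂ E E e e'
  obtain ⟨V, hV, m, rfl⟩ := M.presheaf.exists_germ_eq m
  have hW : x ∈ V ⊓ U := ⟨hV, hx⟩
  rw [← germ_res M (inf_le_left : V ⊓ U ≤ V) x hW, ← germ_res E (inf_le_right : V ⊓ U ≤ U) x hW,
    ← germ_res E (inf_le_right : V ⊓ U ≤ U) x hW, ← map_add, stalkTmul_germ, stalkTmul_germ,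
    stalkTmul_germ, tmul_add, map_add]

lemma add_stalkTmul {x : X} (m m' : M.presheaf.stalk x) (e : E.presheaf.stalk x) :
    stalkTmul (m + m') e = stalkTmul m e + stalkTmul m' e := by
  obtain ⟨U, hx, s, t, rfl, rfl⟩ := exists_germ_eq₂ M M m m'
  obtain ⟨V, hV, e, rfl⟩ := E.presheaf.exists_germ_eq e
  have hW : x ∈ V ⊓ U := ⟨hV, hx⟩
  rw [← germ_res E (inf_le_left : V ⊓ U ≤ V) x hW, ← germ_res M (inf_le_right : V ⊓ U ≤ U) x hW,
    ← germ_res M (inf_le_right : V ⊓ U ≤ U) x hW, ← map_add, stalkTmul_germ, stalkTmul_germ,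
    stalkTmul_germ, add_tmul, map_add]

lemma stalkTmul_smul {x : X} (r : X.presheaf.stalk x) (m : M.presheaf.stalk x)
    (e : E.presheaf.stalk x) : stalkTmul m (r • e) = r • stalkTmul m e := by
  obtain ⟨U, hx, r, e, rfl, rfl⟩ := exists_germ_eq_smul E r e
  obtain ⟨V, hV, m, rfl⟩ := M.presheaf.exists_germ_eq m
  have hW : x ∈ V ⊓ U := ⟨hV, hx⟩
  rw [← germ_res M (inf_le_left : V ⊓ U ≤ V) x hW, ← germ_res E (inf_le_right : V ⊓ U ≤ U) x hW,
    ← germ_res_ring (inf_le_right : V ⊓ U ≤ U) x hW, ← germ_smul, stalkTmul_germ,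
    stalkTmul_germ, tmul_smul, germ_smul]

lemma smul_stalkTmul {x : X} (r : X.presheaf.stalk x) (m : M.presheaf.stalk x)
    (e : E.presheaf.stalk x) : stalkTmul (r • m) e = r • stalkTmul m e := by
  obtain ⟨U, hx, r, m, rfl, rfl⟩ := exists_germ_eq_smul M r m
  obtain ⟨V, hV, e, rfl⟩ := E.presheaf.exists_germ_eq e
  have hW : x ∈ V ⊓ U := ⟨hV, hx⟩
  rw [← germ_res E (inf_le_left : V ⊓ U ≤ V) x hW, ← germ_res M (inf_le_right : V ⊓ U ≤ U) x hW,
    ← germ_res_ring (inf_le_right : V ⊓ U ≤ U) x hW, ← germ_smul, stalkTmul_germ,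
    stalkTmul_germ, smul_tmul, germ_smul]

/-- The `𝒪_x`-bilinear map `(m, e) ↦ m ⊗ e` on stalks. -/
def stalkTmulₗ (M E : X.Modules) (x : X) :
    M.presheaf.stalk x →ₗ[X.presheaf.stalk x] E.presheaf.stalk x →ₗ[X.presheaf.stalk x]
      (tensor M E).presheaf.stalk x :=
  LinearMap.mk₂ _ stalkTmul add_stalkTmul smul_stalkTmul stalkTmul_add stalkTmul_smul

lemma stalkMap_tensorMap {E' : X.Modules} (M : X.Modules) (f : E ⟶ E') {x : X}
    (m : M.presheaf.stalk x) (e : E.presheaf.stalk x) :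
    stalkMap (tensorMap M f) x (stalkTmul m e) = stalkTmul m (stalkMap f x e) := by
  obtain ⟨U, hx, m, e, rfl, rfl⟩ := exists_germ_eq₂ M E m e
  rw [stalkTmul_germ, stalkMap_germ, stalkMap_germ, stalkTmul_germ, tensorMap_tmul]

end Tensor

/-! ### The generic stalk -/

section Generic

variable {X : Scheme.{0}} [IsIntegral X]

lemma genericPoint_mem {U : X.Opens} {x : X} (hx : x ∈ U) : genericPoint X ∈ U :=
  ((genericPoint_spec X).specializes trivial).mem_open U.isOpen hx

lemma toGeneric_germ (E : X.Modules) {U : X.Opens} (x : X) (hx : x ∈ U) (s : Γ(E, U)) :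
    toGeneric E x (E.presheaf.germ U x hx s) =
      E.presheaf.germ U (genericPoint X) (genericPoint_mem hx) s := by
  unfold toGeneric
  rw [← ConcreteCategory.comp_apply, E.presheaf.germ_stalkSpecializes]

lemma toGeneric_stalkMap {E E' : X.Modules} (f : E ⟶ E') (x : X) (e : E.presheaf.stalk x) :
    toGeneric E' x (stalkMap f x e) = stalkMap f (genericPoint X) (toGeneric E x e) := by
  obtain ⟨U, hx, s, rfl⟩ := E.presheaf.exists_germ_eq e
  rw [stalkMap_germ, toGeneric_germ, toGeneric_germ, stalkMap_germ]

lemma toGeneric_stalkTmul {M E : X.Modules} (x : X) (m : M.presheaf.stalk x)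
    (e : E.presheaf.stalk x) :
    toGeneric (tensor M E) x (stalkTmul m e) = stalkTmul (toGeneric M x m) (toGeneric E x e) := by
  obtain ⟨U, hx, m, e, rfl, rfl⟩ := exists_germ_eq₂ M E m e
  rw [stalkTmul_germ, toGeneric_germ, toGeneric_germ, toGeneric_germ, stalkTmul_germ]

lemma toGeneric_genericPoint (E : X.Modules) (e : genericStalk E) :
    toGeneric E (genericPoint X) e = e := by
  obtain ⟨U, hx, s, rfl⟩ := E.presheaf.exists_germ_eq e
  rw [toGeneric_germ]

end Generic

/-! ### Subsheaves given by a subspace of the generic stalk -/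

section GenericSub

variable {X : Scheme.{0}} [IsIntegral X] (E : X.Modules)
  (W : Submodule X.functionField (genericStalk E))

/-- The sections of `E` which lie in the subspace `W` at the generic point. -/
def genericSections (U : X.Opens) : Submodule Γ(X, U) Γ(E, U) where
  carrier := {s | ∀ x (hx : x ∈ U), toGeneric E x (E.presheaf.germ U x hx s) ∈ W}
  add_mem' {a b} ha hb x hx := by
    rw [map_add, map_add]
    exact W.add_mem (ha x hx) (hb x hx)
  zero_mem' x hx := by
    rw [map_zero, map_zero]
    exact W.zero_mem
  smul_mem' r a ha x hx := by
    rw [germ_smul, toGeneric_smul]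
    exact W.smul_mem _ (ha x hx)

variable {E W}

/-- All germs of a section have the same image at the generic point, so that membership in
`genericSections E W U` may be tested at a single point of `U`. -/
lemma mem_genericSections_of_mem {U : X.Opens} {s : Γ(E, U)} {x : X} (hx : x ∈ U)
    (h : toGeneric E x (E.presheaf.germ U x hx s) ∈ W) : s ∈ genericSections E W U := by
  intro y hy
  rw [toGeneric_germ] at h ⊢
  exact h

lemma res_mem_genericSections {U V : X.Opens} (h : V ≤ U) {s : Γ(E, U)}
    (hs : s ∈ genericSections E W U) :
    E.presheaf.map (homOfLE h).op s ∈ genericSections E W V := by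
  intro x hx
  rw [germ_res]
  exact hs x (h hx)

variable (E W)

/-- The subpresheaf of modules of `E` of the sections which lie in the subspace `W` at the generic
point. -/
def genericSubPresheaf : PresheafOfModules.Submodule E.val where
  obj U := genericSections E W U.unop
  map {_ _} i _ hs := res_mem_genericSections i.unop.le hs

lemma isSheaf_genericSubPresheaf : TopCat.Presheaf.IsSheaf (C := Ab) (X := X)
    (genericSubPresheaf E W).toPresheafOfModules.presheaf := by
  rw [TopCat.Presheaf.isSheaf_iff_isSheafUniqueGluing]
  intro ι U sf hsf
  let sf' : ∀ i, Γ(E, U i) := fun i ↦ (sf i : genericSections E W (U i)).1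
  have hc : TopCat.Presheaf.IsCompatible (X := X) E.presheaf U sf' := fun i j ↦
    congrArg (fun s : genericSections E W (U i ⊓ U j) ↦ s.1) (hsf i j)
  obtain ⟨s, hs, hu⟩ := TopCat.Presheaf.IsSheaf.isSheafUniqueGluing (X := X) E.isSheaf U sf' hc
  have hmem : s ∈ genericSections E W (iSup U) := by
    intro x hx
    obtain ⟨i, hi⟩ := Opens.mem_iSup.mp hx
    have := (sf i : genericSections E W (U i)).2 x hi
    have h2 : E.presheaf.map (homOfLE (le_iSup U i)).op s = (sf i : genericSections E W (U i)).1 :=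
      hs i
    rw [← h2, germ_res] at this
    exact this
  refine ⟨(⟨s, hmem⟩ : genericSections E W (iSup U)), fun i ↦ ?_, fun t ht ↦ ?_⟩
  · exact Subtype.ext (hs i)
  · refine Subtype.ext (hu _ fun i ↦ ?_)
    exact congrArg (fun s : genericSections E W (U i) ↦ s.1) (ht i)

/-- The subsheaf of `E` of the sections which lie in the subspace `W` at the generic point. -/
def genericSub : X.Modules where
  val := (genericSubPresheaf E W).toPresheafOfModules
  isSheaf := isSheaf_genericSubPresheaf E W

/-- The inclusion of `genericSub E W` in `E`. -/
def genericSubι : genericSub E W ⟶ E := ⟨(genericSubPresheaf E W).ι⟩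

variable {E W}

lemma genericSubι_injective (U : X.Opens) : Function.Injective ((genericSubι E W).app U) :=
  fun _ _ h ↦ Subtype.ext h

lemma genericSubι_stalk_injective (x : X) : Function.Injective (stalkMap (genericSubι E W) x) :=
  stalkMap_injective_of_app genericSubι_injective x

lemma genericSubι_mem {U : X.Opens} (s : Γ(genericSub E W, U)) :
    (genericSubι E W).app U s ∈ genericSections E W U :=
  (s : genericSections E W U).2

lemma exists_genericSubι_app_eq {U : X.Opens} {s : Γ(E, U)} (hs : s ∈ genericSections E W U) :
    ∃ t, (genericSubι E W).app U t = s := ⟨(⟨s, hs⟩ : genericSections E W U), rfl⟩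

instance : Mono (genericSubι E W) := by
  constructor
  intro G g h e
  refine Scheme.Modules.hom_ext _ _ fun U ↦ ?_
  ext s
  apply genericSubι_injective U
  exact congrArg (fun k : G ⟶ E ↦ k.app U s) e

/-- The stalk of `genericSub E W` at `x` consists of the germs of `E` which lie in `W` generically.
-/
lemma range_stalkMap_genericSubι (x : X) (e : E.presheaf.stalk x) :
    (∃ t, stalkMap (genericSubι E W) x t = e) ↔ toGeneric E x e ∈ W := by
  constructor
  · rintro ⟨t, rfl⟩
    obtain ⟨U, hx, s, rfl⟩ := (genericSub E W).presheaf.exists_germ_eq t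
    rw [stalkMap_germ]
    exact genericSubι_mem s x hx
  · intro h
    obtain ⟨U, hx, s, rfl⟩ := E.presheaf.exists_germ_eq e
    obtain ⟨t, rfl⟩ := exists_genericSubι_app_eq (mem_genericSections_of_mem hx h)
    exact ⟨(genericSub E W).presheaf.germ U x hx t, stalkMap_germ _ _ _ _⟩

/-- A morphism to `E` which maps the generic stalk into `W` factors through `genericSub E W`. -/
lemma exists_genericSub_lift {G : X.Modules} (g : G ⟶ E)
    (h : ∀ e, stalkMap g (genericPoint X) e ∈ W) : ∃ g' : G ⟶ genericSub E W,
      g' ≫ genericSubι E W = g := by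
  have hmem : ∀ (U : X.Opens) (s : Γ(G, U)), g.app U s ∈ genericSections E W U := by
    intro U s x hx
    rw [← stalkMap_germ, toGeneric_stalkMap]
    exact h _
  let g' : G.val ⟶ (genericSubPresheaf E W).toPresheafOfModules :=
    PresheafOfModules.homMk
      { app := fun U ↦ AddCommGrpCat.ofHom
          ((g.app U.unop).hom.codRestrict (genericSections E W U.unop).toAddSubgroup (hmem U.unop))
        naturality := fun U V i ↦ by
          ext s
          exact Subtype.ext (ConcreteCategory.congr_hom (g.mapPresheaf.naturality i) s) }
      (fun U r s ↦ Subtype.ext (g.app_smul r s))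
  exact ⟨⟨g'⟩, rfl⟩

end GenericSub

/-! ### The valuation of a discrete valuation ring -/

section OrdZ

variable (O : Type*) [CommRing O] [IsDomain O] [IsDiscreteValuationRing O]
  {K : Type*} [Field K] [Algebra O K] [IsFractionRing O K]

/-- The normalized discrete valuation of the fraction field `K` of a discrete valuation ring `O`,
written additively; its value at `0` is the junk value `0`. -/
def ordZ (f : K) : ℤ := WithZero.log (Ring.ordFrac O f)

lemma ordZ_mul {f g : K} (hf : f ≠ 0) (hg : g ≠ 0) : ordZ O (f * g) = ordZ O f + ordZ O g := by
  unfold ordZ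
  rw [map_mul, WithZero.log_mul ((map_ne_zero _).mpr hf) ((map_ne_zero _).mpr hg)]

lemma ordZ_one : ordZ O (1 : K) = 0 := by
  unfold ordZ
  rw [map_one, WithZero.log_one]

lemma ordZ_inv (f : K) : ordZ O f⁻¹ = -ordZ O f := by
  unfold ordZ
  rw [map_inv₀, WithZero.log_inv]

lemma ordZ_algebraMap {a : O} (ha : a ≠ 0) :
    ordZ O (algebraMap O K a) = (Ring.ord O a).toNat := by
  have h := Ring.ord_ne_top (mem_nonZeroDivisors_of_ne_zero ha)
  obtain ⟨n, hn⟩ := ENat.ne_top_iff_exists.mp h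
  unfold ordZ
  rw [Ring.ordFrac_eq_ord O ha,
    Ring.ordMonoidWithZeroHom_eq_coe O (mem_nonZeroDivisors_of_ne_zero ha) hn.symm, ← hn]
  rfl

lemma ordZ_algebraMap_nonneg {a : O} (ha : a ≠ 0) : 0 ≤ ordZ O (algebraMap O K a) := by
  rw [ordZ_algebraMap O ha]
  exact Int.natCast_nonneg _

lemma ordZ_unit {a : O} (ha : IsUnit a) : ordZ O (algebraMap O K a) = 0 := by
  rw [ordZ_algebraMap O ha.ne_zero, Ring.ord_of_isUnit ha]
  rfl

lemma ordZ_irreducible {a : O} (ha : Irreducible a) : ordZ O (algebraMap O K a) = 1 := by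
  rw [ordZ_algebraMap O ha.ne_zero, Ring.ord_of_irreducible ha]
  rfl

lemma ordZ_pos_of_mem {a : O} (ha : a ≠ 0) (hm : a ∈ IsLocalRing.maximalIdeal O) :
    0 < ordZ O (algebraMap O K a) := by
  obtain ⟨ϖ, hϖ⟩ := IsDiscreteValuationRing.exists_irreducible O
  rw [hϖ.maximalIdeal_eq, Ideal.mem_span_singleton] at hm
  obtain ⟨b, rfl⟩ := hm
  have hb := right_ne_zero_of_mul ha
  have h0 : ∀ {c : O}, c ≠ 0 → algebraMap O K c ≠ 0 := fun hc ↦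
    (map_ne_zero_iff _ (IsFractionRing.injective O K)).mpr hc
  rw [map_mul, ordZ_mul O (h0 hϖ.ne_zero) (h0 hb), ordZ_irreducible O hϖ]
  have := ordZ_algebraMap_nonneg (K := K) O hb
  omega

lemma exists_algebraMap_eq_of_ordZ_nonneg {f : K} (hf : 0 ≤ ordZ O f) :
    ∃ a, algebraMap O K a = f := by
  by_cases h0 : f = 0
  · exact ⟨0, by rw [h0, map_zero]⟩
  obtain ⟨a, ha⟩ | ⟨a, ha⟩ := ValuationRing.isInteger_or_isInteger O f
  · exact ⟨a, ha⟩
  have ha0 : a ≠ 0 := by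
    rintro rfl
    rw [map_zero] at ha
    exact h0 (inv_eq_zero.mp ha.symm)
  by_cases hu : IsUnit a
  · obtain ⟨u, rfl⟩ := hu
    refine ⟨(u⁻¹ : Oˣ), ?_⟩
    rw [← inv_inv f, ← ha]
    refine eq_inv_of_mul_eq_one_left ?_
    rw [← map_mul, Units.inv_mul, map_one]
  · have := ordZ_pos_of_mem (K := K) O ha0 hu
    rw [ha, ordZ_inv] at this
    omega

lemma exists_mem_maximalIdeal_of_ordZ_pos {f : K} (hf : 0 < ordZ O f) :
    ∃ a ∈ IsLocalRing.maximalIdeal O, algebraMap O K a = f := by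
  obtain ⟨a, rfl⟩ := exists_algebraMap_eq_of_ordZ_nonneg O hf.le
  refine ⟨a, fun hu ↦ ?_, rfl⟩
  rw [ordZ_unit O hu] at hf
  exact hf.false

/-- The maximal ideal is determined by the valuation ring as a subring of `K`. -/
lemma mem_maximalIdeal_iff_forall (a : O) :
    a ∈ IsLocalRing.maximalIdeal O ↔
      ∀ z ∈ Set.range (algebraMap O K), z * algebraMap O K a ≠ 1 := by
  constructor
  · rintro ha _ ⟨b, rfl⟩ h
    rw [← map_mul, ← map_one (algebraMap O K)] at h
    exact ha (IsUnit.of_mul_eq_one_right b (IsFractionRing.injective O K h))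
  · intro h hu
    obtain ⟨b, hb⟩ := hu.exists_left_inv
    refine h _ ⟨b, rfl⟩ ?_
    rw [← map_mul, hb, map_one]

end OrdZ

/-! ### Discrete valuation rings with the same fraction field -/

section Domination

variable {A B K : Type*} [CommRing A] [IsDomain A] [IsDiscreteValuationRing A]
  [CommRing B] [IsDomain B] [IsDiscreteValuationRing B] [Field K] [Algebra A K] [IsFractionRing A K]
  [Algebra B K] [IsFractionRing B K]

/-- Discrete valuation rings are maximal among the proper subrings of their fraction field. -/
lemma range_algebraMap_eq_of_le
    (h : Set.range (algebraMap A K) ⊆ Set.range (algebraMap B K)) :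
    Set.range (algebraMap A K) = Set.range (algebraMap B K) := by
  refine h.antisymm ?_
  rintro _ ⟨b, rfl⟩
  by_contra hb
  obtain ⟨a, ha⟩ := (ValuationRing.isInteger_or_isInteger A (algebraMap B K b)).resolve_left hb
  have hb0 : algebraMap B K b ≠ 0 := fun h0 ↦ hb ⟨0, by rw [map_zero, h0]⟩
  have ha0 : a ≠ 0 := by
    rintro rfl
    rw [map_zero] at ha
    exact hb0 (inv_eq_zero.mp ha.symm)
  -- The element `a` is a nonunit of `A` which becomes invertible in `B`.
  have ham : a ∈ IsLocalRing.maximalIdeal A := by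
    intro hu
    obtain ⟨c, hc⟩ := hu.exists_left_inv
    apply hb
    refine ⟨c, ?_⟩
    have := congrArg (algebraMap A K) hc
    rw [map_mul, ha, map_one] at this
    exact (mul_inv_eq_one₀ hb0).mp this
  apply IsDiscreteValuationRing.not_a_field B
  rw [eq_bot_iff]
  intro c hc
  by_contra hc0
  have hcK : algebraMap B K c ≠ 0 := (map_ne_zero_iff _ (IsFractionRing.injective B K)).mpr hc0
  have h1 : 0 < ordZ A (algebraMap A K a) := ordZ_pos_of_mem A ha0 ham
  -- A large power of `a` times `c⁻¹` lies in `A`, so that `c` is a unit of `B`.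
  obtain ⟨n, hn⟩ : ∃ n : ℕ, 0 ≤ ordZ A (algebraMap A K a ^ n * (algebraMap B K c)⁻¹) := by
    refine ⟨(ordZ A (algebraMap B K c)).toNat, ?_⟩
    have hp : ∀ n : ℕ, ordZ A (algebraMap A K a ^ n) = n * ordZ A (algebraMap A K a) := by
      intro n
      induction n with
      | zero => simp [ordZ_one]
      | succ n ih =>
        have h0 : algebraMap A K a ≠ 0 := (map_ne_zero_iff _ (IsFractionRing.injective A K)).mpr ha0
        rw [pow_succ, ordZ_mul A (pow_ne_zero _ h0) h0, ih]
        push_cast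
        ring
    have h0 : algebraMap A K a ≠ 0 := (map_ne_zero_iff _ (IsFractionRing.injective A K)).mpr ha0
    rw [ordZ_mul A (pow_ne_zero _ h0) (inv_ne_zero hcK), hp, ordZ_inv]
    nlinarith [Int.self_le_toNat (ordZ A (algebraMap B K c)),
      Int.natCast_nonneg (ordZ A (algebraMap B K c)).toNat]
  obtain ⟨d, hd⟩ := exists_algebraMap_eq_of_ordZ_nonneg A hn
  obtain ⟨e, he⟩ := h ⟨d, rfl⟩
  apply hc
  refine IsUnit.of_mul_eq_one_right (b ^ n * e) (IsFractionRing.injective B K ?_)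
  rw [map_mul, map_mul, map_pow, he, hd, ha, map_one, inv_pow]
  field_simp

/-- A ring homomorphism to `K` with values in `B`, as a homomorphism to `B`. -/
def liftRange {R : Type*} [CommRing R] (g : R →+* K) (h : ∀ r, ∃ b, algebraMap B K b = g r) :
    R →+* B where
  toFun r := (h r).choose
  map_one' := IsFractionRing.injective B K (by rw [(h 1).choose_spec, map_one, map_one])
  map_zero' := IsFractionRing.injective B K (by rw [(h 0).choose_spec, map_zero, map_zero])
  map_mul' r s := IsFractionRing.injective B K (by
    rw [(h _).choose_spec, map_mul, map_mul, (h r).choose_spec, (h s).choose_spec])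
  map_add' r s := IsFractionRing.injective B K (by
    rw [(h _).choose_spec, map_add, map_add, (h r).choose_spec, (h s).choose_spec])

lemma algebraMap_liftRange {R : Type*} [CommRing R] (g : R →+* K)
    (h : ∀ r, ∃ b, algebraMap B K b = g r) (r : R) : algebraMap B K (liftRange g h r) = g r :=
  (h r).choose_spec

/-- The valuation of `K` only depends on the valuation ring as a subring of `K`. -/
lemma ordZ_congr (h : Set.range (algebraMap A K) = Set.range (algebraMap B K)) (f : K) :
    ordZ A f = ordZ B f := by
  have hA : ∀ a, ∃ b, algebraMap B K b = algebraMap A K a := fun a ↦ h.subset ⟨a, rfl⟩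
  have hbij : Function.Bijective (liftRange (algebraMap A K) hA) := by
    constructor
    · intro a a' haa
      apply IsFractionRing.injective A K
      rw [← algebraMap_liftRange _ hA, haa, algebraMap_liftRange]
    · intro b
      obtain ⟨a, ha⟩ := h.symm.subset ⟨b, rfl⟩
      refine ⟨a, IsFractionRing.injective B K ?_⟩
      rw [algebraMap_liftRange, ha]
  let e : A ≃+* B := RingEquiv.ofBijective _ hbij
  have he : ∀ a, algebraMap B K (e a) = algebraMap A K a := algebraMap_liftRange _ hA
  -- It suffices to compare on `A`, where everything is a unit times a power of a uniformizer.
  have key : ∀ a : A, a ≠ 0 → ordZ A (algebraMap A K a) = ordZ B (algebraMap A K a) := by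
    intro a ha
    obtain ⟨ϖ, hϖ⟩ := IsDiscreteValuationRing.exists_irreducible A
    have hϖ' : Irreducible (e ϖ) := (MulEquiv.irreducible_iff e).mpr hϖ
    have h0 : algebraMap A K ϖ ≠ 0 := (map_ne_zero_iff _ (IsFractionRing.injective A K)).mpr
      hϖ.ne_zero
    have hp : ∀ n : ℕ, ordZ A (algebraMap A K ϖ ^ n) = ordZ B (algebraMap A K ϖ ^ n) := by
      intro n
      induction n with
      | zero => simp [ordZ_one]
      | succ n ih =>
        rw [pow_succ, ordZ_mul A (pow_ne_zero _ h0) h0, ordZ_mul B (pow_ne_zero _ h0) h0, ih,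
          ordZ_irreducible A hϖ, ← he, ordZ_irreducible B hϖ']
    obtain ⟨n, u, rfl⟩ := IsDiscreteValuationRing.eq_unit_mul_pow_irreducible ha hϖ
    have hu : algebraMap A K u ≠ 0 := (map_ne_zero_iff _ (IsFractionRing.injective A K)).mpr
      u.ne_zero
    rw [map_mul, map_pow, ordZ_mul A hu (pow_ne_zero _ h0), ordZ_mul B hu (pow_ne_zero _ h0), hp,
      ordZ_unit A u.isUnit, ← he (u : A), ordZ_unit B (u.isUnit.map e)]
  by_cases hf : f = 0
  · simp [hf, ordZ]
  obtain ⟨a, b, hb, rfl⟩ := IsFractionRing.div_surjective (A := A) f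
  have hb0 := nonZeroDivisors.ne_zero hb
  have hbK : algebraMap A K b ≠ 0 := (map_ne_zero_iff _ (IsFractionRing.injective A K)).mpr hb0
  have ha0 : a ≠ 0 := by
    rintro rfl
    simp at hf
  have haK : algebraMap A K a ≠ 0 := (map_ne_zero_iff _ (IsFractionRing.injective A K)).mpr ha0
  rw [div_eq_mul_inv, ordZ_mul A haK (inv_ne_zero hbK), ordZ_mul B haK (inv_ne_zero hbK),
    ordZ_inv, ordZ_inv, key a ha0, key b hb0]

end Domination

section Localization

variable {S K : Type} [CommRing S] [IsDedekindDomain S] [Field K] [Algebra S K] [IsFractionRing S K]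

/-- The inclusion of the localization of a domain `S` at a prime in the fraction field. -/
@[reducible]
def localizationAlgebra (P : Ideal S) [P.IsPrime] : Algebra (Localization.AtPrime P) K :=
  (IsLocalization.lift (M := P.primeCompl) (S := Localization.AtPrime P) (g := algebraMap S K)
    (fun y ↦ ((map_ne_zero_iff _ (IsFractionRing.injective S K)).mpr fun h ↦
      y.2 (by rw [h]; exact P.zero_mem)).isUnit)).toAlgebra

lemma localizationAlgebra_isScalarTower (P : Ideal S) [P.IsPrime] :
    letI : Algebra (Localization.AtPrime P) K := localizationAlgebra P
    IsScalarTower S (Localization.AtPrime P) K :=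
  letI : Algebra (Localization.AtPrime P) K := localizationAlgebra P
  IsScalarTower.of_algebraMap_eq fun x ↦ (IsLocalization.lift_eq _ x).symm

lemma localizationAlgebra_isFractionRing (P : Ideal S) [P.IsPrime] :
    letI : Algebra (Localization.AtPrime P) K := localizationAlgebra P
    IsFractionRing (Localization.AtPrime P) K :=
  letI : Algebra (Localization.AtPrime P) K := localizationAlgebra P
  have := localizationAlgebra_isScalarTower (K := K) P
  IsFractionRing.isFractionRing_of_isDomain_of_isLocalization P.primeCompl _ _

/-- A discrete valuation ring of `K` containing the Dedekind domain `S` is the localization of `S`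
at the prime which it dominates. -/
lemma range_localization_eq {O : Type} [CommRing O] [IsDomain O] [IsDiscreteValuationRing O]
    [Algebra O K] [IsFractionRing O K] (h : ∀ s : S, ∃ b, algebraMap O K b = algebraMap S K s)
    (P : Ideal S) [P.IsPrime] (hP : P ≠ ⊥)
    (hcomap : P = (IsLocalRing.maximalIdeal O).comap (liftRange (algebraMap S K) h)) :
    letI : Algebra (Localization.AtPrime P) K := localizationAlgebra P
    Set.range (algebraMap (Localization.AtPrime P) K) = Set.range (algebraMap O K) := by
  let : Algebra (Localization.AtPrime P) K := localizationAlgebra P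
  have := localizationAlgebra_isScalarTower (K := K) P
  have := localizationAlgebra_isFractionRing (K := K) P
  have := IsLocalization.AtPrime.isDiscreteValuationRing_of_dedekind_domain S hP
    (Localization.AtPrime P)
  refine range_algebraMap_eq_of_le ?_
  rintro _ ⟨a, rfl⟩
  obtain ⟨s, t, rfl⟩ := IsLocalization.exists_mk'_eq P.primeCompl a
  have ht : IsUnit (liftRange (B := O) (algebraMap S K) h t) := by
    by_contra hu
    exact t.2 (hcomap.symm.le hu)
  obtain ⟨u, hu⟩ := ht
  have htK : algebraMap S K t ≠ 0 := by
    rw [← algebraMap_liftRange (B := O) _ h, ← hu]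
    exact (map_ne_zero_iff _ (IsFractionRing.injective O K)).mpr u.ne_zero
  refine ⟨liftRange (algebraMap S K) h s * (u⁻¹ : Oˣ), ?_⟩
  apply mul_right_cancel₀ htK
  rw [map_mul, algebraMap_liftRange, mul_assoc]
  nth_rw 2 [← algebraMap_liftRange (B := O) _ h]
  rw [← hu, ← map_mul, Units.inv_mul, map_one, mul_one,
    IsScalarTower.algebraMap_apply S (Localization.AtPrime P) K,
    IsScalarTower.algebraMap_apply S (Localization.AtPrime P) K, ← map_mul,
    IsLocalization.mk'_spec]

end Localization

/-! ### Zeros and poles of rational functions -/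

section ProductFormula

variable {k K : Type} [Field k] [IsAlgClosed k] [CharZero k] [Field K] [Algebra k K]

open Polynomial IntermediateField

lemma isMaximal_span_X : (Ideal.span {(X : k[X])}).IsMaximal := by
  rw [← Polynomial.ker_constantCoeff]
  exact RingHom.ker_isMaximal_of_surjective _ fun c ↦ ⟨C c, by simp⟩

/-- As `k` is algebraically closed, the residue fields above `X = 0` are equal to `k`. -/
lemma inertiaDeg_eq_one {S : Type} [CommRing S] [IsDomain S] [Algebra k[X] S] [Module.Finite k[X] S]
    (P : Ideal S) [P.IsMaximal] [P.LiesOver (Ideal.span {(X : k[X])})] :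
    P.inertiaDeg k[X] = 1 := by
  have := isMaximal_span_X (k := k)
  rw [Ideal.inertiaDeg_eq_of_isMaximal (Ideal.span {(X : k[X])}) P]
  let := Ideal.Quotient.field (Ideal.span {(X : k[X])})
  let e : k ≃+* k[X] ⧸ Ideal.span {(X : k[X])} :=
    ((RingHom.quotientKerEquivOfSurjective (f := Polynomial.constantCoeff (R := k))
      fun c ↦ ⟨C c, by simp⟩).symm).trans
        (Ideal.quotEquivOfEq Polynomial.ker_constantCoeff)
  have := IsAlgClosed.of_ringEquiv _ _ e
  have hb := IsAlgClosed.algebraMap_bijective_of_isIntegral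
    (k := k[X] ⧸ Ideal.span {(X : k[X])}) (K := S ⧸ P)
  exact (LinearEquiv.finrank_eq (LinearEquiv.ofBijective (Algebra.linearMap _ _) hb)).symm.trans
    (Module.finrank_self _)

/-- The degree of the divisor of zeros of a nonconstant rational function `X` on a curve with
function field `K` is the rank of the integral closure `S` of `k[X]` in `K`. The curve is given by
its local rings `O p`. -/
lemma finsum_ordZ_pos_eq_finrank {P : Type} (O : P → Type) [∀ p, CommRing (O p)]
    [∀ p, IsDomain (O p)] [∀ p, IsDiscreteValuationRing (O p)] [∀ p, Algebra (O p) K]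
    [∀ p, IsFractionRing (O p) K]
    (hconst : ∀ p c, algebraMap k K c ∈ Set.range (algebraMap (O p) K))
    (hinj : ∀ p q, Set.range (algebraMap (O p) K) = Set.range (algebraMap (O q) K) → p = q)
    (hsurj : ∀ (A : Type) [CommRing A] [IsDomain A] [IsDiscreteValuationRing A] [Algebra A K]
      [IsFractionRing A K], (∀ c, algebraMap k K c ∈ Set.range (algebraMap A K)) →
        ∃ p, Set.range (algebraMap (O p) K) ⊆ Set.range (algebraMap A K))
    [Algebra k[X] K] {f : K} (hX : algebraMap k[X] K X = f) (hf0 : f ≠ 0)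
    (hC : ∀ c, algebraMap k[X] K (C c) = algebraMap k K c)
    (S : Type) [CommRing S] [IsDedekindDomain S] [Algebra S K] [IsFractionRing S K]
    [Algebra k[X] S] [IsScalarTower k[X] S K] [IsIntegralClosure S k[X] K] [Module.Finite k[X] S]
    (hSinj : Function.Injective (algebraMap k[X] S)) :
    {p | 0 < ordZ (O p) f}.Finite ∧
      ∑ᶠ p ∈ {p | 0 < ordZ (O p) f}, ordZ (O p) f = Module.finrank k[X] S := by
  classical
  have hS : ∀ p : k[X], algebraMap S K (algebraMap k[X] S p) = algebraMap k[X] K p := fun p ↦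
    (IsScalarTower.algebraMap_apply k[X] S K p).symm
  have : FaithfulSMul k[X] S := (faithfulSMul_iff_algebraMap_injective _ _).mpr hSinj
  have : Module.IsTorsionFree k[X] S := inferInstance
  have : Module.Flat k[X] S := inferInstance
  have hmax : (Ideal.span {(X : k[X])}).IsMaximal := isMaximal_span_X
  -- The local rings at the zeros of `f` are integrally closed and contain `k[X]`, hence `S`.
  have hle : ∀ p, 0 < ordZ (O p) f → ∀ s : S, ∃ b, algebraMap (O p) K b = algebraMap S K s := by
    intro p hp s
    have h1 : ∀ q : k[X], ∃ b, algebraMap (O p) K b = algebraMap k[X] K q := by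
      intro q
      induction q using Polynomial.induction_on with
      | C c => rw [hC]; exact hconst p c
      | add q q' hq hq' =>
        obtain ⟨b, hb⟩ := hq
        obtain ⟨b', hb'⟩ := hq'
        exact ⟨b + b', by rw [map_add, map_add, hb, hb']⟩
      | monomial n c hq =>
        obtain ⟨b, hb⟩ := hq
        obtain ⟨b', hb'⟩ := exists_algebraMap_eq_of_ordZ_nonneg (O p) hp.le
        exact ⟨b * b', by rw [map_mul, hb, hb', pow_succ, ← mul_assoc, map_mul _ _ X, hX]⟩
    let : Algebra k[X] (O p) := (liftRange (algebraMap k[X] K) h1).toAlgebra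
    have : IsScalarTower k[X] (O p) K := IsScalarTower.of_algebraMap_eq fun q ↦
      (algebraMap_liftRange _ h1 q).symm
    have hs : IsIntegral k[X] (algebraMap S K s) := IsIntegralClosure.isIntegral_iff.mpr ⟨s, rfl⟩
    exact IsIntegrallyClosed.isIntegral_iff.mp (hs.tower_top (A := O p))
  -- The zero `p` of `f` corresponds to the prime ideal of `S` which its local ring dominates.
  let Φ : P → Ideal S := fun p ↦ if h : 0 < ordZ (O p) f then
    (IsLocalRing.maximalIdeal (O p)).comap (liftRange (algebraMap S K) (hle p h)) else ⊥
  have hΦ : ∀ p (h : 0 < ordZ (O p) f), Φ p =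
    (IsLocalRing.maximalIdeal (O p)).comap (liftRange (algebraMap S K) (hle p h)) :=
      fun p h ↦ dif_pos h
  have hXS : algebraMap k[X] S X ≠ 0 := (map_ne_zero_iff _ hSinj).mpr X_ne_zero
  have hXΦ : ∀ p (h : 0 < ordZ (O p) f), algebraMap k[X] S X ∈ Φ p := by
    intro p h
    rw [hΦ p h, Ideal.mem_comap]
    obtain ⟨a, ha, haf⟩ := exists_mem_maximalIdeal_of_ordZ_pos (O p) h
    have : liftRange (B := O p) (algebraMap S K) (hle p h) (algebraMap k[X] S X) = a := by
      apply IsFractionRing.injective (O p) K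
      rw [algebraMap_liftRange, haf, hS, hX]
    rwa [this]
  have hprime : ∀ p (h : 0 < ordZ (O p) f), (Φ p).IsPrime := fun p h ↦ by
    rw [hΦ p h]; infer_instance
  have hne : ∀ p (h : 0 < ordZ (O p) f), Φ p ≠ ⊥ := fun p h hb ↦ hXS (by
    have := hXΦ p h
    rwa [hb, Ideal.mem_bot] at this)
  have hlies : ∀ Q : Ideal S, Q.IsPrime → algebraMap k[X] S X ∈ Q →
      Q.LiesOver (Ideal.span {(X : k[X])}) := by
    intro Q hQ hQX
    refine ⟨hmax.eq_of_le (Ideal.IsPrime.under _ Q).ne_top ?_⟩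
    rw [Ideal.span_singleton_le_iff_mem]
    exact hQX
  have hrange : ∀ p, 0 < ordZ (O p) f → ∀ (Q : Ideal S) (hQ : Q.IsPrime), Φ p = Q →
      letI : Algebra (Localization.AtPrime Q) K := localizationAlgebra Q
      Set.range (algebraMap (Localization.AtPrime Q) K) = Set.range (algebraMap (O p) K) :=
    fun p h Q hQ hpQ ↦ @range_localization_eq _ _ _ _ _ _ _ (O p) _ _ _ _ _ (hle p h) Q hQ
      (hpQ ▸ hne p h) (hpQ ▸ hΦ p h)
  have hloc : ∀ Q : Ideal S, Q.IsPrime → algebraMap k[X] S X ∈ Q → Q ≠ ⊥ := fun Q _ hXQ hb ↦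
    hXS (by rwa [hb, Ideal.mem_bot] at hXQ)
  have hbij : Set.BijOn Φ {p | 0 < ordZ (O p) f} ((Ideal.span {(X : k[X])}).primesOver S) := by
    refine ⟨fun p hp ↦ ⟨hprime p hp, hlies _ (hprime p hp) (hXΦ p hp)⟩, fun p hp q hq hpq ↦ ?_, ?_⟩
    · apply hinj
      rw [← hrange p hp _ (hprime q hq) hpq, ← hrange q hq _ (hprime q hq) rfl]
    · rintro Q ⟨hQ, hQX⟩
      have hXQ : algebraMap k[X] S X ∈ Q := by
        have : (X : k[X]) ∈ Q.under k[X] := by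
          rw [← hQX.over]
          exact Ideal.mem_span_singleton_self X
        exact this
      have hQ0 := hloc Q hQ hXQ
      let : Algebra (Localization.AtPrime Q) K := localizationAlgebra Q
      have := localizationAlgebra_isScalarTower (K := K) Q
      have := localizationAlgebra_isFractionRing (K := K) Q
      have := IsLocalization.AtPrime.isDiscreteValuationRing_of_dedekind_domain S hQ0
        (Localization.AtPrime Q)
      obtain ⟨p, hp⟩ := hsurj (Localization.AtPrime Q) fun c ↦
        ⟨algebraMap S _ (algebraMap k[X] S (C c)), by
          rw [← IsScalarTower.algebraMap_apply S (Localization.AtPrime Q) K, hS, hC]⟩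
      have hpQ := range_algebraMap_eq_of_le hp
      have hXK : algebraMap (Localization.AtPrime Q) K
          (algebraMap S _ (algebraMap k[X] S X)) = f := by
        rw [← IsScalarTower.algebraMap_apply S (Localization.AtPrime Q) K, hS, hX]
      have hpos : 0 < ordZ (O p) f := by
        rw [ordZ_congr hpQ, ← hXK]
        refine ordZ_pos_of_mem _ (fun h0 ↦ ?_) ?_
        · rw [h0, map_zero] at hXK
          exact hf0 hXK.symm
        · exact (IsLocalization.AtPrime.to_map_mem_maximal_iff (Localization.AtPrime Q) Q _).mpr hXQ
      refine ⟨p, hpos, ?_⟩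
      ext s
      rw [hΦ p hpos, Ideal.mem_comap, mem_maximalIdeal_iff_forall (O p) (K := K),
        algebraMap_liftRange, hpQ,
        IsScalarTower.algebraMap_apply S (Localization.AtPrime Q) K, ← mem_maximalIdeal_iff_forall,
        IsLocalization.AtPrime.to_map_mem_maximal_iff (Localization.AtPrime Q) Q]
  have hfin : ((Ideal.span {(X : k[X])}).primesOver S).Finite :=
    IsDedekindDomain.primesOver_finite _ S
  refine ⟨hbij.finite_iff_finite.mpr hfin, ?_⟩
  -- The order of the zero is the ramification index, and the ramification indices add up to the
  -- rank.
  have hord : ∀ p ∈ {p | 0 < ordZ (O p) f}, ordZ (O p) f =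
      (fun Q : Ideal S ↦ (Q.ramificationIdx k[X] : ℤ)) (Φ p) := by
    intro p hp
    have hQ := hprime p hp
    have hXQ := hXΦ p hp
    have hQX := hlies _ hQ hXQ
    have hr := hrange p hp _ hQ rfl
    generalize Φ p = Q at hQ hXQ hQX hr
    let : Algebra (Localization.AtPrime Q) K := localizationAlgebra Q
    have := localizationAlgebra_isScalarTower (K := K) Q
    have := localizationAlgebra_isFractionRing (K := K) Q
    have := IsLocalization.AtPrime.isDiscreteValuationRing_of_dedekind_domain S (hloc Q hQ hXQ)
      (Localization.AtPrime Q)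
    have hXK : algebraMap (Localization.AtPrime Q) K (algebraMap k[X] _ X) = f := by
      rw [IsScalarTower.algebraMap_apply k[X] S (Localization.AtPrime Q),
        ← IsScalarTower.algebraMap_apply S (Localization.AtPrime Q) K, hS, hX]
    change _ = ((Q.ramificationIdx k[X] : ℕ) : ℤ)
    rw [← ordZ_congr hr, Ideal.ramificationIdx_eq (Ideal.span {(X : k[X])}) Q, ← hXK,
      ordZ_algebraMap, Ideal.map_span, Set.image_singleton]
    · rfl
    · intro h0
      rw [h0, map_zero] at hXK
      exact hf0 hXK.symm
  rw [finsum_mem_eq_of_bijOn (g := fun Q : Ideal S ↦ (Q.ramificationIdx k[X] : ℤ)) Φ hbij hord,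
    ← finsum_set_coe_eq_finsum_mem]
  have := hfin.fintype
  rw [finsum_eq_sum_of_fintype,
    ← Ideal.sum_ramification_inertia_eq_finrank (Ideal.span {(X : k[X])}) S]
  push_cast
  refine Finset.sum_congr rfl fun Q _ ↦ ?_
  have h1 := Q.2.1
  have h2 := Q.2.2
  have : Q.1.IsMaximal := by
    refine h1.isMaximal (hloc Q.1 h1 ?_)
    have : (X : k[X]) ∈ Q.1.under k[X] := by
      rw [← h2.over]
      exact Ideal.mem_span_singleton_self X
    exact this
  rw [inertiaDeg_eq_one Q.1, Nat.cast_one, mul_one]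

/-- The degree of the divisor of zeros of a nonconstant rational function `f` on a curve with
function field `K` is `[K : k(f)]`. The curve is given by its local rings `O p`. -/
lemma finsum_ordZ_pos {P : Type} (O : P → Type) [∀ p, CommRing (O p)] [∀ p, IsDomain (O p)]
    [∀ p, IsDiscreteValuationRing (O p)] [∀ p, Algebra (O p) K] [∀ p, IsFractionRing (O p) K]
    (hconst : ∀ p c, algebraMap k K c ∈ Set.range (algebraMap (O p) K))
    (hinj : ∀ p q, Set.range (algebraMap (O p) K) = Set.range (algebraMap (O q) K) → p = q)
    (hsurj : ∀ (A : Type) [CommRing A] [IsDomain A] [IsDiscreteValuationRing A] [Algebra A K]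
      [IsFractionRing A K], (∀ c, algebraMap k K c ∈ Set.range (algebraMap A K)) →
        ∃ p, Set.range (algebraMap (O p) K) ⊆ Set.range (algebraMap A K))
    (f : K) (hf : Transcendental k f) [FiniteDimensional k⟮f⟯ K] :
    {p | 0 < ordZ (O p) f}.Finite ∧
      ∑ᶠ p ∈ {p | 0 < ordZ (O p) f}, ordZ (O p) f = Module.finrank k⟮f⟯ K := by
  have hf0 : f ≠ 0 := fun h ↦ hf (h ▸ isAlgebraic_zero)
  let : Algebra k[X] K := (aeval f).toAlgebra
  have hX : algebraMap k[X] K X = f := aeval_X f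
  have hC : ∀ c, algebraMap k[X] K (C c) = algebraMap k K c := aeval_C f
  have hinjK : Function.Injective (algebraMap k[X] K) :=
    transcendental_iff_injective.mp hf
  let : Algebra k[X] k⟮f⟯ := ((aeval (R := k) (⟨f, mem_adjoin_simple_self k f⟩ : k⟮f⟯))).toAlgebra
  have hL : ∀ p : k[X], ((algebraMap k[X] k⟮f⟯ p : k⟮f⟯) : K) = algebraMap k[X] K p := fun p ↦
    (aeval_algebraMap_apply K (⟨f, mem_adjoin_simple_self k f⟩ : k⟮f⟯) p).symm
  have : IsScalarTower k[X] k⟮f⟯ K := IsScalarTower.of_algebraMap_eq fun p ↦ (hL p).symm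
  have : FaithfulSMul k[X] k⟮f⟯ := (faithfulSMul_iff_algebraMap_injective _ _).mpr fun p q h ↦
    hinjK (by rw [← hL, ← hL, h])
  have : IsFractionRing k[X] k⟮f⟯ := by
    refine IsFractionRing.of_field _ _ fun z ↦ ?_
    obtain ⟨p, q, h⟩ := (mem_adjoin_simple_iff k z.1).mp z.2
    refine ⟨p, q, Subtype.ext (h.trans ?_)⟩
    rw [IntermediateField.coe_div, hL, hL]
    rfl
  let S := integralClosure k[X] K
  have : Module.Finite k[X] S := IsIntegralClosure.finite k[X] k⟮f⟯ K S
  have : IsDedekindDomain S := IsIntegralClosure.isDedekindDomain k[X] k⟮f⟯ K S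
  have : IsFractionRing S K := integralClosure.isFractionRing_of_finite_extension k⟮f⟯ K
  have hSinj : Function.Injective (algebraMap k[X] S) := fun p q h ↦
    hinjK (congrArg (algebraMap S K) h)
  rw [IsFractionRing.finrank_eq k[X] k⟮f⟯ S K]
  exact finsum_ordZ_pos_eq_finrank O hconst hinj hsurj hX hf0 hC S hSinj

/-- A rational function on a complete curve, given by its local rings `O p`, has as many zeros as
poles. -/
theorem finsum_ordZ_eq_zero {P : Type} (O : P → Type) [∀ p, CommRing (O p)] [∀ p, IsDomain (O p)]
    [∀ p, IsDiscreteValuationRing (O p)] [∀ p, Algebra (O p) K] [∀ p, IsFractionRing (O p) K]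
    (hconst : ∀ p c, algebraMap k K c ∈ Set.range (algebraMap (O p) K))
    (hinj : ∀ p q, Set.range (algebraMap (O p) K) = Set.range (algebraMap (O q) K) → p = q)
    (hsurj : ∀ (A : Type) [CommRing A] [IsDomain A] [IsDiscreteValuationRing A] [Algebra A K]
      [IsFractionRing A K], (∀ c, algebraMap k K c ∈ Set.range (algebraMap A K)) →
        ∃ p, Set.range (algebraMap (O p) K) ⊆ Set.range (algebraMap A K))
    (hdim : ∀ f : K, Transcendental k f → FiniteDimensional k⟮f⟯ K) (f : K) (hf : f ≠ 0) :
    (Function.support fun p ↦ ordZ (O p) f).Finite ∧ ∑ᶠ p, ordZ (O p) f = 0 := by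
  by_cases hfa : IsAlgebraic k f
  -- An algebraic function is constant, hence a unit everywhere.
  · obtain ⟨c, rfl⟩ : ∃ c, algebraMap k K c = f := minpoly.mem_range_of_degree_eq_one k f
      (IsAlgClosed.degree_eq_one_of_irreducible k (minpoly.irreducible hfa.isIntegral))
    have h0 : ∀ p, ordZ (O p) (algebraMap k K c) = 0 := by
      intro p
      obtain ⟨a, ha⟩ := hconst p c
      obtain ⟨b, hb⟩ := hconst p c⁻¹
      have hc : c ≠ 0 := by
        rintro rfl
        exact hf (map_zero _)
      rw [← ha]
      refine ordZ_unit _ (IsUnit.of_mul_eq_one b (IsFractionRing.injective (O p) K ?_))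
      rw [map_mul, ha, hb, ← map_mul, mul_inv_cancel₀ hc, map_one, map_one]
    simp only [h0, finsum_zero]
    simp
  -- Otherwise the divisors of zeros of `f` and of `f⁻¹` both have degree `[K : k(f)]`.
  · have hfi : Transcendental k f⁻¹ := fun h ↦ hfa (by simpa using h.inv)
    have := hdim f hfa
    have := hdim _ hfi
    obtain ⟨h1, h2⟩ := finsum_ordZ_pos O hconst hinj hsurj f hfa
    obtain ⟨h3, h4⟩ := finsum_ordZ_pos O hconst hinj hsurj _ hfi
    have hadj : k⟮f⁻¹⟯ = k⟮f⟯ := by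
      apply le_antisymm
      · rw [adjoin_simple_le_iff]
        exact inv_mem (mem_adjoin_simple_self k f)
      · rw [adjoin_simple_le_iff]
        simpa using inv_mem (mem_adjoin_simple_self k f⁻¹)
    rw [hadj, ← h2] at h4
    simp only [ordZ_inv, Left.neg_pos_iff] at h3 h4
    have hsupp : (Function.support fun p ↦ ordZ (O p) f) =
        {p | 0 < ordZ (O p) f} ∪ {p | ordZ (O p) f < 0} := by
      ext p
      simp [lt_or_lt_iff_ne, ne_comm]
    refine ⟨hsupp ▸ h1.union h3, ?_⟩
    rw [← finsum_mem_support, hsupp, finsum_mem_union _ h1 h3, ← h4, ← finsum_mem_add_distrib h3]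
    · simp
    · rw [Set.disjoint_left]
      intro p hp hp'
      exact lt_asymm (Set.mem_ofPred.mp hp) (Set.mem_ofPred.mp hp')

end ProductFormula

/-! ### Lattices over a discrete valuation ring -/

section Lattice

open Module

variable {O K V ι : Type*} [CommRing O] [IsDomain O] [IsDiscreteValuationRing O]
  [Field K] [Algebra O K] [IsFractionRing O K] [AddCommGroup V] [Module K V] [Module O V]
  [IsScalarTower O K V] [Fintype ι] [DecidableEq ι]

variable (O) in
lemma ordZ_prod {f : ι → K} (hf : ∀ i, f i ≠ 0) : ordZ O (∏ i, f i) = ∑ i, ordZ O (f i) := by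
  have : ∀ s : Finset ι, ordZ O (∏ i ∈ s, f i) = ∑ i ∈ s, ordZ O (f i) := by
    intro s
    induction s using Finset.induction_on with
    | empty => simp [ordZ_one]
    | insert i s hi ih =>
      rw [Finset.prod_insert hi, Finset.sum_insert hi,
        ordZ_mul O (hf i) (Finset.prod_ne_zero_iff.mpr fun i _ ↦ hf i), ih]
  exact this _

lemma det_ne_zero_of_basis (b b' : Basis ι K V) : b.det b' ≠ 0 := (b.isUnit_det b').ne_zero

/-- If the lattice of `b'` is contained in the one of `b`, the determinant of the base change is
integral. -/
lemma exists_algebraMap_eq_det {b : Basis ι K V} {v : ι → V}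
    (h : ∀ i, v i ∈ Submodule.span O (Set.range b)) : ∃ a : O, algebraMap O K a = b.det v := by
  have : ∀ i, ∃ c : ι → O, ∑ j, c j • b j = v i := fun i ↦
    (Submodule.mem_span_range_iff_exists_fun O).mp (h i)
  choose c hc using this
  refine ⟨(Matrix.of fun j i ↦ c i j).det, ?_⟩
  rw [RingHom.map_det, Basis.det_apply]
  congr 1
  ext j i
  rw [Basis.toMatrix_apply, ← hc i]
  simp only [map_sum, RingHom.mapMatrix_apply, Matrix.map_apply, Matrix.of_apply]
  simp_rw [← algebraMap_smul K (c i _) (b _), map_smul]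
  simp [Finsupp.single_apply, Algebra.smul_def]

lemma ordZ_det_nonneg {b b' : Basis ι K V}
    (h : Submodule.span O (Set.range b') ≤ Submodule.span O (Set.range b)) :
    0 ≤ ordZ O (b.det b') := by
  obtain ⟨a, ha⟩ := exists_algebraMap_eq_det (b := b) (v := b')
    fun i ↦ h (Submodule.subset_span ⟨i, rfl⟩)
  have h0 := det_ne_zero_of_basis b b'
  rw [← ha] at h0 ⊢
  exact ordZ_algebraMap_nonneg O fun h ↦ h0 (by rw [h, map_zero])

variable (O) in
lemma ordZ_det_mul (b b' b'' : Basis ι K V) :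
    ordZ O (b.det b'') = ordZ O (b.det b') + ordZ O (b'.det b'') := by
  rw [← Basis.det_mul_det b b' b'', ordZ_mul O (det_ne_zero_of_basis _ _)
    (det_ne_zero_of_basis _ _)]

lemma ordZ_det_self (b : Basis ι K V) : ordZ O (b.det b) = 0 := by
  rw [Basis.det_self, ordZ_one]

lemma ordZ_det_eq_zero {b b' : Basis ι K V}
    (h : Submodule.span O (Set.range b') = Submodule.span O (Set.range b)) :
    ordZ O (b.det b') = 0 := by
  have h1 := ordZ_det_nonneg h.le
  have h2 := ordZ_det_nonneg h.ge
  have h3 := ordZ_det_mul O b b' b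
  rw [ordZ_det_self] at h3
  omega

variable (K) in
/-- An `O`-basis of a lattice in `V` is a `K`-basis of `V`. -/
lemma exists_basis_of_lattice {L : Submodule O V} (c : Basis ι O L)
    (hL : Submodule.span K (L : Set V) = ⊤) : ∃ b : Basis ι K V, ∀ i, b i = c i := by
  have h1 : LinearIndependent O fun i ↦ (c i : V) :=
    c.linearIndependent.map' L.subtype (Submodule.ker_subtype L)
  have h2 : LinearIndependent K fun i ↦ (c i : V) := (LinearIndependent.iff_fractionRing O K).mp h1
  have h3 : ⊤ ≤ Submodule.span K (Set.range fun i ↦ (c i : V)) := by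
    rw [← hL, Submodule.span_le]
    intro v hv
    have := c.sum_repr ⟨v, hv⟩
    rw [← show _ = v from congrArg Subtype.val this]
    rw [Submodule.coe_sum]
    refine Submodule.sum_mem _ fun i _ ↦ ?_
    rw [Submodule.coe_smul, ← algebraMap_smul K]
    exact Submodule.smul_mem _ _ (Submodule.subset_span ⟨i, rfl⟩)
  exact ⟨Basis.mk h2 h3, fun i ↦ Basis.mk_apply h2 h3 i⟩

lemma span_range_coe_basis {L : Submodule O V} (c : Basis ι O L) :
    Submodule.span O (Set.range fun i ↦ (c i : V)) = L := by
  have := congrArg (Submodule.map L.subtype) c.span_eq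
  rw [Submodule.map_span, ← Set.range_comp, Submodule.map_top, Submodule.range_subtype] at this
  exact this

variable (O) in
lemma span_span_range (b : Basis ι K V) :
    Submodule.span K ((Submodule.span O (Set.range b) : Submodule O V) : Set V) = ⊤ := by
  rw [eq_top_iff, ← b.span_eq, Submodule.span_le]
  rintro _ ⟨i, rfl⟩
  exact Submodule.subset_span (Submodule.subset_span ⟨i, rfl⟩)

variable (O) in
/-- A `K`-basis of `V` is an `O`-basis of the lattice which it spans. -/
def latticeBasis (b : Basis ι K V) : Basis ι O (Submodule.span O (Set.range b)) :=
  Basis.span (b.linearIndependent.restrict_scalars' O)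

/-- The colength of the lattice of `γ` in the lattice of `b` is the valuation of the determinant of
the base change. -/
lemma length_quotient_lattice {b γ : Basis ι K V}
    (h : Submodule.span O (Set.range γ) ≤ Submodule.span O (Set.range b)) :
    Module.length O (Submodule.span O (Set.range b) ⧸
      (Submodule.span O (Set.range γ)).submoduleOf (Submodule.span O (Set.range b))) =
        ((ordZ O (b.det γ)).toNat : ℕ∞) := by
  set Λ := Submodule.span O (Set.range b) with hΛ
  set L := Submodule.span O (Set.range γ) with hL
  have hrank : finrank O (L.submoduleOf Λ) = finrank O Λ := by
    rw [(Submodule.submoduleOfEquivOfLe h).finrank_eq, finrank_eq_card_basis (latticeBasis O b),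
      finrank_eq_card_basis (latticeBasis O γ)]
  rw [((L.submoduleOf Λ).quotientEquivPiSpan (latticeBasis O b) hrank).length_eq,
    Module.length_pi_of_fintype]
  -- Bases of the two lattices which are proportional, with factors `a i`.
  set a := Submodule.smithNormalFormCoeffs (latticeBasis O b) hrank with ha
  have ha0 : ∀ i, a i ≠ 0 := Submodule.smithNormalFormCoeffs_ne_zero _ hrank
  have haK : ∀ i, algebraMap O K (a i) ≠ 0 := fun i ↦
    (map_ne_zero_iff _ (IsFractionRing.injective O K)).mpr (ha0 i)
  let top := Submodule.smithNormalFormTopBasis (latticeBasis O b) hrank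
  let bot := (Submodule.smithNormalFormBotBasis (latticeBasis O b) hrank).map
    (Submodule.submoduleOfEquivOfLe h)
  have hbt : ∀ i, (bot i : V) = a i • (top i : V) := fun i ↦
    congrArg Subtype.val (Submodule.smithNormalFormBotBasis_def (latticeBasis O b) hrank i)
  obtain ⟨b', hb'⟩ := exists_basis_of_lattice K top (span_span_range O b)
  obtain ⟨γ', hγ'⟩ := exists_basis_of_lattice K bot (span_span_range O γ)
  have hb'Λ : Submodule.span O (Set.range b') = Λ := by
    rw [funext hb']
    exact span_range_coe_basis top
  have hγ'L : Submodule.span O (Set.range γ') = L := by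
    rw [funext hγ']
    exact span_range_coe_basis bot
  have hdet : b'.det γ' = ∏ i, algebraMap O K (a i) := by
    have : (γ' : ι → V) = fun i ↦ algebraMap O K (a i) • b' i := by
      funext i
      rw [hγ', hb', hbt, algebraMap_smul]
    rw [this, AlternatingMap.map_smul_univ, Basis.det_self, smul_eq_mul, mul_one]
  have hord : ordZ O (b.det γ) = ∑ i, ordZ O (algebraMap O K (a i)) := by
    rw [ordZ_det_mul O b b' γ, ordZ_det_mul O b' γ' γ, ordZ_det_eq_zero (hb'Λ.trans hΛ),
      ordZ_det_eq_zero (hL.symm.trans hγ'L.symm), hdet, ordZ_prod O haK]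
    ring
  rw [hord]
  simp_rw [ordZ_algebraMap O (ha0 _)]
  rw [← Nat.cast_sum, Int.toNat_natCast, Nat.cast_sum]
  refine Finset.sum_congr rfl fun i _ ↦ ?_
  exact (ENat.natCast_toNat (Ring.ord_ne_top (mem_nonZeroDivisors_of_ne_zero (ha0 i)))).symm

/-- The generalized index `length (L / L ∩ Λ) - length (Λ / L ∩ Λ)` of two lattices. -/
def latticeIndex (L Λ : Submodule O V) : ℤ :=
  ((Module.length O (L ⧸ Λ.submoduleOf L)).toNat : ℤ) -
    (Module.length O (Λ ⧸ L.submoduleOf Λ)).toNat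

lemma length_quotient_add {N P L : Submodule O V} (hNP : N ≤ P) (hPL : P ≤ L) :
    Module.length O (L ⧸ N.submoduleOf L) =
      Module.length O (P ⧸ N.submoduleOf P) + Module.length O (L ⧸ P.submoduleOf L) := by
  refine Module.length_eq_add_of_exact
    (Submodule.mapQ _ _ (Submodule.inclusion hPL) fun x hx ↦ hx)
    (Submodule.factor (Submodule.comap_mono hNP)) ?_ (Submodule.factor_surjective _) ?_
  · rw [injective_iff_map_eq_zero]
    intro x
    obtain ⟨x, rfl⟩ := Submodule.mkQ_surjective _ x
    intro hx
    exact (Submodule.Quotient.mk_eq_zero (N.submoduleOf P)).mpr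
      (show (x : V) ∈ N from (Submodule.Quotient.mk_eq_zero (N.submoduleOf L)).mp hx)
  · intro x
    obtain ⟨x, rfl⟩ := Submodule.mkQ_surjective _ x
    constructor
    · intro hx
      exact ⟨Submodule.mkQ _ ⟨x.1, (Submodule.Quotient.mk_eq_zero (P.submoduleOf L)).mp hx⟩, rfl⟩
    · rintro ⟨y, hy⟩
      obtain ⟨y, rfl⟩ := Submodule.mkQ_surjective _ y
      rw [← hy]
      exact (Submodule.Quotient.mk_eq_zero (P.submoduleOf L)).mpr y.2

/-- The index of two lattices may be computed with any common sublattice. The lengths are required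
to be finite as `ENat.toNat ⊤ = 0`. -/
lemma latticeIndex_eq_sub {N L Λ : Submodule O V} (hL : N ≤ L) (hΛ : N ≤ Λ)
    (hLf : Module.length O (L ⧸ N.submoduleOf L) ≠ ⊤)
    (hΛf : Module.length O (Λ ⧸ N.submoduleOf Λ) ≠ ⊤) :
    latticeIndex L Λ = ((Module.length O (L ⧸ N.submoduleOf L)).toNat : ℤ) -
      (Module.length O (Λ ⧸ N.submoduleOf Λ)).toNat := by
  have h1 := length_quotient_add (le_inf hL hΛ) (inf_le_left : L ⊓ Λ ≤ L)
  have h2 := length_quotient_add (le_inf hL hΛ) (inf_le_right : L ⊓ Λ ≤ Λ)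
  have e1 : (L ⊓ Λ).submoduleOf L = Λ.submoduleOf L := by
    simp [Submodule.submoduleOf, Submodule.comap_inf]
  have e2 : (L ⊓ Λ).submoduleOf Λ = L.submoduleOf Λ := by
    simp [Submodule.submoduleOf, Submodule.comap_inf]
  rw [e1] at h1
  rw [e2] at h2
  rw [h1] at hLf ⊢
  rw [h2] at hΛf ⊢
  rw [ne_eq, ENat.add_eq_top, not_or] at hLf hΛf
  rw [ENat.toNat_add hLf.1 hLf.2, ENat.toNat_add hΛf.1 hΛf.2]
  unfold latticeIndex
  push_cast
  ring

variable (K) in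
lemma exists_smul_mem_span (β : Basis ι K V) (v : V) :
    ∃ a : O, a ≠ 0 ∧ a • v ∈ Submodule.span O (Set.range β) := by
  classical
  obtain ⟨a, ha⟩ := IsLocalization.exist_integer_multiples_of_finset (nonZeroDivisors O)
    (Finset.univ.image fun i ↦ β.repr v i)
  refine ⟨a, nonZeroDivisors.ne_zero a.2, ?_⟩
  rw [← β.sum_repr v, Finset.smul_sum]
  refine Submodule.sum_mem _ fun i _ ↦ ?_
  obtain ⟨c, hc⟩ := ha (β.repr v i) (Finset.mem_image_of_mem _ (Finset.mem_univ i))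
  rw [← smul_assoc, ← hc, algebraMap_smul]
  exact Submodule.smul_mem _ _ (Submodule.subset_span ⟨i, rfl⟩)

variable (O) in
/-- Two lattices contain a common one. -/
lemma exists_lattice_le (b β : Basis ι K V) : ∃ γ : Basis ι K V,
    Submodule.span O (Set.range γ) ≤ Submodule.span O (Set.range b) ∧
      Submodule.span O (Set.range γ) ≤ Submodule.span O (Set.range β) := by
  choose a ha0 ha using fun i ↦ exists_smul_mem_span K β (O := O) (b i)
  have haK : ∀ i, algebraMap O K (a i) ≠ 0 := fun i ↦
    (map_ne_zero_iff _ (IsFractionRing.injective O K)).mpr (ha0 i)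
  refine ⟨b.isUnitSMul fun i ↦ (haK i).isUnit, ?_, ?_⟩
  · rw [Submodule.span_le]
    rintro _ ⟨i, rfl⟩
    rw [Basis.isUnitSMul_apply, algebraMap_smul]
    exact Submodule.smul_mem _ _ (Submodule.subset_span ⟨i, rfl⟩)
  · rw [Submodule.span_le]
    rintro _ ⟨i, rfl⟩
    rw [Basis.isUnitSMul_apply, algebraMap_smul]
    exact ha i

/-- The index of two free lattices is given by the determinant. -/
theorem latticeIndex_span_span (β b : Basis ι K V) :
    latticeIndex (Submodule.span O (Set.range β)) (Submodule.span O (Set.range b)) =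
      -ordZ O (b.det β) := by
  obtain ⟨γ, h1, h2⟩ := exists_lattice_le O β b
  have e1 := length_quotient_lattice h1
  have e2 := length_quotient_lattice h2
  rw [latticeIndex_eq_sub h1 h2 (by rw [e1]; exact ENat.natCast_ne_top _)
    (by rw [e2]; exact ENat.natCast_ne_top _), e1, e2, ENat.toNat_natCast, ENat.toNat_natCast,
    Int.toNat_of_nonneg (ordZ_det_nonneg h1), Int.toNat_of_nonneg (ordZ_det_nonneg h2),
    ordZ_det_mul O b β γ]
  ring

variable (K) in
/-- Every lattice over a discrete valuation ring is free. -/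
lemma exists_basis_span_eq (b : Basis ι K V) {L : Submodule O V} [Module.Finite O L]
    (hL : Submodule.span K (L : Set V) = ⊤) :
    ∃ β : Basis ι K V, Submodule.span O (Set.range β) = L := by
  have : Module.IsTorsionFree O V := by
    refine Module.isTorsionFree_iff_smul_eq_zero.mpr fun a v h ↦ ?_
    rw [← algebraMap_smul K, smul_eq_zero] at h
    exact h.imp_left fun h ↦ (map_eq_zero_iff _ (IsFractionRing.injective O K)).mp h
  have : Module.Free O L := inferInstance
  let c := Module.Free.chooseBasis O L
  obtain ⟨β, hβ⟩ := exists_basis_of_lattice K c hL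
  let e : Module.Free.ChooseBasisIndex O L ≃ ι := β.indexEquiv b
  refine ⟨β.reindex e, ?_⟩
  rw [Basis.range_reindex, funext hβ]
  exact span_range_coe_basis c

/-- Two lattices, one contained in the other, agree if the determinant of the base change is a unit.
-/
lemma span_eq_of_ordZ_det_eq_zero {b b' : Basis ι K V}
    (h : Submodule.span O (Set.range b') ≤ Submodule.span O (Set.range b))
    (h0 : ordZ O (b.det b') = 0) :
    Submodule.span O (Set.range b') = Submodule.span O (Set.range b) := by
  have := length_quotient_lattice h
  rw [h0, Int.toNat_zero, Nat.cast_zero, Module.length_eq_zero_iff,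
    Submodule.Quotient.subsingleton_iff] at this
  exact h.antisymm (Submodule.submoduleOf_eq_top.mp this)

end Lattice

/-! ### Étale algebras over a polynomial ring in one variable -/

section EtaleLine

open IsLocalRing

/-- The maximal ideals of the local rings of an étale algebra over a principal ideal domain are
principal, as they are generated by the ones downstairs. -/
lemma isPrincipal_maximalIdeal_of_etale (P : Type) {B : Type} [CommRing P] [IsDomain P]
    [IsPrincipalIdealRing P] [CommRing B] [Algebra P B] [Algebra.Etale P B]
    (q : Ideal B) [q.IsPrime] (R : Type) [CommRing R]
    [IsLocalRing R] [Algebra B R] [IsLocalization.AtPrime R q] : (maximalIdeal R).IsPrincipal := by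
  let _ : Algebra P R := Algebra.compHom R (algebraMap P B)
  have : IsScalarTower P B R := IsScalarTower.of_algebraMap_eq fun _ ↦ rfl
  let p : Ideal P := q.comap (algebraMap P B)
  let S := Localization.AtPrime p
  have hu : ∀ y : p.primeCompl, IsUnit (algebraMap P R y) := fun y ↦ by
    rw [IsScalarTower.algebraMap_apply P B R]
    exact (IsLocalization.AtPrime.isUnit_to_map_iff R q _).mpr y.2
  let g : S →+* R := IsLocalization.lift (M := p.primeCompl) hu
  let _ : Algebra S R := g.toAlgebra
  have : IsScalarTower P S R := IsScalarTower.of_algebraMap_eq fun x ↦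
    (IsLocalization.lift_eq hu x).symm
  have hg : IsLocalHom (algebraMap S R) := by
    refine ⟨fun a ha ↦ ?_⟩
    obtain ⟨x, s, rfl⟩ := IsLocalization.exists_mk'_eq p.primeCompl a
    rw [IsLocalization.AtPrime.isUnit_mk'_iff S p]
    have h1 : algebraMap S R (IsLocalization.mk' S x s) * algebraMap P R s = algebraMap P R x := by
      rw [IsScalarTower.algebraMap_apply P S R s, IsScalarTower.algebraMap_apply P S R x, ← map_mul,
        IsLocalization.mk'_spec]
    have h2 : IsUnit (algebraMap P R x) := h1 ▸ ha.mul (hu s)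
    rw [IsScalarTower.algebraMap_apply P B R] at h2
    exact (IsLocalization.AtPrime.isUnit_to_map_iff R q _).mp h2
  have h1 : Algebra.FormallyUnramified B R := .of_isLocalization q.primeCompl
  have h2 : Algebra.FormallyUnramified P R := .comp P B R
  have h3 : Algebra.FormallyUnramified S R := .of_restrictScalars P S R
  have h4 : Algebra.EssFiniteType B R := .of_isLocalization R q.primeCompl
  have h5 : Algebra.EssFiniteType P R := .comp P B R
  have h6 : Algebra.EssFiniteType S R := .of_comp P S R
  rw [← Algebra.FormallyUnramified.map_maximalIdeal (R := S) (S := R),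
    ← Localization.AtPrime.map_eq_maximalIdeal, Ideal.map_map, ← IsScalarTower.algebraMap_eq]
  obtain ⟨a, ha⟩ := (IsPrincipalIdealRing.principal p).principal
  exact ⟨⟨algebraMap P R a, by rw [ha, ← Ideal.span, Ideal.map_span, Set.image_singleton]⟩⟩

/-- The local rings of an étale algebra over a principal ideal domain at its nonzero primes are
discrete valuation rings. -/
lemma isDiscreteValuationRing_of_etale (P : Type) {B : Type} [CommRing P] [IsDomain P]
    [IsPrincipalIdealRing P] [CommRing B] [IsDomain B] [Algebra P B] [Algebra.Etale P B]
    [IsNoetherianRing B] (q : Ideal B) [q.IsPrime] (hq : q ≠ ⊥)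
    (R : Type) [CommRing R] [IsDomain R] [IsLocalRing R] [Algebra B R]
    [IsLocalization.AtPrime R q] : IsDiscreteValuationRing R := by
  have : IsNoetherianRing R := IsLocalization.isNoetherianRing q.primeCompl R inferInstance
  have hR : ¬ IsField R := by
    rw [isField_iff_maximalIdeal_eq]
    intro h
    obtain ⟨b, hb, hb0⟩ := Submodule.exists_mem_ne_zero_of_ne_bot hq
    have := (IsLocalization.AtPrime.to_map_mem_maximal_iff R q b).mpr hb
    rw [h, Ideal.mem_bot, map_eq_zero_iff _
      (IsLocalization.injective R q.primeCompl_le_nonZeroDivisors)] at this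
    exact hb0 this
  exact ((IsDiscreteValuationRing.TFAE R hR).out 0 4).mpr
    (isPrincipal_maximalIdeal_of_etale P q R)

lemma algebraMap_injective_of_etale (P : Type) {B : Type} [CommRing P] [IsDomain P] [CommRing B]
    [IsDomain B] [Algebra P B] [Algebra.Etale P B] : Function.Injective (algebraMap P B) := by
  have : Module.Flat P B := inferInstance
  exact FaithfulSMul.algebraMap_injective P B

end EtaleLine

section Chart

variable {k B : Type} [Field k] [CommRing B] [IsDomain B] (g : MvPolynomial (Fin 1) k →+* B)

lemma isPrincipalIdealRing_mvPolynomial : IsPrincipalIdealRing (MvPolynomial (Fin 1) k) :=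
  IsPrincipalIdealRing.of_surjective (MvPolynomial.uniqueAlgEquiv k (Fin 1)).symm.toRingHom
    (MvPolynomial.uniqueAlgEquiv k (Fin 1)).symm.surjective

/-- A field finitely generated over `k` is finite over `k`, but an étale algebra over the affine
line contains the polynomial ring. -/
lemma not_isField_of_etale (hg : g.Etale) : ¬ IsField B := by
  intro hB
  let _ := hB.toField
  algebraize [g, g.comp MvPolynomial.C]
  have := isPrincipalIdealRing_mvPolynomial (k := k)
  have h1 := algebraMap_injective_of_etale (MvPolynomial (Fin 1) k) (B := B)
  have h2 : Algebra.FiniteType k B := .trans (S := MvPolynomial (Fin 1) k) inferInstance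
    inferInstance
  have h3 : Module.Finite k B := finite_of_finite_type_of_isJacobsonRing k B
  have h4 : Module.Finite k (MvPolynomial (Fin 1) k) := Module.Finite.of_injective
    (IsScalarTower.toAlgHom k (MvPolynomial (Fin 1) k) B).toLinearMap h1
  have h5 : Module.Finite k (Polynomial k) := Module.Finite.equiv
    (MvPolynomial.uniqueAlgEquiv k (Fin 1)).toLinearEquiv
  exact Polynomial.not_finite h5

/-- A curve has a function field of transcendence degree one: it is finite over the subfield
generated by any transcendental element. -/
lemma finiteDimensional_of_etale (hg : g.Etale) {K : Type} [Field K] [Algebra k K] [Algebra B K]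
    [IsFractionRing B K] (hk : ∀ c, algebraMap k K c = algebraMap B K (g (.C c))) (f : K)
    (hf : Transcendental k f) :
    FiniteDimensional (IntermediateField.adjoin k {f}) K := by
  let P := MvPolynomial (Fin 1) k
  algebraize [g, g.comp MvPolynomial.C]
  let _ : Algebra P K := Algebra.compHom K (algebraMap P B)
  have : IsScalarTower P B K := IsScalarTower.of_algebraMap_eq fun _ ↦ rfl
  have : IsScalarTower k B K := IsScalarTower.of_algebraMap_eq hk
  have : IsScalarTower k P K := IsScalarTower.of_algebraMap_eq hk
  have := isPrincipalIdealRing_mvPolynomial (k := k)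
  have h1 := algebraMap_injective_of_etale P (B := B)
  have hPK : Function.Injective (algebraMap P K) := by
    rw [IsScalarTower.algebraMap_eq P B K]
    exact (IsFractionRing.injective B K).comp h1
  let Q := FractionRing P
  let i : Q →+* K := IsFractionRing.lift hPK
  let _ : Algebra Q K := i.toAlgebra
  have : IsScalarTower P Q K := IsScalarTower.of_algebraMap_eq fun x ↦
    (IsFractionRing.lift_algebraMap hPK x).symm
  have u1 : Algebra.FormallyUnramified B K := .of_isLocalization (nonZeroDivisors B)
  have u2 : Algebra.FormallyUnramified P K := .comp P B K
  have u3 : Algebra.FormallyUnramified Q K := .of_restrictScalars P Q K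
  have e1 : Algebra.EssFiniteType B K := .of_isLocalization K (nonZeroDivisors B)
  have e2 : Algebra.EssFiniteType P K := .comp P B K
  have e3 : Algebra.EssFiniteType Q K := .of_comp P Q K
  have e4 : Algebra.EssFiniteType k K := .comp k P K
  have f1 : Module.Finite Q K := Algebra.FormallyUnramified.finite_of_free Q K
  -- The function field is algebraic over the field generated by the coordinate.
  let t : K := algebraMap P K (.X 0)
  have hadj : ∀ p : P, algebraMap P K p ∈ Algebra.adjoin k {t} := by
    intro p
    induction p using MvPolynomial.induction_on with
    | C a =>
      have : algebraMap P K (.C a) = algebraMap k K a :=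
        (IsScalarTower.algebraMap_apply k P K a).symm
      rw [this]
      exact Subalgebra.algebraMap_mem _ a
    | add p q hp hq => rw [map_add]; exact add_mem hp hq
    | mul_X p j hp =>
      rw [map_mul, Subsingleton.elim j 0]
      exact mul_mem hp (Algebra.subset_adjoin rfl)
  have hP : Algebra.IsAlgebraic P K :=
    (IsFractionRing.comap_isAlgebraic_iff (A := P) (K := Q) (C := K)).mpr inferInstance
  have halg : Algebra.IsAlgebraic (Algebra.adjoin k {t}) K := by
    let j : P →+* Algebra.adjoin k {t} := (algebraMap P K).codRestrict _ hadj
    refine ⟨fun a ↦ ?_⟩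
    obtain ⟨p, hp0, hp⟩ := hP.isAlgebraic a
    refine ⟨p.map j, ?_, ?_⟩
    · rw [Polynomial.map_ne_zero_iff]
      · exact hp0
      · intro a b hab
        exact hPK (congrArg Subtype.val hab)
    · rw [Polynomial.aeval_def, Polynomial.eval₂_map]
      exact hp
  have htr : Algebra.trdeg k K ≤ 1 :=
    (Algebra.IsAlgebraic.trdeg_le_cardinalMk k ({t} : Set K)).trans (by simp)
  have hfi : AlgebraicIndependent k (fun _ : Fin 1 ↦ f) :=
    algebraicIndependent_unique_type_iff.mpr hf
  have hb : IsTranscendenceBasis k (fun _ : Fin 1 ↦ f) :=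
    hfi.isTranscendenceBasis_of_trdeg_le_of_finite (by simpa using htr)
  have hba := hb.isAlgebraic_field
  have hr : Set.range (fun _ : Fin 1 ↦ f) = {f} := by ext; simp [eq_comm]
  rw [hr] at hba
  have : Algebra.EssFiniteType (IntermediateField.adjoin k {f}) K := .of_comp k _ K
  exact Algebra.finite_of_essFiniteType_of_isAlgebraic

end Chart

/-! ### Smooth proper curves -/

section Curve

variable {X : Scheme.{0}}

/-- The constants `ℂ → 𝒪_{X,x}`. -/
def stalkConst (f : X ⟶ Spec (.of ℂ)) (x : X) : CommRingCat.of ℂ ⟶ X.presheaf.stalk x :=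
  (Scheme.ΓSpecIso (.of ℂ)).inv ≫ f.appTop ≫ X.presheaf.germ ⊤ x trivial

lemma stalkConst_specializes (f : X ⟶ Spec (.of ℂ)) {x y : X} (h : x ⤳ y) :
    stalkConst f y ≫ X.presheaf.stalkSpecializes h = stalkConst f x := by
  simp only [stalkConst, Category.assoc]
  exact congrArg (fun z ↦ (Scheme.ΓSpecIso (.of ℂ)).inv ≫ f.appTop ≫ z)
    (X.presheaf.germ_stalkSpecializes (U := ⊤) trivial h)

lemma spec_stalkConst (f : X ⟶ Spec (.of ℂ)) (x : X) :
    Spec.map (stalkConst f x) = X.fromSpecStalk x ≫ f := by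
  have h1 := Scheme.toSpecΓ_naturality (X.fromSpecStalk x ≫ f)
  rw [Scheme.Hom.comp_appTop, Scheme.fromSpecStalk_appTop] at h1
  have h2 : (X.fromSpecStalk x ≫ f) = ((X.fromSpecStalk x ≫ f) ≫ (Spec (.of ℂ)).toSpecΓ) ≫
      Spec.map (Scheme.ΓSpecIso (.of ℂ)).inv := by
    rw [Category.assoc, ← SpecMap_ΓSpecIso_hom, ← Spec.map_comp, Iso.inv_hom_id, Spec.map_id,
      Category.comp_id]
  rw [h2, h1, ← SpecMap_ΓSpecIso_hom, ← Spec.map_comp, ← Spec.map_comp]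
  congr 1
  simp only [stalkConst, Category.assoc]
  have h3 : (Spec (X.presheaf.stalk x)).presheaf.map (homOfLE le_top).op =
      𝟙 ((Spec (X.presheaf.stalk x)).presheaf.obj (op ⊤)) :=
    (Spec (X.presheaf.stalk x)).presheaf.map_id _
  rw [h3, Category.id_comp, Iso.inv_hom_id, Category.comp_id]

/-- A smooth curve is locally étale over the affine line. -/
lemma exists_etale_chart (f : X ⟶ Spec (.of ℂ)) [SmoothOfRelativeDimension 1 f] (x : X) :
    ∃ V : X.Opens, IsAffineOpen V ∧ x ∈ V ∧ ∃ g : MvPolynomial (Fin 1) ℂ →+* Γ(X, V), g.Etale ∧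
      ∀ c, g (.C c) = (constantsTo f).app (op V) c := by
  obtain ⟨U, -, V, hV, hx, e, hs⟩ :=
    SmoothOfRelativeDimension.exists_isStandardSmoothOfRelativeDimension (n := 1) (f := f) x
  have hU : U = ⊤ := by
    refine top_le_iff.mp fun y _ ↦ ?_
    have : Subsingleton (Spec (.of ℂ)) := inferInstanceAs (Subsingleton (PrimeSpectrum ℂ))
    rw [Subsingleton.elim y (f x)]
    exact e hx
  subst hU
  have hs' := (RingHom.isStandardSmoothOfRelativeDimension_respectsIso (n := 1)).2 _
    (Scheme.ΓSpecIso (.of ℂ)).symm.commRingCatIsoToRingEquiv hs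
  obtain ⟨g, hg, hge⟩ := hs'.exists_etale_mvPolynomial
  refine ⟨V, hV, hx, g, hge, fun c ↦ ?_⟩
  exact RingHom.congr_fun hg c

variable [IsIntegral X]

lemma isNoetherianRing_of_etale {V : X.Opens} (g : MvPolynomial (Fin 1) ℂ →+* Γ(X, V))
    (hg : g.Etale) : IsNoetherianRing Γ(X, V) := by
  algebraize [g]
  exact Algebra.FiniteType.isNoetherianRing (MvPolynomial (Fin 1) ℂ) _

lemma isLocallyNoetherian_curve (f : X ⟶ Spec (.of ℂ)) [SmoothOfRelativeDimension 1 f] :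
    IsLocallyNoetherian X := by
  choose V hV hx g hg _ using exists_etale_chart f
  refine isLocallyNoetherian_of_affine_cover (S := fun x ↦ (⟨V x, hV x⟩ : X.affineOpens)) ?_
    fun x ↦ isNoetherianRing_of_etale (g x) (hg x)
  exact top_le_iff.mp fun x _ ↦ Opens.mem_iSup.mpr ⟨x, hx x⟩

/-- The local rings of a smooth curve at its closed points are discrete valuation rings. -/
lemma isDiscreteValuationRing_stalk (f : X ⟶ Spec (.of ℂ)) [SmoothOfRelativeDimension 1 f]
    (x : X) (hx : IsClosed {x}) :
    IsDiscreteValuationRing (X.presheaf.stalk x) := by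
  obtain ⟨V, hV, hxV, g, hg, -⟩ := exists_etale_chart f x
  have : Nonempty V := ⟨⟨x, hxV⟩⟩
  have h1 := hV.primeIdealOf_isMaximal_of_isClosed ⟨x, hxV⟩ hx
  let _ := X.presheaf.algebra_section_stalk ⟨x, hxV⟩
  have h2 := hV.isLocalization_stalk ⟨x, hxV⟩
  have h3 := isNoetherianRing_of_etale g hg
  have h4 : (hV.primeIdealOf ⟨x, hxV⟩).asIdeal ≠ ⊥ := fun h ↦
    not_isField_of_etale g hg (Ring.isField_iff_maximal_bot.mpr (h ▸ h1))
  have := isPrincipalIdealRing_mvPolynomial (k := ℂ)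
  algebraize [g]
  exact isDiscreteValuationRing_of_etale (MvPolynomial (Fin 1) ℂ) _ h4 _

lemma not_isClosed_genericPoint (f : X ⟶ Spec (.of ℂ)) [SmoothOfRelativeDimension 1 f] :
    ¬ IsClosed {genericPoint X} := by
  intro h
  have h1 := isDiscreteValuationRing_stalk f _ h
  have h2 : IsField X.functionField := Field.toIsField _
  exact IsDiscreteValuationRing.not_isField (X.presheaf.stalk (genericPoint X)) h2

lemma compactSpace_of_isProper (f : X ⟶ Spec (.of ℂ)) [IsProper f] : CompactSpace X := by
  exact (quasiCompact_iff_compactSpace (f := f)).mp inferInstance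

lemma isClosed_or_eq_genericPoint (f : X ⟶ Spec (.of ℂ)) [SmoothOfRelativeDimension 1 f]
    [IsProper f] (x : X) : IsClosed {x} ∨ x = genericPoint X := by
  have := compactSpace_of_isProper f
  obtain ⟨y, hy, hyc⟩ := (isClosed_closure (s := {x})).exists_closed_singleton
    ⟨x, subset_closure rfl⟩
  have hxy : x ⤳ y := specializes_iff_mem_closure.mpr hy
  have h1 := isDiscreteValuationRing_stalk f y hyc
  have key : ∀ z : X, z ⤳ y → z = y ∨ z = X.fromSpecStalk y ⟨⊥, Ideal.isPrime_bot⟩ := by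
    intro z hz
    have hz' : z ∈ Set.range (X.fromSpecStalk y) := by rw [Scheme.range_fromSpecStalk]; exact hz
    obtain ⟨p, rfl⟩ := hz'
    by_cases hp : p.asIdeal = ⊥
    · right
      congr 1
      exact PrimeSpectrum.ext hp
    · left
      have := p.2
      have := IsPrime.to_maximal_ideal (S := p.asIdeal) hp
      have h2 : p = IsLocalRing.closedPoint (X.presheaf.stalk y) :=
        PrimeSpectrum.ext (IsLocalRing.eq_maximalIdeal this)
      rw [h2, Scheme.fromSpecStalk_closedPoint]
  have hη : genericPoint X ⤳ y := (genericPoint_spec X).specializes trivial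
  rcases key x hxy with h | h
  · exact .inl (h ▸ hyc)
  rcases key _ hη with h' | h'
  · exact (not_isClosed_genericPoint f (h' ▸ hyc)).elim
  · exact .inr (h.trans h'.symm)

/-- A nonempty open subset of a curve contains all but finitely many closed points. -/
lemma finite_notMem (f : X ⟶ Spec (.of ℂ)) [SmoothOfRelativeDimension 1 f] [IsProper f]
    {U : X.Opens} (hU : genericPoint X ∈ U) :
    {x : {x : X // IsClosed {x}} | x.1 ∉ U}.Finite := by
  have := compactSpace_of_isProper f
  have := isLocallyNoetherian_curve f
  have : AlgebraicGeometry.IsNoetherian X := ⟨⟩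
  obtain ⟨S, hS, hirr, hsup⟩ := NoetherianSpace.exists_finite_set_closeds_irreducible
    (⟨(U : Set X)ᶜ, U.isOpen.isClosed_compl⟩ : Closeds X)
  have hle : ∀ t ∈ S, (t : Set X) ⊆ (U : Set X)ᶜ := fun t ht ↦ by
    have : t ≤ sSup S := le_sSup ht
    rw [← hsup] at this
    exact this
  have hsub : ∀ t ∈ S, (t : Set X).Subsingleton := by
    intro t ht
    have hg := (hirr t ht).isGenericPoint_genericPoint t.isClosed
    rcases isClosed_or_eq_genericPoint f (hirr t ht).genericPoint with h | h
    · rw [← hg.def, h.closure_eq]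
      exact Set.subsingleton_singleton
    · have := hle t ht hg.mem
      rw [h] at this
      exact (this hU).elim
  have hfin : ((U : Set X)ᶜ).Finite := by
    have h2 : (U : Set X)ᶜ = ⋃ t ∈ S, (t : Set X) := by
      have h3 := congrArg (fun Z : Closeds X ↦ (Z : Set X)) hsup
      rw [show sSup S = hS.toFinset.sup id by rw [Finset.sup_id_eq_sSup, hS.coe_toFinset]] at h3
      simpa [Closeds.coe_finset_sup] using h3
    rw [h2]
    exact hS.biUnion fun t ht ↦ (hsub t ht).finite
  exact hfin.preimage Subtype.val_injective.injOn

end Curve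

/-! ### Principal divisors on a proper curve -/

section Valuative

variable {X : Scheme.{0}} [IsIntegral X]

/-- The map `𝒪_{X,x} → A` of subrings of the function field induced by a morphism `Spec A → X`
which is generically the inclusion of the generic point. -/
lemma algebraMap_stalkClosedPointTo {A : Type} [CommRing A] [IsLocalRing A]
    [Algebra A X.functionField] (l : Spec (.of A) ⟶ X)
    (hl : Spec.map (CommRingCat.ofHom (algebraMap A X.functionField)) ≫ l =
      X.fromSpecStalk (genericPoint X)) (r) :
    algebraMap A X.functionField ((Scheme.stalkClosedPointTo l).hom r) =
      algebraMap (X.presheaf.stalk (l (IsLocalRing.closedPoint A))) X.functionField r := by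
  have h1 := Scheme.Spec_stalkClosedPointTo_fromSpecStalk l
  have h2 := Scheme.SpecMap_stalkSpecializes_fromSpecStalk (X := X)
    ((genericPoint_spec X).specializes (Set.mem_univ (l (IsLocalRing.closedPoint A))))
  have h3 : Spec.map (X.presheaf.stalkSpecializes
      ((genericPoint_spec X).specializes (Set.mem_univ (l (IsLocalRing.closedPoint A))))) =
      Spec.map (CommRingCat.ofHom (algebraMap A X.functionField)) ≫
        Spec.map (Scheme.stalkClosedPointTo l) := by
    rw [← cancel_mono (X.fromSpecStalk (l (IsLocalRing.closedPoint A))), Category.assoc]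
    refine h2.trans (hl.symm.trans ?_)
    exact congrArg _ h1.symm
  rw [← Spec.map_comp] at h3
  have h4 := Spec.map_injective h3
  exact (RingHom.congr_fun (congrArg CommRingCat.Hom.hom h4) r).symm

/-- The local rings of a proper curve at its closed points are all the discrete valuation rings of
its function field which contain the constants. -/
lemma exists_range_stalk_subset (f : X ⟶ Spec (.of ℂ)) [SmoothOfRelativeDimension 1 f] [IsProper f]
    (A : Type) [CommRing A] [IsDomain A] [IsDiscreteValuationRing A] [Algebra A X.functionField]
    [IsFractionRing A X.functionField]
    (hA : ∀ c : ℂ, (stalkConst f (genericPoint X)).hom c ∈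
      Set.range (algebraMap A X.functionField)) :
    ∃ x : {x : X // IsClosed {x}}, Set.range (algebraMap (X.presheaf.stalk x.1) X.functionField) ⊆
      Set.range (algebraMap A X.functionField) := by
  let j : ℂ →+* A := liftRange (stalkConst f (genericPoint X)).hom hA
  have hj : ∀ c, algebraMap A X.functionField (j c) = (stalkConst f (genericPoint X)).hom c :=
    algebraMap_liftRange _ hA
  have hsq : CommSq (X.fromSpecStalk (genericPoint X))
      (Spec.map (CommRingCat.ofHom (algebraMap A X.functionField))) f
      (Spec.map (CommRingCat.ofHom j)) := ⟨by
    rw [← spec_stalkConst]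
    refine Eq.trans ?_ (Spec.map_comp (CommRingCat.ofHom j)
      (CommRingCat.ofHom (S := X.functionField) (algebraMap A X.functionField)))
    exact congrArg _ (CommRingCat.hom_ext (RingHom.ext fun c ↦ (hj c).symm))⟩
  have hex : ValuativeCriterion.Existence f := by
    have : @UniversallyClosed _ _ f := inferInstance
    rw [UniversallyClosed.eq_valuativeCriterion] at this
    exact this.1
  obtain ⟨⟨l, hl, -⟩⟩ := hex ⟨A, X.functionField, X.fromSpecStalk (genericPoint X), _, hsq⟩
  have key := algebraMap_stalkClosedPointTo l hl
  have hsub : Set.range (algebraMap (X.presheaf.stalk (l (IsLocalRing.closedPoint A)))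
      X.functionField) ⊆ Set.range (algebraMap A X.functionField) := by
    rintro _ ⟨r, rfl⟩
    exact ⟨_, key r⟩
  refine ⟨⟨l (IsLocalRing.closedPoint A), ?_⟩, hsub⟩
  refine (isClosed_or_eq_genericPoint f _).resolve_right fun h ↦ ?_
  -- Otherwise `A` contains the whole function field.
  have hsurj : Function.Surjective (algebraMap A X.functionField) := by
    have h1 : ∀ y : X, y = genericPoint X →
        Function.Surjective (algebraMap (X.presheaf.stalk y) X.functionField) := by
      rintro _ rfl a
      refine ⟨a, ?_⟩
      rw [RingHom.algebraMap_toAlgebra]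
      exact congrArg (fun φ : X.functionField ⟶ X.functionField ↦ φ.hom a)
        (X.presheaf.stalkSpecializes_refl (genericPoint X))
    intro a
    exact hsub (h1 _ h a)
  exact IsDiscreteValuationRing.not_isField A
    (MulEquiv.isField (Field.toIsField X.functionField) (RingEquiv.ofBijective _
      ⟨IsFractionRing.injective A X.functionField, hsurj⟩).toMulEquiv)

/-- As a curve is separated, a closed point is determined by its local ring. -/
lemma eq_of_range_stalk_eq (f : X ⟶ Spec (.of ℂ)) [SmoothOfRelativeDimension 1 f] [IsProper f]
    (x y : {x : X // IsClosed {x}})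
    (h : Set.range (algebraMap (X.presheaf.stalk x.1) X.functionField) =
      Set.range (algebraMap (X.presheaf.stalk y.1) X.functionField)) : x = y := by
  have := isDiscreteValuationRing_stalk f x.1 x.2
  have := isDiscreteValuationRing_stalk f y.1 y.2
  have hx : ∀ r, ∃ b, algebraMap (X.presheaf.stalk x.1) X.functionField b =
      algebraMap (X.presheaf.stalk y.1) X.functionField r := fun r ↦ by
    have : algebraMap (X.presheaf.stalk y.1) X.functionField r ∈
      Set.range (algebraMap (X.presheaf.stalk x.1) X.functionField) := h ▸ ⟨r, rfl⟩
    exact this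
  let φ : X.presheaf.stalk y.1 →+* X.presheaf.stalk x.1 := liftRange (algebraMap _ _) hx
  have hφ : ∀ r, algebraMap _ X.functionField (φ r) = algebraMap _ X.functionField r :=
    algebraMap_liftRange _ hx
  have hinj : ∀ z : X, Function.Injective (algebraMap (X.presheaf.stalk z) X.functionField) :=
    fun z ↦ IsFractionRing.injective _ _
  have hφb : Function.Bijective φ := by
    constructor
    · intro a b hab
      apply hinj
      rw [← hφ, ← hφ, hab]
    · intro a
      have : algebraMap (X.presheaf.stalk x.1) X.functionField a ∈
        Set.range (algebraMap (X.presheaf.stalk y.1) X.functionField) := h ▸ ⟨a, rfl⟩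
      obtain ⟨b, hb⟩ := this
      exact ⟨b, hinj _ ((hφ b).trans hb)⟩
  let l₁ := X.fromSpecStalk x.1
  let l₂ := Spec.map (CommRingCat.ofHom φ) ≫ X.fromSpecStalk y.1
  have hgen : ∀ z : X, Spec.map (CommRingCat.ofHom (algebraMap (X.presheaf.stalk z)
      X.functionField)) ≫ X.fromSpecStalk z = X.fromSpecStalk (genericPoint X) := fun z ↦
    Scheme.SpecMap_stalkSpecializes_fromSpecStalk
      ((genericPoint_spec X).specializes (Set.mem_univ z))
  have h1 : Spec.map (CommRingCat.ofHom (algebraMap (X.presheaf.stalk x.1) X.functionField)) ≫ l₁ =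
      X.fromSpecStalk (genericPoint X) := hgen _
  have h2 : Spec.map (CommRingCat.ofHom (algebraMap (X.presheaf.stalk x.1) X.functionField)) ≫ l₂ =
      X.fromSpecStalk (genericPoint X) := by
    rw [← hgen y.1, ← Spec.map_comp_assoc]
    congr 2
    ext r
    exact hφ r
  have hc : ∀ (z : X) (c : ℂ), algebraMap (X.presheaf.stalk z) X.functionField
      ((stalkConst f z).hom c) = (stalkConst f (genericPoint X)).hom c := fun z c ↦
    RingHom.congr_fun (congrArg CommRingCat.Hom.hom (stalkConst_specializes f
      ((genericPoint_spec X).specializes (Set.mem_univ z)))) c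
  have h3 : l₂ ≫ f = l₁ ≫ f := by
    simp only [l₁, l₂, Category.assoc]
    rw [← spec_stalkConst, ← spec_stalkConst, ← Spec.map_comp]
    congr 1
    ext c
    apply hinj
    exact (hφ _).trans ((hc _ _).trans (hc _ _).symm)
  have hsq : CommSq (X.fromSpecStalk (genericPoint X))
      (Spec.map (CommRingCat.ofHom (algebraMap (X.presheaf.stalk x.1) X.functionField))) f
      (l₁ ≫ f) := ⟨by
    rw [← h1, Category.assoc]
    rfl⟩
  have huniq := (IsSeparated.valuativeCriterion f
    ⟨X.presheaf.stalk x.1, X.functionField, X.fromSpecStalk (genericPoint X), _, hsq⟩)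
  have heq : l₁ = l₂ := congrArg CommSq.LiftStruct.l
    (huniq.elim ⟨l₁, h1, rfl⟩ ⟨l₂, h2, h3⟩)
  have h4 : l₁ (IsLocalRing.closedPoint _) = l₂ (IsLocalRing.closedPoint _) := by rw [heq]
  have h5 : IsLocalHom φ := ⟨fun a ha ↦ by
    have := ha.map (RingEquiv.ofBijective φ hφb).symm
    rwa [show φ a = RingEquiv.ofBijective φ hφb a from rfl, RingEquiv.symm_apply_apply] at this⟩
  have h6 : Spec.map (CommRingCat.ofHom φ) (IsLocalRing.closedPoint (X.presheaf.stalk x.1)) =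
      IsLocalRing.closedPoint (X.presheaf.stalk y.1) :=
    IsLocalRing.comap_closedPoint φ
  apply Subtype.ext
  rw [Scheme.fromSpecStalk_closedPoint] at h4
  have h7 : l₂ (IsLocalRing.closedPoint (X.presheaf.stalk x.1)) = y.1 := by
    change X.fromSpecStalk y.1 (Spec.map (CommRingCat.ofHom φ) _) = _
    exact (congrArg (X.fromSpecStalk y.1) h6).trans Scheme.fromSpecStalk_closedPoint
  exact h4.trans h7

/-- A principal divisor on a smooth proper curve has finite support and degree zero. -/
theorem finsum_ordZ_stalk_eq_zero (f : X ⟶ Spec (.of ℂ)) [SmoothOfRelativeDimension 1 f]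
    [IsProper f]
    [hdvr : ∀ x : {x : X // IsClosed {x}}, IsDiscreteValuationRing (X.presheaf.stalk x.1)]
    (g : X.functionField) (hg : g ≠ 0) :
    (Function.support fun x : {x : X // IsClosed {x}} ↦ ordZ (X.presheaf.stalk x.1) g).Finite ∧
      ∑ᶠ x : {x : X // IsClosed {x}}, ordZ (X.presheaf.stalk x.1) g = 0 := by
  let _ : Algebra ℂ X.functionField := (stalkConst f (genericPoint X)).hom.toAlgebra
  refine finsum_ordZ_eq_zero (k := ℂ) (K := X.functionField)
    (fun x : {x : X // IsClosed {x}} ↦ X.presheaf.stalk x.1) (fun x c ↦ ?_)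
    (eq_of_range_stalk_eq f) (fun A _ _ _ _ _ hA ↦ exists_range_stalk_subset f A hA)
    (fun t ht ↦ ?_) g hg
  · exact ⟨(stalkConst f x.1).hom c, RingHom.congr_fun (congrArg CommRingCat.Hom.hom
      (stalkConst_specializes f ((genericPoint_spec X).specializes (Set.mem_univ x.1)))) c⟩
  · obtain ⟨V, hV, hxV, e, he, hc⟩ := exists_etale_chart f (genericPoint X)
    have : Nonempty V := ⟨⟨_, hxV⟩⟩
    have := functionField_isFractionRing_of_isAffineOpen X V hV
    refine finiteDimensional_of_etale (B := Γ(X, V)) e he (fun c ↦ ?_) t ht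
    rw [hc]
    exact (congrArg (fun φ ↦ ((Scheme.ΓSpecIso (.of ℂ)).inv ≫ f.appTop ≫ φ).hom c)
      (X.presheaf.germ_res (homOfLE (le_top : V ≤ ⊤)) (genericPoint X) hxV)).symm

end Valuative

/-! ### Coherent sheaves on an integral noetherian scheme -/

section Coherent

variable {X : Scheme.{0}} {E : X.Modules}

lemma IsCoherent.localizesOn (hE : IsCoherent E) {U : X.Opens} (hU : IsAffineOpen U) :
    LocalizesOn E U := by
  have hE' : SheafOfModules.IsFinitePresentation E := hE
  obtain ⟨σ, hσ⟩ := hE'.exists_quasicoherentData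
  have : SheafOfModules.IsQuasicoherent E := ⟨⟨σ⟩⟩
  exact localizesOn_of_isQuasicoherent hU E

lemma IsLocallyFree.localizesOn (hE : IsLocallyFree E) {U : X.Opens} (hU : IsAffineOpen U) :
    LocalizesOn E U := by
  obtain ⟨q, hq⟩ := SheafOfModules.IsLocallyFree.exists_isLocallyFreeData (self := hE)
  have : SheafOfModules.IsQuasicoherent E := ⟨⟨q.quasiCoherentData⟩⟩
  exact localizesOn_of_isQuasicoherent hU E

lemma germ_sum_smul {ι : Type} (s : Finset ι) {U : X.Opens} (x : X) (hx : x ∈ U) (c : ι → Γ(X, U))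
    (t : ι → Γ(E, U)) : E.presheaf.germ U x hx (∑ i ∈ s, c i • t i) =
      ∑ i ∈ s, X.presheaf.germ U x hx (c i) • E.presheaf.germ U x hx (t i) := by
  rw [map_sum]
  exact Finset.sum_congr rfl fun i _ ↦ germ_smul E x hx _ _

lemma res_sum_smul {ι : Type} (s : Finset ι) {U V : X.Opens} (h : V ≤ U) (c : ι → Γ(X, U))
    (t : ι → Γ(E, U)) : E.presheaf.map (homOfLE h).op (∑ i ∈ s, c i • t i) =
      ∑ i ∈ s, X.presheaf.map (homOfLE h).op (c i) • E.presheaf.map (homOfLE h).op (t i) := by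
  rw [map_sum]
  exact Finset.sum_congr rfl fun i _ ↦ res_smul E h _ _

lemma isUnit_germ_of_mem_basicOpen {U : X.Opens} {f : Γ(X, U)} {x : X} (hx : x ∈ U)
    (hf : x ∈ X.basicOpen f) : IsUnit (X.presheaf.germ U x hx f) :=
  (X.mem_basicOpen f x hx).mp hf

/-- Generators of the sections over an affine open generate all the stalks. -/
lemma span_germ_eq_top {ι : Type} {U : X.Opens} (hU : IsAffineOpen U) (hE : LocalizesOn E U)
    {s : ι → Γ(E, U)} (hs : Submodule.span Γ(X, U) (Set.range s) = ⊤) {x : X} (hx : x ∈ U) :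
    Submodule.span (X.presheaf.stalk x) (Set.range fun i ↦ E.presheaf.germ U x hx (s i)) = ⊤ := by
  refine top_le_iff.mp fun e _ ↦ ?_
  have key : ∀ t : Γ(E, U), E.presheaf.germ U x hx t ∈
      Submodule.span (X.presheaf.stalk x) (Set.range fun i ↦ E.presheaf.germ U x hx (s i)) := by
    intro t
    have ht : t ∈ Submodule.span Γ(X, U) (Set.range s) := hs ▸ Submodule.mem_top
    induction ht using Submodule.span_induction with
    | mem t h => obtain ⟨i, rfl⟩ := h; exact Submodule.subset_span ⟨i, rfl⟩
    | zero => rw [map_zero]; exact Submodule.zero_mem _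
    | add a b _ _ ha hb => rw [map_add]; exact Submodule.add_mem _ ha hb
    | smul r a _ ha => rw [germ_smul]; exact Submodule.smul_mem _ _ ha
  obtain ⟨f, t, hf, he⟩ := exists_smul_germ_eq hU hE hx e
  obtain ⟨u, hu⟩ := isUnit_germ_of_mem_basicOpen hx hf
  rw [← hu] at he
  have : e = (↑u⁻¹ : X.presheaf.stalk x) • E.presheaf.germ U x hx t := by
    rw [← he, smul_smul, Units.inv_mul, one_smul]
  rw [this]
  exact Submodule.smul_mem _ _ (key t)

/-- Generators of the sections over an affine open generate the sections over its basic opens. -/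
lemma span_res_basicOpen_eq_top {ι : Type} {U : X.Opens} (hE : LocalizesOn E U)
    {s : ι → Γ(E, U)} (hs : Submodule.span Γ(X, U) (Set.range s) = ⊤) (f : Γ(X, U)) :
    Submodule.span Γ(X, X.basicOpen f) (Set.range fun i ↦
      E.presheaf.map (homOfLE (X.basicOpen_le f)).op (s i)) = ⊤ := by
  refine top_le_iff.mp fun e _ ↦ ?_
  have key : ∀ t : Γ(E, U), E.presheaf.map (homOfLE (X.basicOpen_le f)).op t ∈
      Submodule.span Γ(X, X.basicOpen f) (Set.range fun i ↦
        E.presheaf.map (homOfLE (X.basicOpen_le f)).op (s i)) := by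
    intro t
    have ht : t ∈ Submodule.span Γ(X, U) (Set.range s) := hs ▸ Submodule.mem_top
    induction ht using Submodule.span_induction with
    | mem t h => obtain ⟨i, rfl⟩ := h; exact Submodule.subset_span ⟨i, rfl⟩
    | zero => rw [map_zero]; exact Submodule.zero_mem _
    | add a b _ _ ha hb => rw [map_add]; exact Submodule.add_mem _ ha hb
    | smul r a _ ha => rw [res_smul]; exact Submodule.smul_mem _ _ ha
  obtain ⟨n, t, ht⟩ := (hE f).1 e
  have hu : IsUnit (X.presheaf.map (homOfLE (X.basicOpen_le f)).op f) :=
    RingedSpace.isUnit_res_basicOpen X.toRingedSpace f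
  obtain ⟨u, hu⟩ := hu.pow n
  rw [map_pow, ← hu] at ht
  have : e = (↑u⁻¹ : Γ(X, X.basicOpen f)) • E.presheaf.map (homOfLE (X.basicOpen_le f)).op t := by
    rw [ht, smul_smul, Units.inv_mul, one_smul]
  rw [this]
  exact Submodule.smul_mem _ _ (key t)

/-- Finitely many generators of a stalk of a coherent sheaf extend to generators on an affine
neighbourhood. -/
lemma exists_affine_span_eq_top (hE : IsCoherent E) {ι : Type} [Finite ι] (x : X)
    (β : ι → E.presheaf.stalk x) (hβ : Submodule.span (X.presheaf.stalk x) (Set.range β) = ⊤) :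
    ∃ (V : X.Opens) (_ : IsAffineOpen V) (hx : x ∈ V) (s : ι → Γ(E, V)),
      (∀ i, E.presheaf.germ V x hx (s i) = β i) ∧
        Submodule.span Γ(X, V) (Set.range s) = ⊤ := by
  have := Fintype.ofFinite ι
  obtain ⟨U, hU, hxU, hfin⟩ := exists_affine_finite E hE x
  obtain ⟨n, t, ht⟩ := Module.Finite.exists_fin (R := Γ(X, U)) (M := Γ(E, U))
  choose A hA b hb using fun i ↦ E.presheaf.exists_germ_eq (β i)
  have hc : ∀ j, ∃ c : ι → X.presheaf.stalk x,
      ∑ i, c i • β i = E.presheaf.germ U x hxU (t j) := fun j ↦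
    (Submodule.mem_span_range_iff_exists_fun _).mp (hβ ▸ Submodule.mem_top)
  choose c hc using hc
  choose C hC d hd using fun j i ↦ X.presheaf.exists_germ_eq (c j i)
  let W : X.Opens := U ⊓ ((Finset.univ.inf A) ⊓ Finset.univ.inf fun j ↦ Finset.univ.inf (C j))
  have hWU : W ≤ U := inf_le_left
  have hWA : ∀ i, W ≤ A i := fun i ↦ inf_le_right.trans (inf_le_left.trans
    (Finset.inf_le (Finset.mem_univ i)))
  have hWC : ∀ j i, W ≤ C j i := fun j i ↦ inf_le_right.trans (inf_le_right.trans
    ((Finset.inf_le (Finset.mem_univ j)).trans (Finset.inf_le (Finset.mem_univ i))))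
  have hinf : ∀ {κ : Type} [Fintype κ] (B : κ → X.Opens), (∀ k, x ∈ B k) →
      x ∈ Finset.univ.inf B := fun B h ↦ by
    have : x ∈ ((Finset.univ.inf B : X.Opens) : Set X) := by
      rw [Opens.coe_finset_inf]
      simpa using h
    exact this
  have hxW : x ∈ W := ⟨hxU, hinf A hA, hinf _ fun j ↦ hinf _ (hC j)⟩
  have hrel : ∀ j, E.presheaf.germ W x hxW (∑ i, X.presheaf.map (homOfLE (hWC j i)).op (d j i) •
      E.presheaf.map (homOfLE (hWA i)).op (b i)) =
        E.presheaf.germ W x hxW (E.presheaf.map (homOfLE hWU).op (t j)) := fun j ↦ by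
    rw [germ_sum_smul, germ_res, ← hc]
    refine Finset.sum_congr rfl fun i _ ↦ ?_
    rw [germ_res_ring, germ_res, hd, hb]
  choose D hxD i₁ i₂ hD using fun j ↦ E.presheaf.germ_eq x hxW hxW _ _ (hrel j)
  let W' : X.Opens := W ⊓ Finset.univ.inf D
  have hxW' : x ∈ W' := ⟨hxW, hinf D hxD⟩
  obtain ⟨f, hfW, hxf⟩ := hU.exists_basicOpen_le ⟨x, hxW'⟩ hxU
  have hVW : X.basicOpen f ≤ W := hfW.trans inf_le_left
  have hVD : ∀ j, X.basicOpen f ≤ D j := fun j ↦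
    hfW.trans (inf_le_right.trans (Finset.inf_le (Finset.mem_univ j)))
  refine ⟨X.basicOpen f, hU.basicOpen f, hxf, fun i ↦
    E.presheaf.map (homOfLE (hVW.trans (hWA i))).op (b i), fun i ↦ ?_, ?_⟩
  · rw [germ_res, hb]
  · rw [← top_le_iff, ← span_res_basicOpen_eq_top (hE.localizesOn hU) ht f, Submodule.span_le]
    rintro _ ⟨j, rfl⟩
    have h1 := congrArg (E.presheaf.map (homOfLE (hVD j)).op) (hD j)
    have h2 : ∀ s : Γ(E, W), E.presheaf.map (homOfLE (hVD j)).op (E.presheaf.map (i₁ j).op s) =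
        E.presheaf.map (homOfLE hVW).op s := fun s ↦ res_res E (i₁ j).le (hVD j) s
    have h3 : ∀ s : Γ(E, W), E.presheaf.map (homOfLE (hVD j)).op (E.presheaf.map (i₂ j).op s) =
        E.presheaf.map (homOfLE hVW).op s := fun s ↦ res_res E (i₂ j).le (hVD j) s
    rw [h2, h3, res_res, res_sum_smul] at h1
    change E.presheaf.map (homOfLE (X.basicOpen_le f)).op (t j) ∈ _
    rw [← h1]
    refine Submodule.sum_mem _ fun i _ ↦ Submodule.smul_mem _ _ (Submodule.subset_span ⟨i, ?_⟩)
    rw [res_res]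

lemma IsCoherent.finite_stalk (hE : IsCoherent E) (x : X) :
    Module.Finite (X.presheaf.stalk x) (E.presheaf.stalk x) := by
  obtain ⟨U, hU, hxU, hfin⟩ := exists_affine_finite E hE x
  obtain ⟨n, t, ht⟩ := Module.Finite.exists_fin (R := Γ(X, U)) (M := Γ(E, U))
  refine Module.finite_def.mpr ?_
  rw [← span_germ_eq_top hU (hE.localizesOn hU) ht hxU]
  exact Submodule.fg_span (Set.finite_range _)

end Coherent

section Integral

variable {X : Scheme.{0}} [IsIntegral X] {E : X.Modules}

/-- Near the generic point, a basis of the generic stalk of a coherent sheaf generates all stalks.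
-/
lemma exists_nhds_generic_basis (hE : IsCoherent E) {ι : Type} [Finite ι]
    (b : Module.Basis ι X.functionField (genericStalk E)) :
    ∃ (V : X.Opens) (_ : IsAffineOpen V) (hη : genericPoint X ∈ V) (s : ι → Γ(E, V)),
      (∀ i, E.presheaf.germ V _ hη (s i) = b i) ∧ ∀ x (hx : x ∈ V),
        Submodule.span (X.presheaf.stalk x)
          (Set.range fun i ↦ E.presheaf.germ V x hx (s i)) = ⊤ := by
  obtain ⟨V, hV, hη, s, hs, hspan⟩ := exists_affine_span_eq_top hE (genericPoint X) b b.span_eq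
  exact ⟨V, hV, hη, s, hs, fun x hx ↦ span_germ_eq_top hV (hE.localizesOn hV) hspan hx⟩

/-- Elements of the generic stalk are fractions of elements of any other stalk. -/
lemma exists_smul_eq_toGeneric (hE : IsCoherent E) (x : X) (e : genericStalk E) :
    ∃ (r : X.presheaf.stalk x) (t : E.presheaf.stalk x), r ≠ 0 ∧
      algebraMap (X.presheaf.stalk x) X.functionField r • e = toGeneric E x t := by
  obtain ⟨U, hU, hxU, -⟩ := exists_affine_finite E hE x
  have hη := genericPoint_mem hxU
  obtain ⟨f, t, hf, he⟩ := exists_smul_germ_eq hU (hE.localizesOn hU) hη e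
  have hr : algebraMap (X.presheaf.stalk x) X.functionField (X.presheaf.germ U x hxU f) =
      X.presheaf.germ U _ hη f := by
    rw [RingHom.algebraMap_toAlgebra]
    exact ConcreteCategory.congr_hom (X.presheaf.germ_stalkSpecializes (U := U) hxU
      ((genericPoint_spec X).specializes (Set.mem_univ x))) f
  refine ⟨X.presheaf.germ U x hxU f, E.presheaf.germ U x hxU t, ?_, ?_⟩
  · intro h0
    rw [h0, map_zero] at hr
    exact (isUnit_germ_of_mem_basicOpen hη hf).ne_zero hr.symm
  · rw [hr, toGeneric_germ]
    exact he

/-- A coherent sheaf with torsion-free stalks whose local rings are principal ideal domains is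
locally free. -/
lemma isLocallyFree_of_torsionFree (hE : IsCoherent E)
    (hX : ∀ x : X, IsPrincipalIdealRing (X.presheaf.stalk x))
    (h : ∀ x, Function.Injective (toGeneric E x)) : IsLocallyFree E := by
  refine isLocallyFree_of_affine E fun x ↦ ?_
  have := hX x
  have := hE.finite_stalk x
  have htf : Module.IsTorsionFree (X.presheaf.stalk x) (E.presheaf.stalk x) := by
    refine .of_smul_eq_zero fun r e hre ↦ ?_
    have := congrArg (toGeneric E x) hre
    rw [toGeneric_smul, map_zero, smul_eq_zero] at this
    rcases this with h0 | h0
    · exact .inl (IsFractionRing.injective _ X.functionField (h0.trans (map_zero _).symm))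
    · exact .inr (h x (h0.trans (map_zero _).symm))
  have : Module.Free (X.presheaf.stalk x) (E.presheaf.stalk x) := inferInstance
  let β := Module.Free.chooseBasis (X.presheaf.stalk x) (E.presheaf.stalk x)
  let n := Fintype.equivFin (Module.Free.ChooseBasisIndex (X.presheaf.stalk x) (E.presheaf.stalk x))
  let β' := β.reindex n
  obtain ⟨V, hV, hx, s, hs, hspan⟩ := exists_affine_span_eq_top hE x β' β'.span_eq
  refine ⟨V, hV, hx, hE.localizesOn hV, ?_⟩
  have hli : LinearIndependent Γ(X, V) s := by
    rw [Fintype.linearIndependent_iff]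
    intro c hc i
    have h1 := congrArg (E.presheaf.germ V x hx) hc
    rw [germ_sum_smul, map_zero] at h1
    simp only [hs] at h1
    have h2 := Fintype.linearIndependent_iff.mp β'.linearIndependent _ h1 i
    exact germ_injective_of_isIntegral X x hx (h2.trans (map_zero _).symm)
  exact Module.Free.of_basis (Module.Basis.mk hli hspan.ge)

lemma toGeneric_injective_of_isLocallyFree (hE : IsLocallyFree E) (x : X) :
    Function.Injective (toGeneric E x) := by
  obtain ⟨U, hU, hxU, hfree⟩ := exists_affine_free E hE x
  rw [injective_iff_map_eq_zero]
  intro e he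
  obtain ⟨f, t, hf, hft⟩ := exists_smul_germ_eq hU (hE.localizesOn hU) hxU e
  have h1 : E.presheaf.germ U _ (genericPoint_mem hxU) t = 0 := by
    rw [← toGeneric_germ E x hxU, ← hft, toGeneric_smul, he, smul_zero]
  obtain ⟨g, hg, hgt⟩ := exists_basicOpen_of_germ_eq_zero hU (hE.localizesOn hU) _ h1
  have hg0 : g ≠ 0 := by
    rintro rfl
    exact (isUnit_germ_of_mem_basicOpen (genericPoint_mem hxU) hg).ne_zero (map_zero _)
  have : Nonempty U := ⟨⟨x, hxU⟩⟩
  have ht : t = 0 := (smul_eq_zero.mp hgt).resolve_left hg0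
  rw [ht, map_zero] at hft
  obtain ⟨u, hu⟩ := isUnit_germ_of_mem_basicOpen hxU hf
  rw [← hu] at hft
  exact (smul_eq_zero_iff_eq u).mp hft

variable (E) in
/-- The subsheaf of a coherent sheaf cut out by a subspace of the generic stalk is coherent. -/
lemma isCoherent_genericSub [IsLocallyNoetherian X] (hE : IsCoherent E)
    (W : Submodule X.functionField (genericStalk E)) : IsCoherent (genericSub E W) := by
  refine isCoherent_of_affine _ fun x ↦ ?_
  obtain ⟨U, hU, hxU, hfin⟩ := exists_affine_finite E hE x
  have hN : IsNoetherianRing Γ(X, U) := IsLocallyNoetherian.component_noetherian ⟨U, hU⟩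
  refine ⟨U, hU, hxU, hN, fun f ↦ ⟨fun s ↦ ?_, fun t ht ↦ ?_⟩, ?_⟩
  · by_cases hf : X.basicOpen f = ⊥
    · refine ⟨0, 0, ?_⟩
      refine section_ext _ fun y hy ↦ ?_
      rw [hf] at hy
      exact hy.elim
    · obtain ⟨y, hy⟩ := (Opens.ne_bot_iff_nonempty _).mp hf
      obtain ⟨n, t, ht⟩ := (hE.localizesOn hU f).1 ((genericSubι E W).app _ s)
      have hyU : y ∈ U := X.basicOpen_le f hy
      have hmem : t ∈ genericSections E W U := by
        refine mem_genericSections_of_mem hyU ?_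
        rw [← germ_res E (X.basicOpen_le f) y hy, ht]
        exact (genericSections E W _).smul_mem _ (genericSubι_mem s) y hy
      obtain ⟨t', rfl⟩ := exists_genericSubι_app_eq hmem
      refine ⟨n, t', genericSubι_injective _ ?_⟩
      rw [app_res, ht, Scheme.Modules.Hom.app_smul]
  · have h1 := congrArg ((genericSubι E W).app _) ht
    rw [app_res, map_zero] at h1
    obtain ⟨n, hn⟩ := (hE.localizesOn hU f).2 _ h1
    refine ⟨n, genericSubι_injective _ ?_⟩
    rw [Scheme.Modules.Hom.app_smul, hn, map_zero]
  · have : Module.Finite Γ(X, U) (genericSections E W U) := inferInstance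
    exact this

end Integral

/-! ### Degrees of coherent sheaves on a curve -/

section Degree

open Module

variable {X : Scheme.{0}} [IsIntegral X]

/-- The generic stalk as a module over the stalk at `x`, by restriction of scalars. This is not a
global instance, as it would clash with the structure of a vector space when `x` is the generic
point. -/
@[reducible] def genericModule (E : X.Modules) (x : X) :
    Module (X.presheaf.stalk x) (genericStalk E) :=
  Module.compHom _ (algebraMap (X.presheaf.stalk x) X.functionField)

attribute [local instance] genericModule

lemma isScalarTower_generic (E : X.Modules) (x : X) :
    IsScalarTower (X.presheaf.stalk x) X.functionField (genericStalk E) :=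
  IsScalarTower.of_algebraMap_smul fun _ _ ↦ rfl

/-- The map from the stalk at `x` to the generic stalk, as a linear map. -/
def toGenericₗ (E : X.Modules) (x : X) :
    E.presheaf.stalk x →ₗ[X.presheaf.stalk x] genericStalk E where
  toFun := toGeneric E x
  map_add' := map_add _
  map_smul' := toGeneric_smul E x

/-- The lattice in the generic stalk given by the stalk at `x`. -/
def stalkLattice (E : X.Modules) (x : X) : Submodule (X.presheaf.stalk x) (genericStalk E) :=
  LinearMap.range (toGenericₗ E x)

/-- The torsion of the stalk at `x`. -/
def stalkTorsion (E : X.Modules) (x : X) : Submodule (X.presheaf.stalk x) (E.presheaf.stalk x) :=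
  LinearMap.ker (toGenericₗ E x)

lemma localDegree_eq_add (E : X.Modules) {ι : Type*} (b : ι → genericStalk E) (x : X) :
    localDegree E b x = (Module.length (X.presheaf.stalk x) (stalkTorsion E x)).toNat +
      latticeIndex (stalkLattice E x) (Submodule.span (X.presheaf.stalk x) (Set.range b)) :=
  add_sub_assoc _ _ _

lemma span_stalkLattice {E : X.Modules} (hE : IsCoherent E) (x : X) :
    Submodule.span X.functionField (stalkLattice E x : Set (genericStalk E)) = ⊤ := by
  refine top_le_iff.mp fun e _ ↦ ?_
  obtain ⟨r, t, hr, h⟩ := exists_smul_eq_toGeneric hE x e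
  have hr' : algebraMap (X.presheaf.stalk x) X.functionField r ≠ 0 :=
    (map_ne_zero_iff _ (IsFractionRing.injective _ _)).mpr hr
  have : e = (algebraMap (X.presheaf.stalk x) X.functionField r)⁻¹ • toGeneric E x t := by
    rw [← h, smul_smul, inv_mul_cancel₀ hr', one_smul]
  rw [this]
  exact Submodule.smul_mem _ _ (Submodule.subset_span ⟨t, rfl⟩)

lemma finite_stalkLattice {E : X.Modules} (hE : IsCoherent E) (x : X) :
    Module.Finite (X.presheaf.stalk x) (stalkLattice E x) := by
  have := hE.finite_stalk x
  exact Module.Finite.range (toGenericₗ E x)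

variable {ι : Type} [Fintype ι] [DecidableEq ι]

/-- The lattice given by the stalk at a closed point of a curve has a basis. -/
lemma exists_basis_stalkLattice {E : X.Modules} (hE : IsCoherent E) (x : X)
    [IsDiscreteValuationRing (X.presheaf.stalk x)]
    (b : Basis ι X.functionField (genericStalk E)) :
    ∃ β : Basis ι X.functionField (genericStalk E),
      Submodule.span (X.presheaf.stalk x) (Set.range β) = stalkLattice E x := by
  have := isScalarTower_generic E x
  have := finite_stalkLattice hE x
  exact exists_basis_span_eq X.functionField b (span_stalkLattice hE x)

lemma localDegree_eq {E : X.Modules} (x : X)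
    [IsDiscreteValuationRing (X.presheaf.stalk x)]
    (b β : Basis ι X.functionField (genericStalk E))
    (hβ : Submodule.span (X.presheaf.stalk x) (Set.range β) = stalkLattice E x) :
    localDegree E b x = (Module.length (X.presheaf.stalk x) (stalkTorsion E x)).toNat -
      ordZ (X.presheaf.stalk x) (b.det β) := by
  have := isScalarTower_generic E x
  rw [localDegree_eq_add, ← hβ, latticeIndex_span_span, sub_eq_add_neg]

/-- Changing the basis changes the local degree by the order of the determinant. -/
lemma localDegree_change {E : X.Modules} (hE : IsCoherent E) (x : X)
    [IsDiscreteValuationRing (X.presheaf.stalk x)]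
    (b b' : Basis ι X.functionField (genericStalk E)) :
    localDegree E b x = localDegree E b' x - ordZ (X.presheaf.stalk x) (b.det b') := by
  have := isScalarTower_generic E x
  obtain ⟨β, hβ⟩ := exists_basis_stalkLattice hE x b
  rw [localDegree_eq x b β hβ, localDegree_eq x b' β hβ, ordZ_det_mul _ b b' β]
  ring

/-- Away from finitely many points, a coherent sheaf has no torsion and its stalk is spanned by a
given basis of the generic stalk. -/
lemma finite_stalkLattice_ne (f : X ⟶ Spec (.of ℂ)) [SmoothOfRelativeDimension 1 f] [IsProper f]
    {E : X.Modules} (hE : IsCoherent E)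
    (b : Basis ι X.functionField (genericStalk E)) :
    {x : {x : X // IsClosed {x}} | ¬ (stalkTorsion E x.1 = ⊥ ∧
      Submodule.span (X.presheaf.stalk x.1) (Set.range b) = stalkLattice E x.1)}.Finite := by
  obtain ⟨V, -, hη, s, hs, hspan⟩ := exists_nhds_generic_basis hE b
  refine (finite_notMem f hη).subset fun x hx hxV ↦ hx ?_
  have := isScalarTower_generic E x.1
  have hgen : ∀ i, toGeneric E x.1 (E.presheaf.germ V x.1 hxV (s i)) = b i := fun i ↦ by
    rw [toGeneric_germ]
    exact hs i
  constructor
  · rw [eq_bot_iff]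
    intro e he
    obtain ⟨c, rfl⟩ := (Submodule.mem_span_range_iff_exists_fun _).mp
      (show e ∈ Submodule.span _ _ from hspan x.1 hxV ▸ Submodule.mem_top)
    have h1 : toGenericₗ E x.1 (∑ i, c i • E.presheaf.germ V x.1 hxV (s i)) = 0 := he
    rw [map_sum] at h1
    have h2 : ∑ i, algebraMap (X.presheaf.stalk x.1) X.functionField (c i) • b i = 0 := by
      rw [← h1]
      refine Finset.sum_congr rfl fun i _ ↦ ?_
      rw [map_smul, ← hgen i]
      rfl
    have h3 : ∀ i, c i = 0 := fun i ↦
      IsFractionRing.injective (X.presheaf.stalk x.1) X.functionField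
        ((Fintype.linearIndependent_iff.mp b.linearIndependent _ h2 i).trans (map_zero _).symm)
    simp only [h3, zero_smul, Finset.sum_const_zero]
    exact Submodule.zero_mem _
  · have h4 := congrArg (Submodule.map (toGenericₗ E x.1)) (hspan x.1 hxV)
    rw [Submodule.map_span, ← Set.range_comp, Submodule.map_top] at h4
    refine Eq.trans ?_ h4
    congr 2
    funext i
    exact (hgen i).symm

variable [hdvr : ∀ x : {x : X // IsClosed {x}}, IsDiscreteValuationRing (X.presheaf.stalk x.1)]

lemma finite_support_localDegree (f : X ⟶ Spec (.of ℂ)) [SmoothOfRelativeDimension 1 f] [IsProper f]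
    {E : X.Modules} (hE : IsCoherent E)
    (b : Basis ι X.functionField (genericStalk E)) :
    (Function.support fun x : {x : X // IsClosed {x}} ↦ localDegree E b x.1).Finite := by
  refine (finite_stalkLattice_ne f hE b).subset fun x hx h ↦ hx ?_
  have := isScalarTower_generic E x.1
  change localDegree E b x.1 = 0
  rw [localDegree_eq x.1 b b h.2, h.1, ordZ_det_self]
  simp

/-- The degree may be computed with any basis of the generic stalk. -/
theorem degree_eq_finsum (f : X ⟶ Spec (.of ℂ)) [SmoothOfRelativeDimension 1 f] [IsProper f]
    {E : X.Modules} (hE : IsCoherent E)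
    (b : Basis ι X.functionField (genericStalk E)) :
    degree E = ∑ᶠ x : {x : X // IsClosed {x}}, localDegree E b x.1 := by
  have : Module.Finite X.functionField (genericStalk E) := hE.finite_stalk (genericPoint X)
  let b₀ := Module.Free.chooseBasis X.functionField (genericStalk E)
  let b₁ := b₀.reindex (b₀.indexEquiv b)
  have h1 : ∀ x, localDegree E b₀ x = localDegree E b₁ x := fun x ↦ by
    rw [localDegree_eq_add, localDegree_eq_add, Basis.range_reindex]
  have h2 := finsum_ordZ_stalk_eq_zero f (b₁.det b) (det_ne_zero_of_basis b₁ b)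
  unfold degree
  calc _ = ∑ᶠ x : {x : X // IsClosed {x}}, (localDegree E b x.1 -
        ordZ (X.presheaf.stalk x.1) (b₁.det b)) :=
        finsum_congr fun x ↦ (h1 x.1).trans (localDegree_change hE x.1 b₁ b)
    _ = _ := by
      rw [finsum_sub_distrib (finite_support_localDegree f hE b) h2.1, h2.2, sub_zero]

/-- The comparison of a lattice `L'` in a subspace with a lattice `L` of the whole space, which
contains `L'` and the multiples by `a` of the vectors of a complementary family. -/
lemma neg_ordZ_det_le {O K V' V : Type*} [CommRing O] [IsDomain O] [IsDiscreteValuationRing O]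
    [Field K] [Algebra O K] [IsFractionRing O K] [AddCommGroup V'] [Module K V'] [AddCommGroup V]
    [Module K V] [Module O V] [IsScalarTower O K V] {p q : Type*} [Fintype p] [Fintype q]
    [DecidableEq p] [DecidableEq q] (b' β' : Basis p K V') (b β : Basis (p ⊕ q) K V)
    (j : V' →ₗ[K] V) (hj : ∀ i, b (.inl i) = j (b' i))
    (hL : ∀ i, j (β' i) ∈ Submodule.span O (Set.range β)) {a : K} (ha : a ≠ 0)
    (hq : ∀ i, a • b (.inr i) ∈ Submodule.span O (Set.range β)) :
    -ordZ O (b'.det β') ≤ -ordZ O (b.det β) + Fintype.card q * ordZ O a := by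
  let γ : p ⊕ q → V := Sum.elim (fun i ↦ j (β' i)) fun i ↦ a • b (.inr i)
  obtain ⟨c, hc⟩ := exists_algebraMap_eq_det (O := O) (b := β) (v := γ) (by
    rintro (i | i)
    · exact hL i
    · exact hq i)
  have h1 : b.det γ = b'.det β' * a ^ Fintype.card q := by
    rw [Basis.det_apply, Basis.det_apply]
    have hM : b.toMatrix γ = Matrix.fromBlocks (b'.toMatrix β') 0 0 (a • (1 : Matrix q q K)) := by
      ext i k
      rw [Basis.toMatrix_apply]
      rcases k with k | k
      · have : γ (.inl k) = ∑ l, b'.repr (β' k) l • b (.inl l) := by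
          change j (β' k) = _
          conv_lhs => rw [← b'.sum_repr (β' k), map_sum]
          exact Finset.sum_congr rfl fun l _ ↦ by rw [map_smul, hj]
        rw [this, map_sum, Finset.sum_apply']
        rcases i with i | i
        · simp [Finsupp.single_apply, Basis.toMatrix_apply]
        · simp
      · have : γ (.inr k) = a • b (.inr k) := rfl
        rw [this, map_smul]
        rcases i with i | i
        · simp
        · simp [Finsupp.single_apply, Matrix.one_apply, eq_comm]
    rw [hM, Matrix.det_fromBlocks_zero₂₁, Matrix.det_smul, Matrix.det_one, mul_one]
  have h2 : b.det γ = b.det β * β.det γ := by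
    conv_lhs => rw [AlternatingMap.eq_smul_basis_det β b.det]
    rfl
  have h3 : b'.det β' * a ^ Fintype.card q ≠ 0 :=
    mul_ne_zero (det_ne_zero_of_basis _ _) (pow_ne_zero _ ha)
  have h4 : β.det γ ≠ 0 := fun h ↦ h3 (by rw [← h1, h2, h, mul_zero])
  have h5 : 0 ≤ ordZ O (β.det γ) := by
    rw [← hc] at h4 ⊢
    exact ordZ_algebraMap_nonneg O fun h ↦ h4 (by rw [h, map_zero])
  have h6 : ordZ O (a ^ Fintype.card q) = Fintype.card q * ordZ O a := by
    have := ordZ_prod O (f := fun _ : q ↦ a) fun _ ↦ ha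
    simpa using this
  have h7 : ordZ O (b'.det β') + Fintype.card q * ordZ O a =
      ordZ O (b.det β) + ordZ O (β.det γ) := by
    rw [← h6, ← ordZ_mul O (det_ne_zero_of_basis _ _) (pow_ne_zero _ ha), ← h1, h2,
      ordZ_mul O (det_ne_zero_of_basis _ _) h4]
  omega

lemma exists_ordZ_eq (O : Type*) {K : Type*} [CommRing O] [IsDomain O] [IsDiscreteValuationRing O]
    [Field K] [Algebra O K] [IsFractionRing O K] (n : ℕ) : ∃ a : K, a ≠ 0 ∧ ordZ O a = n := by
  obtain ⟨ϖ, hϖ⟩ := IsDiscreteValuationRing.exists_irreducible O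
  have h0 : algebraMap O K ϖ ≠ 0 :=
    (map_ne_zero_iff _ (IsFractionRing.injective O K)).mpr hϖ.ne_zero
  refine ⟨algebraMap O K ϖ ^ n, pow_ne_zero _ h0, ?_⟩
  have := ordZ_prod O (f := fun _ : Fin n ↦ algebraMap O K ϖ) fun _ ↦ h0
  simpa [ordZ_irreducible O hϖ] using this

/-- The map of generic stalks, as a linear map over the function field. -/
def genericMap {E' E : X.Modules} (g : E' ⟶ E) :
    genericStalk E' →ₗ[X.functionField] genericStalk E := stalkMapₗ g (genericPoint X)

lemma genericMap_mem_stalkLattice {E' E : X.Modules} (g : E' ⟶ E) {x : X} {e : genericStalk E'}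
    (he : e ∈ stalkLattice E' x) : genericMap g e ∈ stalkLattice E x := by
  obtain ⟨t, rfl⟩ := he
  exact ⟨stalkMap g x t, toGeneric_stalkMap g x t⟩

/-- Let `E'` be a torsion-free sheaf mapping to `E`, and extend a basis of the image of the generic
stalk of `E'` by rational sections of `E` with poles of order at most `n x` at `x`. Then the degree
of `E'` exceeds the one of `E` by at most `∑ n x` for each of these additional sections. -/
theorem degree_le_degree_add (f : X ⟶ Spec (.of ℂ)) [SmoothOfRelativeDimension 1 f] [IsProper f]
    {E' E : X.Modules} (hE' : IsCoherent E') (hE : IsCoherent E)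
    (htf : ∀ x : {x : X // IsClosed {x}}, stalkTorsion E' x.1 = ⊥) (g : E' ⟶ E)
    {p q : Type} [Fintype p] [Fintype q] [DecidableEq p] [DecidableEq q]
    (b' : Basis p X.functionField (genericStalk E'))
    (b : Basis (p ⊕ q) X.functionField (genericStalk E))
    (hb : ∀ i, b (.inl i) = genericMap g (b' i))
    (n : {x : X // IsClosed {x}} → ℕ) (hn : (Function.support n).Finite)
    (hq : ∀ x (i : q) (a : X.functionField), a ≠ 0 → (n x : ℤ) ≤ ordZ (X.presheaf.stalk x.1) a →
      a • b (.inr i) ∈ stalkLattice E x.1) :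
    degree E' ≤ degree E + Fintype.card q * (∑ᶠ x, n x : ℕ) := by
  have h1 := degree_eq_finsum f hE' b'
  have h2 := degree_eq_finsum f hE b
  have f1 := finite_support_localDegree f hE' b'
  have f2 := finite_support_localDegree f hE b
  have hn' : (Function.support fun x ↦ (n x : ℤ)).Finite :=
    hn.subset fun x hx h ↦ hx (by simp [h])
  have f3 : (Function.support fun x ↦ (Fintype.card q * n x : ℤ)).Finite :=
    hn'.subset fun x hx h ↦ hx (by
      dsimp only at h ⊢
      rw [h, mul_zero])
  have h3 : ((∑ᶠ x, n x : ℕ) : ℤ) = ∑ᶠ x, (n x : ℤ) :=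
    (Nat.castAddMonoidHom ℤ).map_finsum hn
  rw [h1, h2, h3, mul_finsum, ← finsum_add_distrib f2 f3]
  refine finsum_le_finsum' f1 ((f2.union f3).subset (Function.support_add _ _)) fun x ↦ ?_
  have := isScalarTower_generic E x.1
  have := isScalarTower_generic E' x.1
  obtain ⟨β', hβ'⟩ := exists_basis_stalkLattice hE' x.1 b'
  obtain ⟨β, hβ⟩ := exists_basis_stalkLattice hE x.1 b
  obtain ⟨a, ha, han⟩ := exists_ordZ_eq (X.presheaf.stalk x.1) (K := X.functionField) (n x)
  have key := neg_ordZ_det_le (O := X.presheaf.stalk x.1) b' β' b β (genericMap g) hb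
    (fun i ↦ by
      rw [hβ]
      exact genericMap_mem_stalkLattice g (hβ' ▸ Submodule.subset_span ⟨i, rfl⟩)) ha
    (fun i ↦ by
      rw [hβ]
      exact hq x i a ha han.ge)
  rw [localDegree_eq x.1 b' β' hβ', localDegree_eq x.1 b β hβ, htf]
  rw [han] at key
  simp only [Module.length_bot, ENat.toNat_zero, Nat.cast_zero]
  omega

/-- A generically bijective map of torsion-free sheaves is an isomorphism if it does not
increase the degree. -/
theorem isIso_of_degree_le (f : X ⟶ Spec (.of ℂ)) [SmoothOfRelativeDimension 1 f] [IsProper f]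
    {E' E : X.Modules} (hE' : IsCoherent E') (hE : IsCoherent E)
    (htf' : ∀ x, Function.Injective (toGeneric E' x))
    (htf : ∀ x, Function.Injective (toGeneric E x))
    (g : E' ⟶ E) (hg : Function.Bijective (genericMap g)) (hdeg : degree E ≤ degree E') :
    IsIso g := by
  have tor' : ∀ x, stalkTorsion E' x = ⊥ := fun x ↦ LinearMap.ker_eq_bot.mpr (htf' x)
  have tor : ∀ x, stalkTorsion E x = ⊥ := fun x ↦ LinearMap.ker_eq_bot.mpr (htf x)
  have : Module.Finite X.functionField (genericStalk E') := hE'.finite_stalk (genericPoint X)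
  let b' := Module.finBasis X.functionField (genericStalk E')
  let e := LinearEquiv.ofBijective (genericMap g) hg
  let b := b'.map e
  have h1 := degree_eq_finsum f hE' b'
  have h2 := degree_eq_finsum f hE b
  have f1 := finite_support_localDegree f hE' b'
  have f2 := finite_support_localDegree f hE b
  -- At each closed point the degree can only grow along `g`, and if it does not, then the lattices
  -- agree.
  have key : ∀ x : {x : X // IsClosed {x}}, localDegree E' b' x.1 ≤ localDegree E b x.1 ∧
      (localDegree E b x.1 ≤ localDegree E' b' x.1 →
        ∀ v ∈ stalkLattice E x.1, ∃ w ∈ stalkLattice E' x.1, genericMap g w = v) := by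
    intro x
    have := isScalarTower_generic E x.1
    have := isScalarTower_generic E' x.1
    obtain ⟨β', hβ'⟩ := exists_basis_stalkLattice hE' x.1 b'
    obtain ⟨β, hβ⟩ := exists_basis_stalkLattice hE x.1 b
    let γ := β'.map e
    have hmem : ∀ i, γ i ∈ stalkLattice E x.1 := fun i ↦ by
      rw [Basis.map_apply]
      exact genericMap_mem_stalkLattice g (hβ' ▸ Submodule.subset_span ⟨i, rfl⟩)
    have hle : Submodule.span (X.presheaf.stalk x.1) (Set.range γ) ≤
        Submodule.span (X.presheaf.stalk x.1) (Set.range β) := by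
      rw [Submodule.span_le, hβ]
      rintro _ ⟨i, rfl⟩
      exact hmem i
    have hdet : b.det γ = b'.det β' := by
      rw [Basis.det_map]
      congr 1
      funext i
      simp [γ]
    have h0 := ordZ_det_nonneg hle
    have h3 := ordZ_det_mul (X.presheaf.stalk x.1) b β γ
    rw [localDegree_eq x.1 b' β' hβ', localDegree_eq x.1 b β hβ, tor, tor', ← hdet]
    simp only [Module.length_bot, ENat.toNat_zero, Nat.cast_zero]
    refine ⟨by omega, fun h v hv ↦ ?_⟩
    have h4 := span_eq_of_ordZ_det_eq_zero hle (by omega)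
    rw [← hβ, ← h4] at hv
    obtain ⟨c, rfl⟩ := (Submodule.mem_span_range_iff_exists_fun _).mp hv
    refine ⟨∑ i, c i • β' i, hβ' ▸ Submodule.sum_mem _ fun i _ ↦ Submodule.smul_mem _ _
      (Submodule.subset_span ⟨i, rfl⟩), ?_⟩
    rw [map_sum]
    refine Finset.sum_congr rfl fun i _ ↦ ?_
    exact map_smul (genericMap g) (algebraMap (X.presheaf.stalk x.1) X.functionField (c i)) _
  have heq : ∀ x : {x : X // IsClosed {x}}, localDegree E b x.1 ≤ localDegree E' b' x.1 := by
    have hs : ∑ᶠ x : {x : X // IsClosed {x}},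
        (localDegree E b x.1 - localDegree E' b' x.1) ≤ 0 := by
      rw [finsum_sub_distrib f2 f1]
      omega
    intro x
    have := single_le_finsum x ((f2.union f1).subset (Function.support_sub _ _))
      fun y ↦ sub_nonneg.mpr (key y).1
    linarith
  refine isIso_of_stalkMap_bijective fun x ↦ ⟨fun s t hst ↦ htf' x (hg.1 ?_), fun t ↦ ?_⟩
  · exact (toGeneric_stalkMap g x s).symm.trans
      ((congrArg (toGeneric E x) hst).trans (toGeneric_stalkMap g x t))
  · rcases isClosed_or_eq_genericPoint f x with hx | rfl
    · obtain ⟨w, ⟨s, rfl⟩, hw⟩ := (key ⟨x, hx⟩).2 (heq ⟨x, hx⟩) _ ⟨t, rfl⟩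
      exact ⟨s, htf x ((toGeneric_stalkMap g x s).trans hw)⟩
    · exact hg.2 t

/-- Finitely generated torsion modules over a discrete valuation ring have finite length, so that
the `ENat.toNat` in the definition of the degree loses nothing. -/
lemma length_ne_top_of_torsion {O M : Type*} [CommRing O] [IsDomain O] [IsDiscreteValuationRing O]
    [AddCommGroup M] [Module O M] [Module.Finite O M] (h : ∀ m : M, ∃ a : O, a ≠ 0 ∧ a • m = 0) :
    Module.length O M ≠ ⊤ := by
  obtain ⟨n, t, ht⟩ := Module.Finite.exists_fin (R := O) (M := M)
  choose a ha0 ha using fun i ↦ h (t i)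
  have h1 : ∀ i, IsArtinian O (O ⧸ Ideal.span {a i}) := fun i ↦
    ((isFiniteLength_iff_isNoetherian_isArtinian).mp
      (isFiniteLength_quotient_span_singleton O (mem_nonZeroDivisors_of_ne_zero (ha0 i)))).2
  let φ : (∀ i, O ⧸ Ideal.span {a i}) →ₗ[O] M := LinearMap.lsum O _ O fun i ↦
    Submodule.liftQ (Ideal.span {a i}) (LinearMap.toSpanSingleton O M (t i)) (by
      rw [Ideal.span, Submodule.span_le, Set.singleton_subset_iff]
      exact ha i)
  have hφ : Function.Surjective φ := by
    rw [← LinearMap.range_eq_top, ← top_le_iff, ← ht, Submodule.span_le]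
    rintro _ ⟨i, rfl⟩
    refine ⟨Pi.single i (Submodule.Quotient.mk 1), ?_⟩
    rw [LinearMap.lsum_piSingle]
    exact one_smul O (t i)
  have : IsArtinian O M := isArtinian_of_surjective _ φ hφ
  exact Module.length_ne_top

/-- The kernel of the map from a stalk to the generic stalk is torsion. -/
lemma exists_smul_eq_zero {E : X.Modules} (hE : IsCoherent E) (x : X) (e : E.presheaf.stalk x)
    (he : toGeneric E x e = 0) : ∃ a : X.presheaf.stalk x, a ≠ 0 ∧ a • e = 0 := by
  obtain ⟨U, hU, hxU, -⟩ := exists_affine_finite E hE x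
  obtain ⟨f, t, hf, hft⟩ := exists_smul_germ_eq hU (hE.localizesOn hU) hxU e
  have h1 : E.presheaf.germ U _ (genericPoint_mem hxU) t = 0 := by
    rw [← toGeneric_germ E x hxU, ← hft, toGeneric_smul, he, smul_zero]
  obtain ⟨g, hg, hgt⟩ := exists_basicOpen_of_germ_eq_zero hU (hE.localizesOn hU) _ h1
  have hg0 : X.presheaf.germ U x hxU g ≠ 0 := by
    intro h0
    have : g = 0 := germ_injective_of_isIntegral X x hxU (h0.trans (map_zero _).symm)
    rw [this] at hg
    exact (isUnit_germ_of_mem_basicOpen (genericPoint_mem hxU) hg).ne_zero (map_zero _)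
  refine ⟨X.presheaf.germ U x hxU g * X.presheaf.germ U x hxU f, mul_ne_zero hg0
    (isUnit_germ_of_mem_basicOpen hxU hf).ne_zero, ?_⟩
  rw [mul_smul, hft, ← germ_smul, hgt, map_zero]

section Torsion

variable {E : X.Modules} [Subsingleton (genericStalk E)]

/-- The degree of a torsion sheaf is its length. -/
lemma degree_eq_finsum_length (f : X ⟶ Spec (.of ℂ)) [SmoothOfRelativeDimension 1 f] [IsProper f]
    (hE : IsCoherent E) :
    degree E = ∑ᶠ x : {x : X // IsClosed {x}},
      ((Module.length (X.presheaf.stalk x.1) (E.presheaf.stalk x.1)).toNat : ℤ) := by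
  let b : Basis (Fin 0) X.functionField (genericStalk E) := Basis.empty _
  rw [degree_eq_finsum f hE b]
  refine finsum_congr fun x ↦ ?_
  have := isScalarTower_generic E x.1
  have h1 : stalkTorsion E x.1 = ⊤ := top_le_iff.mp fun t _ ↦ Subsingleton.elim _ _
  rw [localDegree_eq x.1 b b (Subsingleton.elim _ _), ordZ_det_self, sub_zero, h1,
    Module.length_top]

lemma degree_nonneg_of_subsingleton (f : X ⟶ Spec (.of ℂ)) [SmoothOfRelativeDimension 1 f]
    [IsProper f] (hE : IsCoherent E) : 0 ≤ degree E := by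
  rw [degree_eq_finsum_length f hE]
  exact finsum_nonneg fun x ↦ Int.natCast_nonneg _

/-- A torsion sheaf of degree zero vanishes. -/
lemma stalk_eq_zero_of_degree_le (f : X ⟶ Spec (.of ℂ)) [SmoothOfRelativeDimension 1 f]
    [IsProper f] (hE : IsCoherent E) (h : degree E ≤ 0) (x : X) (e : E.presheaf.stalk x) :
    e = 0 := by
  rcases isClosed_or_eq_genericPoint f x with hx | rfl
  · let b : Basis (Fin 0) X.functionField (genericStalk E) := Basis.empty _
    have hfin : (Function.support fun x : {x : X // IsClosed {x}} ↦
        ((Module.length (X.presheaf.stalk x.1) (E.presheaf.stalk x.1)).toNat : ℤ)).Finite := by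
      refine (finite_stalkLattice_ne f hE b).subset fun x hx h ↦ hx ?_
      have h1 : stalkTorsion E x.1 = ⊤ := top_le_iff.mp fun t _ ↦ Subsingleton.elim _ _
      change ((Module.length (X.presheaf.stalk x.1) (E.presheaf.stalk x.1)).toNat : ℤ) = 0
      rw [← Module.length_top, ← h1, h.1]
      simp
    have h1 := single_le_finsum ⟨x, hx⟩ hfin fun y ↦ Int.natCast_nonneg _
    rw [← degree_eq_finsum_length f hE] at h1
    have h2 : (Module.length (X.presheaf.stalk x) (E.presheaf.stalk x)).toNat = 0 := by
      have := h1.trans h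
      dsimp only at this
      omega
    have := hE.finite_stalk x
    have h3 : Module.length (X.presheaf.stalk x) (E.presheaf.stalk x) ≠ ⊤ := by
      have := hdvr ⟨x, hx⟩
      refine length_ne_top_of_torsion fun m ↦ ?_
      exact exists_smul_eq_zero hE x m (Subsingleton.elim (α := genericStalk E) _ _)
    rw [ENat.toNat_eq_zero] at h2
    have h4 := Module.length_eq_zero_iff.mp (h2.resolve_right h3)
    exact Subsingleton.elim _ _
  · exact Subsingleton.elim (α := genericStalk E) _ _

end Torsion

end Degree

/-! ### Closed curves in affine space parametrized by Laurent polynomials -/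

section Laurent

open Polynomial LaurentPolynomial

variable {k : Type} [Field k]

/-- If `s` is inverse to `t` and `p(t) s ^ M` comes from `A`, where `p(0) = 1` and `M > 0`, then
multiplying by a power of `s` gives a monic equation for `s` over `A`. -/
lemma isIntegral_of_aeval_mul_pow {A S : Type*} [CommRing A] [CommRing S] [Algebra k A]
    [Algebra k S] [Algebra A S] [IsScalarTower k A S] {p : k[X]} (hp : p.coeff 0 = 1) {t s : S}
    (hts : t * s = 1) {M : ℕ} (hM : 0 < M) {r : A}
    (h : aeval t p * s ^ M = algebraMap A S r) : IsIntegral A s := by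
  set n := p.natDegree
  have hq : (X ^ M * (p.reflect n).map (algebraMap k A)).natDegree ≤ M + n := by
    refine natDegree_mul_le.trans (add_le_add (natDegree_X_pow_le M) ?_)
    refine natDegree_map_le.trans (natDegree_reflect_le.trans ?_)
    simp [n]
  refine ⟨X ^ M * (p.reflect n).map (algebraMap k A) - Polynomial.C r * X ^ n, ?_, ?_⟩
  · refine monic_of_natDegree_le_of_coeff_eq_one (M + n) ((natDegree_sub_le _ _).trans
      (max_le hq ((natDegree_C_mul_X_pow_le _ _).trans (by lia)))) ?_
    rw [coeff_sub, coeff_X_pow_mul', coeff_C_mul_X_pow,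
      if_pos (Nat.le_add_right M n), if_neg (by lia : ¬ M + n = n),
      add_tsub_cancel_left, coeff_map, coeff_reflect, revAt_le le_rfl]
    simp [hp]
  · let : Invertible t := ⟨s, by rw [mul_comm, hts], hts⟩
    have h1 := eval₂_reflect_mul_pow (algebraMap k S) t n p le_rfl
    have h2 : eval₂ (algebraMap k S) s (p.reflect n) = s ^ n * aeval t p := by
      rw [aeval_def, ← h1, mul_comm (s ^ n), mul_assoc, ← mul_pow, hts, one_pow, mul_one]
      rfl
    rw [eval₂_sub, eval₂_mul, eval₂_X_pow, eval₂_map, ← IsScalarTower.algebraMap_eq, h2, eval₂_mul,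
      Polynomial.eval₂_C, eval₂_X_pow, ← h]
    ring

/-- A Laurent polynomial which is not a polynomial is `p T⁻ᴹ` with `p(0) ≠ 0` and `M > 0`. -/
lemma exists_toLaurent_eq_mul_T {r : k[T;T⁻¹]} (hr : ∀ p : k[X], toLaurent p ≠ r) :
    ∃ (p : k[X]) (M : ℕ), 0 < M ∧ p.coeff 0 ≠ 0 ∧ toLaurent p * T (-M) = r := by
  classical
  have hex : ∃ M : ℕ, ∃ p : k[X], toLaurent p = r * T M := exists_T_pow r
  obtain ⟨p, hp⟩ := Nat.find_spec hex
  have hM : 0 < Nat.find hex := by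
    by_contra! h
    rw [Nat.le_zero.1 h] at hp
    exact hr p (by simpa using hp)
  refine ⟨p, Nat.find hex, hM, fun h0 ↦ ?_, by rw [hp, mul_T_assoc]; simp⟩
  obtain ⟨q, rfl⟩ := X_dvd_iff.2 h0
  refine Nat.find_min hex (Nat.sub_lt hM one_pos) ⟨q, ?_⟩
  rw [map_mul, toLaurent_X] at hp
  rw [Nat.cast_pred hM, sub_eq_add_neg, ← mul_T_assoc, ← hp, mul_assoc, mul_comm,
    mul_assoc, ← T_add]
  simp

/-- `T⁻¹` is integral over any algebra containing a Laurent polynomial with a pole at `0`. -/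
lemma isIntegral_T_neg_one {A : Type*} [CommRing A] [Algebra k A] [Algebra A k[T;T⁻¹]]
    [IsScalarTower k A k[T;T⁻¹]] (r : A) (hr : ∀ p : k[X], toLaurent p ≠ algebraMap A k[T;T⁻¹] r) :
    IsIntegral A (T (-1) : k[T;T⁻¹]) := by
  obtain ⟨p, M, hM, h0, h⟩ := exists_toLaurent_eq_mul_T hr
  refine isIntegral_of_aeval_mul_pow (p := Polynomial.C (p.coeff 0)⁻¹ * p) (t := T 1)
    (r := (p.coeff 0)⁻¹ • r) (by simp [h0]) (by rw [← T_add]; simp) hM ?_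
  have h1 : ∀ q : k[X], aeval (T 1 : k[T;T⁻¹]) q = toLaurent q := fun q ↦ by
    rw [← toLaurent_X, ← toLaurentAlg_apply, aeval_algHom_apply, aeval_X_left_apply,
      toLaurentAlg_apply]
  rw [h1, map_mul, toLaurent_C, T_pow, mul_neg_one, mul_assoc, h, Algebra.smul_def,
    map_mul, ← IsScalarTower.algebraMap_apply, LaurentPolynomial.C_eq_algebraMap]

/-- `T` is integral over any algebra containing a Laurent polynomial with a pole at `∞`. -/
lemma isIntegral_T_one {A : Type*} [CommRing A] [Algebra k A] [Algebra A k[T;T⁻¹]]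
    [IsScalarTower k A k[T;T⁻¹]] (r : A)
    (hr : ∀ p : k[X], toLaurent p ≠ invert (algebraMap A k[T;T⁻¹] r)) :
    IsIntegral A (T 1 : k[T;T⁻¹]) := by
  obtain ⟨p, M, hM, h0, h⟩ := exists_toLaurent_eq_mul_T hr
  refine isIntegral_of_aeval_mul_pow (p := Polynomial.C (p.coeff 0)⁻¹ * p) (t := T (-1))
    (r := (p.coeff 0)⁻¹ • r) (by simp [h0]) (by rw [← T_add]; simp) hM ?_
  have h1 : ∀ q : k[X], aeval (T (-1) : k[T;T⁻¹]) q = invert (toLaurent q) := fun q ↦ by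
    have : (T (-1) : k[T;T⁻¹]) = (invert.toAlgHom.comp toLaurentAlg) X := by simp
    rw [this, aeval_algHom_apply, aeval_X_left_apply]
    simp
  replace h := congrArg invert h
  rw [involutive_invert (R := k) _, map_mul, invert_T, neg_neg] at h
  rw [h1, map_mul, map_mul, toLaurent_C, invert_C, T_pow, mul_one, mul_assoc, h, Algebra.smul_def,
    map_mul, ← IsScalarTower.algebraMap_apply, LaurentPolynomial.C_eq_algebraMap]

/-- The curve parametrized by Laurent polynomials `F` is closed if some coordinate has a pole at `0`
and some coordinate has a pole at `∞`: then `k[T, T⁻¹]` is integral over `k[F]`, and points of the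
closure lift to points of the parametrizing line. -/
theorem isZariskiClosed_range_eval [IsAlgClosed k] {σ : Type} (F : σ → k[T;T⁻¹])
    (h0 : ∃ s, ∀ p : k[X], toLaurent p ≠ F s) (h1 : ∃ s, ∀ p : k[X], toLaurent p ≠ invert (F s)) :
    IsZariskiClosed
      (Set.range fun (t : kˣ) s ↦ LaurentPolynomial.eval₂ (RingHom.id k) t (F s)) := by
  let φ : MvPolynomial σ k →ₐ[k] k[T;T⁻¹] := MvPolynomial.aeval F
  let : Algebra (MvPolynomial σ k) k[T;T⁻¹] := φ.toRingHom.toAlgebra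
  have hφ : ∀ a, algebraMap (MvPolynomial σ k) k[T;T⁻¹] a = φ a := fun _ ↦ rfl
  have : IsScalarTower k (MvPolynomial σ k) k[T;T⁻¹] :=
    .of_algebraMap_eq fun a ↦ (φ.commutes a).symm
  have hX : ∀ s, algebraMap (MvPolynomial σ k) k[T;T⁻¹] (MvPolynomial.X s) = F s :=
    fun s ↦ MvPolynomial.aeval_X F s
  have hneg : IsIntegral (MvPolynomial σ k) (T (-1) : k[T;T⁻¹]) := by
    obtain ⟨s, hs⟩ := h0
    exact isIntegral_T_neg_one (MvPolynomial.X s) (by rwa [hX])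
  have hpos : IsIntegral (MvPolynomial σ k) (T 1 : k[T;T⁻¹]) := by
    obtain ⟨s, hs⟩ := h1
    exact isIntegral_T_one (MvPolynomial.X s) (by rwa [hX])
  have hint : Algebra.IsIntegral (MvPolynomial σ k) k[T;T⁻¹] := ⟨fun r ↦ by
    induction r using LaurentPolynomial.induction_on' with
    | add p q hp hq => exact hp.add hq
    | C_mul_T n a =>
      refine IsIntegral.mul ?_ ?_
      · rw [LaurentPolynomial.C_eq_algebraMap, IsScalarTower.algebraMap_apply k (MvPolynomial σ k)]
        exact isIntegral_algebraMap
      · obtain ⟨m, rfl | rfl⟩ := n.eq_nat_or_neg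
        · simpa [T_pow] using hpos.pow m
        · simpa [T_pow] using hneg.pow m⟩
  refine ⟨{q | φ q = 0}, Set.Subset.antisymm ?_ fun y hy ↦ ?_⟩
  · rintro _ ⟨t, rfl⟩ q hq
    rw [← map_zero (LaurentPolynomial.eval₂ (RingHom.id k) t), ← show φ q = 0 from hq]
    have h2 : (LaurentPolynomial.eval₂ (RingHom.id k) t).comp (φ : MvPolynomial σ k →+* k[T;T⁻¹]) =
        MvPolynomial.eval fun s ↦ LaurentPolynomial.eval₂ (RingHom.id k) t (F s) := by
      refine MvPolynomial.ringHom_ext (fun a ↦ ?_) fun s ↦ ?_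
      · rw [RingHom.comp_apply, RingHom.coe_coe, ← MvPolynomial.algebraMap_eq, φ.commutes,
          ← LaurentPolynomial.C_eq_algebraMap]
        simp
      · simp [φ]
    exact (RingHom.congr_fun h2 q).symm
  -- Lift the maximal ideal of the point `y` to a prime `Q` of `k[T, T⁻¹]`, with residue field `k`.
  · let P : Ideal (MvPolynomial σ k) := RingHom.ker (MvPolynomial.eval y)
    have hP : P.IsPrime := RingHom.ker_isPrime _
    obtain ⟨Q, hQ, hQP⟩ := Ideal.exists_ideal_over_prime_of_isIntegral_of_isDomain P
      (fun a ha ↦ hy a ha)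
    let B := k[T;T⁻¹] ⧸ Q
    have hA : ∀ a : MvPolynomial σ k,
        Ideal.Quotient.mk Q (φ a) = algebraMap k B (MvPolynomial.eval y a) := fun a ↦ by
      have h2 : a - MvPolynomial.C (MvPolynomial.eval y a) ∈ P := by
        simp only [P, RingHom.mem_ker, map_sub, MvPolynomial.eval_C, sub_self]
      rw [← hQP, Ideal.mem_comap, hφ, map_sub, ← Ideal.Quotient.eq] at h2
      rw [h2, ← MvPolynomial.algebraMap_eq, AlgHom.commutes]
      rfl
    have hB : Algebra.IsIntegral k B := ⟨fun b ↦ by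
      obtain ⟨r, rfl⟩ := Ideal.Quotient.mk_surjective b
      exact (hint.isIntegral r).map_of_comp_eq (MvPolynomial.eval y) (Ideal.Quotient.mk Q)
        (RingHom.ext fun a ↦ (hA a).symm)⟩
    let e := AlgEquiv.ofBijective (Algebra.ofId k B) IsAlgClosed.algebraMap_bijective_of_isIntegral
    let χ : k[T;T⁻¹] →ₐ[k] k := e.symm.toAlgHom.comp (Ideal.Quotient.mkₐ k Q)
    let u : kˣ := Units.map (χ : k[T;T⁻¹] →* k) (isUnit_T 1).unit
    refine ⟨u, funext fun s ↦ ?_⟩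
    have hχ : LaurentPolynomial.eval₂ (RingHom.id k) u = (χ : k[T;T⁻¹] →+* k) := by
      refine IsLocalization.ringHom_ext (Submonoid.powers (X : k[X])) ?_
      refine Polynomial.ringHom_ext (fun a ↦ ?_) ?_
      · have := χ.commutes a
        rw [← LaurentPolynomial.C_eq_algebraMap] at this
        simp [this]
      · simp [u]
    dsimp only
    rw [hχ, ← hX, hφ]
    change e.symm (Ideal.Quotient.mk Q (φ _)) = _
    rw [hA, MvPolynomial.eval_X]
    exact e.symm.commutes _

/-- Laurent polynomials are determined by their values. -/
lemma laurent_ext [Infinite k] {r s : k[T;T⁻¹]}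
    (h : ∀ t : kˣ, LaurentPolynomial.eval₂ (RingHom.id k) t r =
      LaurentPolynomial.eval₂ (RingHom.id k) t s) : r = s := by
  obtain ⟨N, p, hp⟩ := exists_T_pow (r - s)
  have h0 : p = 0 := by
    refine Polynomial.eq_zero_of_infinite_isRoot p
      ((Set.finite_singleton 0).infinite_compl.mono fun t ht ↦ ?_)
    have h1 := congrArg (LaurentPolynomial.eval₂ (RingHom.id k) (Units.mk0 t ht)) hp
    rw [eval₂_toLaurent, map_mul, map_sub, h, sub_self, zero_mul] at h1
    exact h1
  rw [h0, map_zero] at hp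
  exact sub_eq_zero.1 ((isUnit_T N).mul_left_eq_zero.1 hp.symm)

lemma eval_invert (t : kˣ) (r : k[T;T⁻¹]) :
    LaurentPolynomial.eval₂ (RingHom.id k) t (invert r) =
      LaurentPolynomial.eval₂ (RingHom.id k) t⁻¹ r := by
  induction r using LaurentPolynomial.induction_on' with
  | add p q hp hq => rw [map_add, map_add, map_add, hp, hq]
  | C_mul_T n a => simp

/-- A polynomial in `T` which is also a polynomial in `T⁻¹` is constant. -/
lemma eq_C_of_mem_range {r : k[T;T⁻¹]} (h : r ∈ (toLaurentAlg : k[X] →ₐ[k] _).range)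
    (h' : invert r ∈ (toLaurentAlg : k[X] →ₐ[k] _).range) : ∃ a, r = LaurentPolynomial.C a := by
  obtain ⟨p, hp⟩ := h
  obtain ⟨q, hq⟩ := h'
  have hneg : ∀ (p : k[X]) (n : ℤ), n < 0 → (toLaurent p).coeff n = 0 := fun p n hn ↦ by
    rw [← Finsupp.notMem_support_iff, support_coeff_toLaurent]
    simp only [Finset.mem_map, not_exists, not_and]
    rintro m - rfl
    exact absurd hn (by simp)
  refine ⟨r.coeff 0, LaurentPolynomial.ext fun n ↦ ?_⟩
  rw [C_apply]
  split_ifs with h0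
  · rw [h0]
  · obtain h1 | h1 := lt_or_gt_of_ne h0
    · rw [← hp]
      exact hneg p n h1
    · have h2 := hneg q (-n) (by lia)
      change (toLaurentAlg q).coeff (-n) = 0 at h2
      erw [hq] at h2
      simpa using h2

end Laurent

/-! ### Stability of representations of the doubled quiver -/

section GIT

open LaurentPolynomial

variable {I : Type} [Quiver.{0} I] {k : Type} [Field k] {n : I → ℕ} {o : I}

/-- The representation `x` is generated by the framing: a subrepresentation which contains the
framing vector space is everything. -/
def IsGenerated (o : I) (x : Rep I n k) : Prop :=
  ∀ W : ∀ i, Submodule k (Fin (n i) → k),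
    (∀ i j (a : DArrow i j), ∀ w ∈ W i, (x i j a).mulVec w ∈ W j) → W o = ⊤ → ∀ i, W i = ⊤

variable [Fintype I] [DecidableEq I]

/-- The coordinates of `g (x, 1)` for a family `A` of matrices of Laurent polynomials with inverse
`A'`. -/
def curvePoint (o : I) (x : Rep I n k) (A A' : ∀ i, Matrix (Fin (n i)) (Fin (n i)) k[T;T⁻¹]) :
    Coord I n → k[T;T⁻¹] :=
  affinePoint (fun i j a ↦ A j * (x i j a).map LaurentPolynomial.C * A' i)
    (∏ i : {i : I // i ≠ o}, (A' i).det)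

/-- If `g (x, 1)` is polynomial in the parameter and `x` is generated by its framing, then `g` is
constant. The vectors `w` with `A w` polynomial form a subrepresentation containing the framing, so
that `A` is polynomial. So is the inverse of its determinant, which is a factor of the last
coordinate. Hence `A' = A(T⁻¹)` is polynomial too, and `A` is constant. -/
lemma exists_eq_C_of_curvePoint_mem {x : Rep I n k} (hx : IsGenerated o x)
    {A A' : ∀ i, Matrix (Fin (n i)) (Fin (n i)) k[T;T⁻¹]} (hA : ∀ i, A' i * A i = 1)
    (hinv : ∀ i, A' i = (A i).map invert) (ho : A o = 1)
    (h : ∀ s, curvePoint o x A A' s ∈ (Polynomial.toLaurentAlg : Polynomial k →ₐ[k] _).range)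
    (i : I) (r s : Fin (n i)) : ∃ a, A i r s = LaurentPolynomial.C a := by
  let S := (Polynomial.toLaurentAlg : Polynomial k →ₐ[k] k[T;T⁻¹]).range
  have hC : ∀ a, LaurentPolynomial.C a ∈ S := fun a ↦ S.algebraMap_mem a
  let W : ∀ i, Submodule k (Fin (n i) → k) := fun i ↦
    { carrier := {w | ∀ r, (A i).mulVec (fun s ↦ LaurentPolynomial.C (w s)) r ∈ S}
      add_mem' := fun {w w'} hw hw' r ↦ by
        convert S.add_mem (hw r) (hw' r) using 1
        simp [Matrix.mulVec, dotProduct, mul_add, Finset.sum_add_distrib]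
      zero_mem' := fun r ↦ by
        convert S.zero_mem using 1
        simp [Matrix.mulVec, dotProduct]
      smul_mem' := fun c w hw r ↦ by
        convert S.mul_mem (hC c) (hw r) using 1
        simp [Matrix.mulVec, dotProduct, Finset.mul_sum, mul_left_comm] }
  have hmem : ∀ i r s, A i r s ∈ S := fun i r s ↦ by
    have hW := hx W (fun i j a w hw r ↦ ?_) (eq_top_iff.2 fun w _ r ↦ ?_) i
    · have h1 : Pi.single s 1 ∈ W i := hW ▸ Submodule.mem_top
      convert h1 r using 1
      have h2 : (fun s' ↦ LaurentPolynomial.C ((Pi.single s 1 : Fin (n i) → k) s')) =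
          Pi.single s 1 := funext fun s' ↦ by
        rw [Pi.single_apply, Pi.single_apply]
        split_ifs <;> simp
      rw [h2, Matrix.mulVec_single_one]
      rfl
    · have h1 : (A j).mulVec (fun s ↦ LaurentPolynomial.C ((x i j a).mulVec w s)) =
          (A j * (x i j a).map LaurentPolynomial.C * A' i).mulVec
            ((A i).mulVec fun s ↦ LaurentPolynomial.C (w s)) := by
        rw [Matrix.mulVec_mulVec, Matrix.mul_assoc, hA, Matrix.mul_one, ← Matrix.mulVec_mulVec]
        congr 1
        ext1 s
        simp [Matrix.mulVec, dotProduct]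
      rw [h1, Matrix.mulVec, dotProduct]
      exact S.sum_mem fun s _ ↦ S.mul_mem (h (some ⟨i, j, a, r, s⟩)) (hw s)
    · rw [ho, Matrix.one_mulVec]
      exact hC _
  refine eq_C_of_mem_range (hmem i r s) ?_
  have hdet : ∀ i, (A i).det ∈ S := fun i ↦ by
    rw [Matrix.det_apply]
    exact S.sum_mem fun σ _ ↦ by
      rw [Units.smul_def]
      exact zsmul_mem (S.prod_mem fun _ _ ↦ hmem _ _ _) _
  by_cases hi : i = o
  · subst hi
    rw [ho, Matrix.one_apply]
    split_ifs
    exacts [by simp only [map_one]; exact S.one_mem, by simp only [map_zero]; exact S.zero_mem]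
  have hdet' : ∀ i, (A' i).det * (A i).det = 1 := fun i ↦ by
    rw [← Matrix.det_mul, hA, Matrix.det_one]
  have hdA' : (A' i).det ∈ S := by
    have h1 : (∏ j : {i : I // i ≠ o}, (A' j).det) *
        ∏ j ∈ Finset.univ.erase (⟨i, hi⟩ : {i : I // i ≠ o}), (A j).det = (A' i).det := by
      rw [← Finset.mul_prod_erase _ _ (Finset.mem_univ (⟨i, hi⟩ : {i : I // i ≠ o})), mul_assoc,
        ← Finset.prod_mul_distrib, Finset.prod_congr rfl fun (j : {i : I // i ≠ o}) _ ↦ hdet' j,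
        Finset.prod_const_one, mul_one]
    rw [← h1]
    exact S.mul_mem (h none) (S.prod_mem fun j _ ↦ hdet _)
  have h2 : A' i = (A' i).det • (A i).adjugate := by
    rw [← Matrix.mul_one ((A' i).det • (A i).adjugate), ← mul_eq_one_comm.1 (hA i), ← mul_assoc,
      Matrix.smul_mul, Matrix.adjugate_mul, smul_smul, hdet', one_smul, Matrix.one_mul]
  rw [show invert (A i r s) = A' i r s by rw [hinv]; rfl, h2, Matrix.smul_apply, smul_eq_mul]
  refine S.mul_mem hdA' ?_
  rw [Matrix.adjugate_apply, Matrix.det_apply]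
  refine S.sum_mem fun σ _ ↦ ?_
  rw [Units.smul_def]
  refine zsmul_mem (S.prod_mem fun _ _ ↦ ?_) _
  rw [Matrix.updateRow_apply]
  split_ifs
  · rw [Pi.single_apply]
    split_ifs
    exacts [S.one_mem, S.zero_mem]
  · exact hmem _ _ _

lemma Gauge.at_of_ne (g : Gauge o n k) {i : I} (h : i ≠ o) : g.at i = g ⟨i, h⟩ := dif_pos h

lemma Gauge.at_self (g : Gauge o n k) : g.at o = 1 := dif_neg (not_not.2 rfl)

lemma Gauge.at_inv (g : Gauge o n k) (i : I) : g⁻¹.at i = (g.at i)⁻¹ := by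
  by_cases h : i = o
  · subst h
    simp [Gauge.at_self]
  · simp [Gauge.at_of_ne _ h]

/-- A representation generated by its framing is stable: either the orbit of `(x, 1)` under a
one-parameter subgroup has poles at both ends, and hence is closed, or the subgroup is trivial. -/
theorem IsGenerated.isThetaStable [IsAlgClosed k] {x : Rep I n k} (hx : IsGenerated o x) :
    IsThetaStable o (fun _ ↦ 1) x := by
  rintro c ⟨P, hP⟩
  have hinf : Infinite k := IsAlgClosed.instInfinite
  let ev (t : kˣ) : k[T;T⁻¹] →+* k := LaurentPolynomial.eval₂ (RingHom.id k) t
  let A : ∀ i, Matrix (Fin (n i)) (Fin (n i)) k[T;T⁻¹] := fun i ↦ if h : i ≠ o then P ⟨i, h⟩ else 1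
  let A' : ∀ i, Matrix (Fin (n i)) (Fin (n i)) k[T;T⁻¹] := fun i ↦ (A i).map invert
  have hev : ∀ t i, (A i).map (ev t) = ((c t).at i).val := fun t i ↦ by
    by_cases h : i = o
    · subst h
      simp [A, Gauge.at_self, Matrix.map_one]
    · ext r s
      simp only [A, dif_pos h, Gauge.at_of_ne _ h, hP, Matrix.map_apply, ev]
  have hev' : ∀ t i, (A' i).map (ev t) = ((c t).at i)⁻¹.val := fun t i ↦ by
    rw [← Gauge.at_inv, ← map_inv, ← hev]
    ext r s
    exact eval_invert t _
  have hA : ∀ i, A' i * A i = 1 := fun i ↦ by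
    refine Matrix.ext fun r s ↦ laurent_ext fun t ↦ ?_
    change (A' i * A i).map (ev t) r s = (1 : Matrix _ _ k[T;T⁻¹]).map (ev t) r s
    rw [Matrix.map_mul, hev, hev', ← Units.val_mul, inv_mul_cancel,
      Matrix.map_one _ (map_zero _) (map_one _)]
    rfl
  have hA'' : ∀ i, A i = (A' i).map invert := fun i ↦
    Matrix.ext fun r s ↦ (involutive_invert _).symm
  let F := curvePoint o x A A'
  have hF : (fun t ↦ affinePoint ((c t).act x) (((c t).character fun _ ↦ 1)⁻¹ : kˣ)) =
      fun t s ↦ ev t (F s) := by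
    funext t s
    obtain _ | ⟨i, j, a, r, s⟩ := s
    · simp only [affinePoint, Gauge.character, zpow_one, F, curvePoint, ← Finset.prod_inv_distrib,
        Units.coe_prod, map_prod]
      refine Finset.prod_congr rfl fun i _ ↦ ?_
      rw [RingHom.map_det, RingHom.mapMatrix_apply, hev', Gauge.at_of_ne _ i.2, ← map_inv]
      rfl
    · change _ = (A j * (x i j a).map LaurentPolynomial.C * A' i).map (ev t) r s
      have h1 : ((x i j a).map LaurentPolynomial.C).map (ev t) = x i j a :=
        Matrix.ext fun r s ↦ eval₂_C _ _ _
      rw [Matrix.map_mul, Matrix.map_mul, hev, hev', h1]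
      rfl
  have hF' : ∀ s, curvePoint o x A' A s = invert (F s) := fun s ↦ by
    obtain _ | ⟨i, j, a, r, s⟩ := s
    · simp only [F, curvePoint, affinePoint, map_prod]
      refine Finset.prod_congr rfl fun i _ ↦ ?_
      rw [hA'' i, AlgEquiv.map_det]
      rfl
    · change _ = (A j * (x i j a).map LaurentPolynomial.C * A' i).map invert r s
      have h1 : ((x i j a).map LaurentPolynomial.C).map invert =
          (x i j a).map LaurentPolynomial.C :=
        Matrix.ext fun r s ↦ invert_C _
      rw [Matrix.map_mul, Matrix.map_mul, ← hA'', h1]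
      rfl
  -- If every entry of `A` is constant, then the orbit is a point.
  have hconst (h : ∀ i r s, ∃ a, A i r s = LaurentPolynomial.C a) :
      IsZariskiClosed (Set.range fun t s ↦ ev t (F s)) := by
    have h1 : ∀ t s, ev t (F s) = ev 1 (F s) := fun t s ↦ by
      have h2 : ∀ i, (c t).at i = (c 1).at i := fun i ↦ by
        rw [← Units.val_inj, ← hev, ← hev]
        ext r s
        obtain ⟨a, ha⟩ := h i r s
        simp [ha, ev]
      have h3 : c t = c 1 := funext fun i ↦ by simpa [Gauge.at_of_ne _ i.2] using h2 i
      rw [← congrFun (congrFun hF t) s, ← congrFun (congrFun hF 1) s, h3]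
    refine ⟨{q | ∃ s, q = MvPolynomial.X s - MvPolynomial.C (ev 1 (F s))}, Set.ext fun y ↦
      ⟨?_, fun hy ↦ ⟨1, funext fun s ↦ ?_⟩⟩⟩
    · rintro ⟨t, rfl⟩ _ ⟨s, rfl⟩
      simp [h1 t]
    · have := hy _ ⟨s, rfl⟩
      rw [map_sub, MvPolynomial.eval_X, MvPolynomial.eval_C, sub_eq_zero] at this
      exact this.symm
  rw [hF]
  by_cases h0 : ∀ s, F s ∈ (Polynomial.toLaurentAlg : Polynomial k →ₐ[k] _).range
  · exact hconst (exists_eq_C_of_curvePoint_mem hx hA (fun _ ↦ rfl) (by simp [A]) h0)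
  by_cases h1 : ∀ s, invert (F s) ∈ (Polynomial.toLaurentAlg : Polynomial k →ₐ[k] _).range
  · refine hconst fun i r s ↦ ?_
    obtain ⟨a, ha⟩ := exists_eq_C_of_curvePoint_mem hx (fun i ↦ mul_eq_one_comm.1 (hA i)) hA''
      (by simp [A', A, Matrix.map_one]) (fun s ↦ hF' s ▸ h1 s) i r s
    refine ⟨a, ?_⟩
    rw [hA'' i, Matrix.map_apply, ha, invert_C]
  push Not at h0 h1
  obtain ⟨s, hs⟩ := h0
  obtain ⟨s', hs'⟩ := h1
  exact isZariskiClosed_range_eval F ⟨s, fun p hp ↦ hs ⟨p, hp⟩⟩ ⟨s', fun p hp ↦ hs' ⟨p, hp⟩⟩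

lemma exists_projection {m : ℕ} (W : Submodule k (Fin m → k)) :
    ∃ p : Matrix (Fin m) (Fin m) k,
      p * p = p ∧ (∀ w ∈ W, p.mulVec w = w) ∧ ∀ w, p.mulVec w ∈ W := by
  obtain ⟨π, hπ⟩ := LinearMap.exists_leftInverse_of_injective W.subtype W.ker_subtype
  have h1 : ∀ w, (LinearMap.toMatrix' (W.subtype ∘ₗ π)).mulVec w = π w := fun w ↦ by
    rw [LinearMap.toMatrix'_mulVec]
    rfl
  have h2 : ∀ w ∈ W, (π w : Fin m → k) = w := fun w hw ↦
    congrArg Subtype.val (LinearMap.congr_fun hπ ⟨w, hw⟩)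
  refine ⟨LinearMap.toMatrix' (W.subtype ∘ₗ π), ?_, fun w hw ↦ by rw [h1, h2 w hw],
    fun w ↦ by rw [h1]; exact (π w).2⟩
  rw [← LinearMap.toMatrix'_comp]
  congr 1
  exact LinearMap.ext fun w ↦ h2 _ (π w).2

lemma add_smul_mul_add_smul {m : ℕ} {p : Matrix (Fin m) (Fin m) k} (hp : p * p = p) (a b : k) :
    (p + a • (1 - p)) * (p + b • (1 - p)) = p + (a * b) • (1 - p) := by
  have h1 : p * (1 - p) = 0 := by rw [mul_sub, hp, mul_one, sub_self]
  have h2 : (1 - p) * p = 0 := by rw [sub_mul, hp, one_mul, sub_self]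
  have h3 : (1 - p) * (1 - p) = 1 - p := by rw [mul_sub, h2, mul_one, sub_zero]
  rw [add_mul, mul_add, mul_add, smul_mul_smul_comm, Matrix.smul_mul, Matrix.mul_smul, h1, h2, h3,
    hp, smul_zero, smul_zero, add_zero, zero_add]

/-- The one-parameter subgroup acting with weight `0` on the images of the projections `p i`, and
with weight `-1` on their kernels. -/
def projectionSubgroup (o : I) (p : ∀ i, Matrix (Fin (n i)) (Fin (n i)) k)
    (hp : ∀ i, p i * p i = p i) : kˣ →* Gauge o n k :=
  MonoidHom.pi fun i ↦ MonoidHom.toHomUnits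
    { toFun := fun t ↦ p i + (t⁻¹ : kˣ).val • (1 - p i)
      map_one' := by simp
      map_mul' := fun s t ↦ by
        rw [add_smul_mul_add_smul (hp i), mul_inv, Units.val_mul] }

lemma projectionSubgroup_at {p : ∀ i, Matrix (Fin (n i)) (Fin (n i)) k}
    (hp : ∀ i, p i * p i = p i) (ho : p o = 1) (t : kˣ) (i : I) :
    ((projectionSubgroup o p hp t).at i).val = p i + (t⁻¹ : kˣ).val • (1 - p i) := by
  by_cases h : i = o
  · subst h
    simp [Gauge.at_self, ho]
  · rw [Gauge.at_of_ne _ h]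
    rfl

lemma projectionSubgroup_at_inv {p : ∀ i, Matrix (Fin (n i)) (Fin (n i)) k}
    (hp : ∀ i, p i * p i = p i) (ho : p o = 1) (t : kˣ) (i : I) :
    ((projectionSubgroup o p hp t).at i)⁻¹.val = p i + t.val • (1 - p i) := by
  rw [← Gauge.at_inv, ← map_inv, projectionSubgroup_at hp ho, inv_inv]

/-- If `W` is a proper subrepresentation containing the framing, then `(x, 1)` flows under the
one-parameter subgroup of weight `0` on `W` and `-1` on a complement to a point `(x₀, 0)` which is
not in the orbit. -/
theorem IsThetaStable.isGenerated [Infinite k] {x : Rep I n k}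
    (hx : IsThetaStable o (fun _ ↦ 1) x) : IsGenerated o x := by
  intro W hW hWo
  by_contra! ⟨i₀, hi₀⟩
  choose p hp hpW hpm using fun i ↦ exists_projection (W i)
  have ho : p o = 1 := by
    refine Matrix.ext_of_mulVec_single fun s ↦ ?_
    rw [hpW o _ (hWo ▸ Submodule.mem_top), Matrix.one_mulVec]
  have hi₀o : i₀ ≠ o := fun h ↦ hi₀ (h ▸ hWo)
  have hzero : ∀ i j (a : DArrow i j), (1 - p j) * x i j a * p i = 0 := fun i j a ↦ by
    refine Matrix.ext_of_mulVec_single fun s ↦ ?_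
    rw [← Matrix.mulVec_mulVec, ← Matrix.mulVec_mulVec, Matrix.sub_mulVec, Matrix.one_mulVec,
      hpW j _ (hW i j a _ (hpm i _)), sub_self, Matrix.zero_mulVec]
  -- The orbit map extends to the affine line, as the block of `x` from `W` to its complement
  -- vanishes.
  let G : Coord I n → Polynomial k := affinePoint
    (fun i j a ↦ (p j * x i j a * p i + (1 - p j) * x i j a * (1 - p i)).map Polynomial.C +
      (Polynomial.X : Polynomial k) • (p j * x i j a * (1 - p i)).map Polynomial.C)
    (∏ i : {i : I // i ≠ o}, ((p i).map Polynomial.C +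
      (Polynomial.X : Polynomial k) • (1 - p i).map Polynomial.C).det)
  have hmap : ∀ (m m' : ℕ) (t : k) (B B' : Matrix (Fin m) (Fin m') k),
      (B.map Polynomial.C + (Polynomial.X : Polynomial k) • B'.map Polynomial.C).map
        (Polynomial.evalRingHom t) = B + t • B' := fun m m' t B B' ↦
    Matrix.ext fun r s ↦ by simp [mul_comm t]
  have hnone : ∀ t, (G none).eval t =
      ∏ i : {i : I // i ≠ o}, (p i + t • (1 - p i)).det := fun t ↦ by
    rw [← Polynomial.coe_evalRingHom]
    simp only [G, affinePoint, map_prod]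
    refine Finset.prod_congr rfl fun i _ ↦ ?_
    rw [RingHom.map_det, RingHom.mapMatrix_apply, hmap]
  let c := projectionSubgroup o p hp
  have hG : ∀ t : kˣ, affinePoint ((c t).act x) (((c t).character fun _ ↦ 1)⁻¹ : kˣ) =
      fun s ↦ (G s).eval t.val := fun t ↦ by
    funext s
    obtain _ | ⟨i, j, a, r, s⟩ := s
    · rw [hnone]
      simp only [affinePoint, Gauge.character, zpow_one, ← Finset.prod_inv_distrib, Units.coe_prod]
      refine Finset.prod_congr rfl fun i _ ↦ ?_
      rw [← projectionSubgroup_at_inv hp ho, Gauge.at_of_ne _ i.2, ← map_inv]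
      rfl
    · have h1 : (p j + (t⁻¹ : kˣ).val • (1 - p j)) * x i j a * (p i + t.val • (1 - p i)) =
          (p j * x i j a * p i + (1 - p j) * x i j a * (1 - p i)) +
            t.val • (p j * x i j a * (1 - p i)) := by
        simp only [Matrix.add_mul, Matrix.mul_add, Matrix.smul_mul, Matrix.mul_smul, hzero,
          smul_zero]
        rw [smul_add, smul_smul, Units.mul_inv, one_smul, add_zero]
        abel
      change (((c t).at j).val * x i j a * ((c t).at i)⁻¹.val) r s = _
      rw [projectionSubgroup_at hp ho, projectionSubgroup_at_inv hp ho, h1, ← hmap]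
      rfl
  obtain ⟨J, hJ⟩ := hx c ⟨fun i ↦ (p i).map LaurentPolynomial.C +
    (T (-1) : k[T;T⁻¹]) • (1 - p i).map LaurentPolynomial.C, fun t i r s ↦ by
      rw [← Gauge.at_of_ne (c t) i.2, projectionSubgroup_at hp ho]
      simp
      ring⟩
  -- Its value at `0` lies in the closure of the orbit, but its last coordinate vanishes.
  have h0 : (fun s ↦ (G s).eval 0) ∈ {y : Coord I n → k | ∀ q ∈ J, MvPolynomial.eval y q = 0} := by
    intro q hq
    have h1 : ∀ t, MvPolynomial.eval (fun s ↦ (G s).eval t) q = (MvPolynomial.aeval G q).eval t :=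
      fun t ↦ by
        rw [← Polynomial.coe_evalRingHom, MvPolynomial.aeval_def, MvPolynomial.hom_eval₂]
        simp only [MvPolynomial.eval, MvPolynomial.coe_eval₂Hom]
        congr 1
        exact RingHom.ext fun a ↦ by simp
    rw [h1]
    have h2 : MvPolynomial.aeval G q = 0 := by
      refine Polynomial.eq_zero_of_infinite_isRoot _
        ((Set.finite_singleton 0).infinite_compl.mono fun t ht ↦ ?_)
      have h3 : affinePoint ((c (Units.mk0 t ht)).act x)
          (((c (Units.mk0 t ht)).character fun _ ↦ 1)⁻¹ : kˣ) ∈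
          {y : Coord I n → k | ∀ q ∈ J, MvPolynomial.eval y q = 0} := hJ ▸ ⟨_, rfl⟩
      rw [hG] at h3
      exact (h1 t).symm.trans (h3 q hq)
    rw [h2, Polynomial.eval_zero]
  rw [← hJ] at h0
  obtain ⟨t, ht⟩ := h0
  have h1 : (((c t).character fun _ ↦ 1)⁻¹ : kˣ).val = (G none).eval 0 := congrFun ht none
  have h2 : (p i₀).det = 0 := by
    by_contra h
    refine hi₀ (eq_top_iff.2 fun w _ ↦ ?_)
    have h3 : p i₀ = 1 := by
      have h4 := (Matrix.isUnit_iff_isUnit_det _).2 (Ne.isUnit h)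
      exact h4.mul_left_cancel ((hp i₀).trans (mul_one _).symm)
    rw [← Matrix.one_mulVec w, ← h3]
    exact hpm i₀ w
  rw [hnone, Finset.prod_eq_zero (Finset.mem_univ (⟨i₀, hi₀o⟩ : {i : I // i ≠ o})) (by simp [h2])]
    at h1
  exact Units.ne_zero _ h1

omit [Fintype I] [DecidableEq I] in
/-- Generation by the framing does not depend on the base field: a proper subspace over `k` which is
a subrepresentation spans a proper one over `L`, and the vectors over `k` in a subrepresentation
over `L` form a subrepresentation. -/
theorem isGenerated_map_iff {L : Type} [Field L] (φ : k →+* L) {x : Rep I n k} :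
    IsGenerated o (fun i j a ↦ (x i j a).map φ : Rep I n L) ↔ IsGenerated o x := by
  have hmul : ∀ i j (a : DArrow i j) (w : Fin (n i) → k),
      ((x i j a).map φ).mulVec (φ ∘ w) = φ ∘ (x i j a).mulVec w := fun i j a w ↦
    (funext fun r ↦ RingHom.map_mulVec φ _ _ r).symm
  have hsingle : ∀ i (s : Fin (n i)), φ ∘ (Pi.single s 1 : Fin (n i) → k) = Pi.single s 1 :=
    fun i s ↦ by
      ext r
      rw [Function.comp_apply, Pi.single_apply, Pi.single_apply]
      split_ifs <;> simp
  have htop : ∀ i (W : Submodule L (Fin (n i) → L)), (∀ s, Pi.single s 1 ∈ W) → W = ⊤ :=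
    fun i W h ↦ by
      rw [eq_top_iff, ← (Pi.basisFun L (Fin (n i))).span_eq, Submodule.span_le]
      rintro _ ⟨s, rfl⟩
      simpa using h s
  constructor
  · intro h W hW ho i
    let WL : ∀ i, Submodule L (Fin (n i) → L) := fun i ↦
      Submodule.span L ((fun w ↦ φ ∘ w) '' (W i : Set (Fin (n i) → k)))
    have h1 := h WL (fun i j a w hw ↦ ?_) (htop o _ fun s ↦ Submodule.subset_span
      ⟨Pi.single s 1, ho ▸ Submodule.mem_top, hsingle o s⟩) i
    · by_contra hne
      obtain ⟨g, hg, hgW⟩ := Submodule.exists_le_ker_of_lt_top _ (lt_top_iff_ne_top.2 hne)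
      let gL : (Fin (n i) → L) →ₗ[L] L := Fintype.linearCombination L fun s ↦ φ (g (Pi.single s 1))
      have h2 : ∀ w, gL (φ ∘ w) = φ (g w) := fun w ↦ by
        rw [LinearMap.pi_apply_eq_sum_univ g w, map_sum, Fintype.linearCombination_apply]
        refine Finset.sum_congr rfl fun s _ ↦ ?_
        rw [smul_eq_mul, smul_eq_mul, map_mul]
        congr 3
        ext r
        simp [Pi.single_apply, eq_comm]
      have h3 : WL i ≤ LinearMap.ker gL := by
        rw [Submodule.span_le]
        rintro _ ⟨w, hw, rfl⟩
        rw [SetLike.mem_coe, LinearMap.mem_ker]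
        exact (h2 w).trans ((congrArg φ (hgW hw)).trans (map_zero φ))
      rw [h1] at h3
      refine hg (LinearMap.ext fun w ↦ φ.injective ?_)
      rw [← h2, LinearMap.zero_apply, map_zero]
      exact h3 Submodule.mem_top
    · induction hw using Submodule.span_induction with
      | mem w hw =>
        obtain ⟨w, hw, rfl⟩ := hw
        exact Submodule.subset_span ⟨_, hW i j a w hw, (hmul i j a w).symm⟩
      | zero => rw [Matrix.mulVec_zero]; exact Submodule.zero_mem _
      | add w w' _ _ hw hw' => rw [Matrix.mulVec_add]; exact Submodule.add_mem _ hw hw'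
      | smul t w _ hw => rw [Matrix.mulVec_smul]; exact Submodule.smul_mem _ _ hw
  · intro h W hW ho i
    let WK : ∀ i, Submodule k (Fin (n i) → k) := fun i ↦
      { carrier := {w | φ ∘ w ∈ W i}
        add_mem' := fun {w w'} hw hw' ↦ by
          have h1 : φ ∘ (w + w') = φ ∘ w + φ ∘ w' := funext fun _ ↦ map_add φ _ _
          exact (congrArg (· ∈ W i) h1).mpr ((W i).add_mem hw hw')
        zero_mem' := by
          have h1 : φ ∘ (0 : Fin (n i) → k) = 0 := funext fun _ ↦ map_zero φ
          exact (congrArg (· ∈ W i) h1).mpr ((W i).zero_mem)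
        smul_mem' := fun t w hw ↦ by
          have h1 : φ ∘ (t • w) = φ t • φ ∘ w := funext fun _ ↦ map_mul φ _ _
          exact (congrArg (· ∈ W i) h1).mpr ((W i).smul_mem (φ t) hw) }
    have h1 := h WK (fun i j a w hw ↦ ?_) (eq_top_iff.2 fun w _ ↦ ?_) i
    · refine htop i _ fun s ↦ hsingle i s ▸ ?_
      have : (Pi.single s 1 : Fin (n i) → k) ∈ WK i := h1 ▸ Submodule.mem_top
      exact this
    · change φ ∘ _ ∈ W j
      rw [← hmul]
      exact hW i j a _ hw
    · change φ ∘ w ∈ W o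
      exact ho ▸ Submodule.mem_top

/-- The geometric point over a `k`-point of the representation space is stable for the character `∏
det` if and only if the `k`-point is generated by the framing. -/
theorem isThetaStable_map_iff {x : Rep I n k} :
    IsThetaStable o (fun _ ↦ 1)
      (fun i j a ↦ (x i j a).map (algebraMap k (AlgebraicClosure k)) :
        Rep I n (AlgebraicClosure k)) ↔
      IsGenerated o x := by
  have : Infinite (AlgebraicClosure k) := IsAlgClosed.instInfinite
  rw [← isGenerated_map_iff (algebraMap k (AlgebraicClosure k))]
  exact ⟨IsThetaStable.isGenerated, IsGenerated.isThetaStable⟩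

omit [Fintype I] [DecidableEq I] in
/-- Generation by the framing in terms of linear maps instead of matrices. -/
lemma isGenerated_toMatrix_iff {V : I → Type} [∀ i, AddCommGroup (V i)] [∀ i, Module k (V i)]
    (b : ∀ i, Module.Basis (Fin (n i)) k (V i)) (Φ : ∀ i j, DArrow i j → V i →ₗ[k] V j) :
    IsGenerated o (fun i j a ↦ LinearMap.toMatrix (b i) (b j) (Φ i j a) : Rep I n k) ↔
      ∀ W : ∀ i, Submodule k (V i), (∀ i j (a : DArrow i j), ∀ w ∈ W i, Φ i j a w ∈ W j) →
        W o = ⊤ → ∀ i, W i = ⊤ := by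
  have hΦ : ∀ i j (a : DArrow i j) v, (LinearMap.toMatrix (b i) (b j) (Φ i j a)).mulVec
      ((b i).equivFun v) = (b j).equivFun (Φ i j a v) := fun i j a v ↦
    LinearMap.toMatrix_mulVec_repr _ _ _ _
  constructor
  · intro h W hW ho i
    have h1 := h (fun i ↦ (W i).map (b i).equivFun.toLinearMap) (fun i j a ↦ ?_) ?_ i
    · exact (Submodule.map_injective_of_injective (b i).equivFun.injective)
        (h1.trans (by simp))
    · rintro _ ⟨w, hw, rfl⟩
      exact ⟨_, hW i j a w hw, (hΦ i j a w).symm⟩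
    · rw [ho, Submodule.map_top, LinearEquiv.range]
  · intro h W hW ho i
    have h1 := h (fun i ↦ (W i).comap (b i).equivFun.toLinearMap) (fun i j a w hw ↦ ?_) ?_ i
    · refine (Submodule.comap_injective_of_surjective (b i).equivFun.surjective) (h1.trans ?_)
      rw [Submodule.comap_top]
    · have := hW i j a _ hw
      rwa [LinearEquiv.coe_coe, hΦ] at this
    · rw [ho, Submodule.comap_top]

end GIT

/-! ### Free sheaves and their global frames -/

section Frames

variable {X : Scheme.{0}} {E : X.Modules} {ι : Type} [Fintype ι]

/-- A family of global sections is a frame if its germs form a basis of every stalk. -/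
def IsFrame (s : ι → Γ(E, ⊤)) : Prop :=
  ∀ x : X, Function.Bijective fun c : ι → X.presheaf.stalk x ↦
    ∑ i, c i • E.presheaf.germ ⊤ x (Opens.mem_top x) (s i)

/-- The section `1` of the structure sheaf. -/
def unitSection (X : Scheme.{0}) : Γ(structureSheaf X, ⊤) := (1 : Γ(X, ⊤))

lemma smul_unitSection_bijective (x : X) : Function.Bijective fun r : X.presheaf.stalk x ↦
    r • (structureSheaf X).presheaf.germ ⊤ x (Opens.mem_top x) (unitSection X) := by
  have hsec : ∀ (U : X.Opens) (r : Γ(X, U)),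
      r • (structureSheaf X).presheaf.map (homOfLE (le_top : U ≤ ⊤)).op (unitSection X) =
        (r : Γ(structureSheaf X, U)) := fun U r ↦ by
    have h1 : (structureSheaf X).presheaf.map (homOfLE (le_top : U ≤ ⊤)).op (unitSection X) =
        (1 : Γ(X, U)) := map_one (X.presheaf.map (homOfLE (le_top : U ≤ ⊤)).op).hom
    rw [h1]
    exact mul_one r
  have hgerm : ∀ (U : X.Opens) (hx : x ∈ U) (r : Γ(X, U)),
      X.presheaf.germ U x hx r •
          (structureSheaf X).presheaf.germ ⊤ x (Opens.mem_top x) (unitSection X) =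
        (structureSheaf X).presheaf.germ U x hx r := fun U hx r ↦ by
    rw [← germ_res _ (le_top : U ≤ ⊤) x hx, ← germ_smul, hsec]
  constructor
  · intro r r' h
    obtain ⟨U, hx, t, rfl⟩ := X.presheaf.exists_germ_eq r
    obtain ⟨U', hx', t', rfl⟩ := X.presheaf.exists_germ_eq r'
    dsimp only at h
    rw [hgerm, hgerm] at h
    obtain ⟨V, hV, i, i', h1⟩ := (structureSheaf X).presheaf.germ_eq x hx hx' _ _ h
    exact TopCat.Presheaf.germ_ext X.presheaf V hV i i' h1
  · intro e
    obtain ⟨U, hx, t, rfl⟩ := (structureSheaf X).presheaf.exists_germ_eq e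
    exact ⟨X.presheaf.germ U x hx t, hgerm U hx t⟩

/-- The homomorphism `𝒪_X ⟶ E` given by a global section of `E`. -/
def homOfSection (s : Γ(E, ⊤)) : structureSheaf X ⟶ E :=
  (SheafOfModules.unitHomEquiv E).symm (PresheafOfModules.sectionsMk
    (fun U ↦ E.presheaf.map (homOfLE le_top).op s) fun U V i ↦ by
      change E.presheaf.map i _ = _
      rw [← ConcreteCategory.comp_apply, ← Functor.map_comp]
      rfl)

lemma homOfSection_app (s : Γ(E, ⊤)) : (homOfSection s).app ⊤ (unitSection X) = s := by
  have h := congrArg (fun t : SheafOfModules.sections E ↦ t.val (op ⊤))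
    ((SheafOfModules.unitHomEquiv E).apply_symm_apply (PresheafOfModules.sectionsMk
    (fun U ↦ E.presheaf.map (homOfLE le_top).op s) fun U V i ↦ by
      change E.presheaf.map i _ = _
      rw [← ConcreteCategory.comp_apply, ← Functor.map_comp]
      rfl))
  refine h.trans ?_
  change E.presheaf.map (𝟙 _) s = s
  rw [CategoryTheory.Functor.map_id]
  rfl

lemma stalkMap_sum {E' : X.Modules} (s : Finset ι) (f : ι → (E ⟶ E')) (x : X)
    (e : E.presheaf.stalk x) : stalkMap (∑ i ∈ s, f i) x e = ∑ i ∈ s, stalkMap (f i) x e := by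
  obtain ⟨U, hx, t, rfl⟩ := E.presheaf.exists_germ_eq e
  have h1 : (∑ i ∈ s, f i).app U t = ∑ i ∈ s, (f i).app U t := by
    classical
    induction s using Finset.induction_on with
    | empty => simp
    | insert i s hi h => rw [Finset.sum_insert hi, Finset.sum_insert hi, ← h]; rfl
  simp only [stalkMap_germ, h1, map_sum]

/-- The inclusion of a summand of a free sheaf. -/
def freeι (X : Scheme.{0}) {r : ℕ} (i : Fin r) : structureSheaf X ⟶ freeSheaf X r :=
  SheafOfModules.ιFree (R := X.ringCatSheaf) i

lemma exists_freeι_comp {r : ℕ} (g : Fin r → (structureSheaf X ⟶ E)) :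
    ∃ h : freeSheaf X r ⟶ E, ∀ i, freeι X i ≫ h = g i :=
  ⟨Limits.Cofan.IsColimit.desc (SheafOfModules.isColimitFreeCofan (R := X.ringCatSheaf) (Fin r)) g,
    fun i ↦ Limits.Cofan.IsColimit.fac (SheafOfModules.isColimitFreeCofan (Fin r)) g i⟩

lemma freeSheaf_hom_ext {r : ℕ} {g h : freeSheaf X r ⟶ E}
    (H : ∀ i, freeι X i ≫ g = freeι X i ≫ h) : g = h :=
  Limits.Cofan.IsColimit.hom_ext (SheafOfModules.isColimitFreeCofan (R := X.ringCatSheaf) (Fin r))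
    _ _ H

open Classical in
lemma isFrame_free (r : ℕ) : IsFrame fun i : Fin r ↦ (freeι X i).app ⊤ (unitSection X) := by
  choose p hp using fun i : Fin r ↦
    exists_freeι_comp (E := structureSheaf X) fun i' ↦ if i' = i then 𝟙 _ else 0
  have hsum : ∑ i, p i ≫ freeι X i = 𝟙 (freeSheaf X r) := by
    refine freeSheaf_hom_ext fun i ↦ ?_
    rw [Preadditive.comp_sum, Category.comp_id]
    simp only [← Category.assoc, hp, ite_comp]
    simp
  intro x
  have hp' : ∀ i i' (e : (structureSheaf X).presheaf.stalk x),
      stalkMap (p i) x (stalkMap (freeι X i') x e) = if i' = i then e else 0 := fun i i' e ↦ by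
    rw [← stalkMap_comp, hp]
    split_ifs
    · exact stalkMap_id _ _ _
    · obtain ⟨U, hx, t, rfl⟩ := (structureSheaf X).presheaf.exists_germ_eq e
      rw [stalkMap_germ]
      simp
  have hcomp : ∀ c : Fin r → X.presheaf.stalk x, (∑ i, c i •
      (freeSheaf X r).presheaf.germ ⊤ x (Opens.mem_top x) ((freeι X i).app ⊤ (unitSection X))) =
      ∑ i, stalkMap (freeι X i) x
        (c i • (structureSheaf X).presheaf.germ ⊤ x (Opens.mem_top x) (unitSection X)) := fun c ↦
    Finset.sum_congr rfl fun i _ ↦ by rw [stalkMap_smul, stalkMap_germ]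
  constructor
  · intro c c' h
    dsimp only at h
    rw [hcomp, hcomp] at h
    funext i
    have h1 := congrArg (stalkMap (p i) x) h
    simp only [map_sum, hp', Finset.sum_ite_eq', Finset.mem_univ, if_true] at h1
    exact (smul_unitSection_bijective x).1 h1
  · intro e
    choose c hc using fun i ↦ (smul_unitSection_bijective x).2 (stalkMap (p i) x e)
    refine ⟨c, ?_⟩
    dsimp only at hc ⊢
    rw [hcomp]
    simp only [hc]
    simp only [← stalkMap_comp, ← stalkMap_sum, hsum]
    exact stalkMap_id _ _ _

lemma IsFrame.map {E' : X.Modules} {s : ι → Γ(E, ⊤)} (hs : IsFrame s) (e : E ⟶ E')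
    (he : ∀ x, Function.Bijective (stalkMap e x)) : IsFrame fun i ↦ e.app ⊤ (s i) := by
  intro x
  have h : (fun c : ι → X.presheaf.stalk x ↦
      ∑ i, c i • E'.presheaf.germ ⊤ x (Opens.mem_top x) (e.app ⊤ (s i))) =
      stalkMap e x ∘ fun c : ι → X.presheaf.stalk x ↦
        ∑ i, c i • E.presheaf.germ ⊤ x (Opens.mem_top x) (s i) := by
    funext c
    simp only [Function.comp_apply, map_sum, stalkMap_smul, stalkMap_germ]
  rw [h]
  exact (he x).comp (hs x)

lemma stalkMap_bijective_of_isIso {E' : X.Modules} (e : E ⟶ E') [IsIso e] (x : X) :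
    Function.Bijective (stalkMap e x) := by
  refine Function.bijective_iff_has_inverse.2 ⟨stalkMap (inv e) x, fun t ↦ ?_, fun t ↦ ?_⟩
  · rw [← stalkMap_comp, IsIso.hom_inv_id, stalkMap_id]
  · rw [← stalkMap_comp, IsIso.inv_hom_id, stalkMap_id]

lemma exists_frame_of_iso {r : ℕ} (e : E ≅ freeSheaf X r) :
    ∃ s : Fin r → Γ(E, ⊤), IsFrame s := by
  exact ⟨_, (isFrame_free (X := X) r).map e.inv (stalkMap_bijective_of_isIso _)⟩

/-- A sheaf with a global frame is free. -/
lemma IsFrame.nonempty_iso {r : ℕ} {s : Fin r → Γ(E, ⊤)} (hs : IsFrame s) :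
    Nonempty (E ≅ freeSheaf X r) := by
  obtain ⟨h, hh⟩ := exists_freeι_comp fun i ↦ homOfSection (s i)
  have : IsIso h := isIso_of_stalkMap_bijective fun x ↦ by
    have h1 := isFrame_free (X := X) r x
    refine (Function.Bijective.of_comp_iff _ h1).1 ?_
    convert! hs x using 1
    funext c
    simp only [Function.comp_apply, map_sum, stalkMap_smul, stalkMap_germ]
    refine Finset.sum_congr rfl fun i _ ↦ ?_
    rw [← homOfSection_app (s i), ← hh i]
    rfl
  exact ⟨(asIso h).symm⟩

variable [IsIntegral X]

lemma IsFrame.toGeneric_injective {s : ι → Γ(E, ⊤)} (hs : IsFrame s) (x : X) :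
    Function.Injective (toGeneric E x) := by
  rw [injective_iff_map_eq_zero]
  intro e he
  obtain ⟨c, rfl⟩ := (hs x).2 e
  simp only [map_sum, toGeneric_smul, toGeneric_germ] at he
  have h1 : (fun i ↦ algebraMap (X.presheaf.stalk x) X.functionField (c i)) = 0 :=
    (hs (genericPoint X)).1 (he.trans (by simp))
  have h2 : c = 0 := funext fun i ↦
    (map_eq_zero_iff _ (IsFractionRing.injective _ X.functionField)).1 (congrFun h1 i)
  simp [h2]

/-- The basis of the generic stalk given by a frame. -/
def IsFrame.genericBasis {s : ι → Γ(E, ⊤)} (hs : IsFrame s) :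
    Module.Basis ι X.functionField (genericStalk E) :=
  .ofEquivFun (LinearEquiv.ofBijective (Fintype.linearCombination X.functionField fun i ↦
    (E.presheaf.germ ⊤ (genericPoint X) (Opens.mem_top _) (s i) : genericStalk E))
      (hs (genericPoint X))).symm

lemma IsFrame.genericBasis_apply {s : ι → Γ(E, ⊤)} (hs : IsFrame s) (i : ι) :
    hs.genericBasis i = E.presheaf.germ ⊤ (genericPoint X) (Opens.mem_top _) (s i) := by
  classical
  simp only [genericBasis, Module.Basis.coe_ofEquivFun, LinearEquiv.symm_symm]
  exact (Fintype.linearCombination_apply_single _ _ _ _).trans (one_smul _ _)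

lemma IsFrame.rank_eq {s : ι → Γ(E, ⊤)} (hs : IsFrame s) : rank E = Fintype.card ι :=
  Module.finrank_eq_card_basis hs.genericBasis

/-- The subsheaf `genericSub E ⊥` is the torsion of `E`. -/
lemma genericSub_bot_isZero (h : ∀ x, Function.Injective (toGeneric E x)) :
    Limits.IsZero (genericSub E ⊥) := by
  refine isZero_of_stalk fun x e ↦ genericSubι_stalk_injective x (h x ?_)
  have h1 := (range_stalkMap_genericSubι (W := ⊥) x _).1 ⟨e, rfl⟩
  rw [map_zero, map_zero]
  exact (Submodule.mem_bot _).1 h1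

lemma isIso_genericSubι_top : IsIso (genericSubι E ⊤) :=
  isIso_of_stalkMap_bijective fun x ↦ ⟨genericSubι_stalk_injective x, fun e ↦
    (range_stalkMap_genericSubι x e).2 Submodule.mem_top⟩

lemma nonempty_iso_freeSheaf_zero (h : Limits.IsZero E) : Nonempty (E ≅ freeSheaf X 0) :=
  IsFrame.nonempty_iso (s := Fin.elim0) fun x ↦ by
    have h0 : ∀ e : E.presheaf.stalk x, e = 0 := fun e ↦ by
      rw [← stalkMap_id E x e, h.eq_of_src (𝟙 E) 0]
      obtain ⟨U, hx, t, rfl⟩ := E.presheaf.exists_germ_eq e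
      rw [stalkMap_germ]
      simp
    exact ⟨fun _ _ _ ↦ Subsingleton.elim _ _, fun e ↦ ⟨0, by simp [h0 e]⟩⟩

/-- The kernel of a homomorphism from a free sheaf to the structure sheaf is free if the global
functions form a field: the homomorphism is given by constants, and elimination yields a frame. -/
lemma exists_iso_genericSub_ker (hX : IsField Γ(X, ⊤)) {r : ℕ} (e : E ≅ freeSheaf X r)
    (g : E ⟶ structureSheaf X) :
    ∃ r', Nonempty (genericSub E (LinearMap.ker (genericMap g)) ≅ freeSheaf X r') := by
  obtain ⟨s, hs⟩ := exists_frame_of_iso e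
  let c : Fin r → Γ(X, ⊤) := fun i ↦ g.app ⊤ (s i)
  have hc : ∀ i, g.app ⊤ (s i) = c i • unitSection X := fun i ↦ (mul_one (c i)).symm
  set W := LinearMap.ker (genericMap g) with hW
  have hgerm : ∀ (x : X) (a : Fin r → X.presheaf.stalk x),
      stalkMap g x (∑ i, a i • E.presheaf.germ ⊤ x (Opens.mem_top x) (s i)) =
        (∑ i, a i * X.presheaf.germ ⊤ x (Opens.mem_top x) (c i)) •
          (structureSheaf X).presheaf.germ ⊤ x (Opens.mem_top x) (unitSection X) := fun x a ↦ by
    simp only [map_sum, stalkMap_smul, stalkMap_germ, hc, germ_smul, Finset.sum_smul, mul_smul]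
  have hmem : ∀ (x : X) (t : E.presheaf.stalk x), toGeneric E x t ∈ W ↔ stalkMap g x t = 0 :=
    fun x t ↦ by
      rw [LinearMap.mem_ker]
      change stalkMap g (genericPoint X) _ = 0 ↔ _
      have htf : Function.Injective (toGeneric (structureSheaf X) x) :=
        IsFrame.toGeneric_injective (ι := Unit) (s := fun _ ↦ unitSection X) (fun y ↦ by
          have := (smul_unitSection_bijective y).comp (Equiv.funUnique Unit _).bijective
          simpa [Function.comp_def] using this) x
      rw [← toGeneric_stalkMap, map_eq_zero_iff _ htf]
  by_cases h0 : ∀ i, c i = 0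
  · have h1 : W = ⊤ := by
      refine eq_top_iff.2 fun t _ ↦ ?_
      rw [← toGeneric_genericPoint E t, hmem]
      obtain ⟨a, rfl⟩ := (hs _).2 t
      dsimp only
      rw [hgerm]
      simp [h0]
    rw [h1]
    have := isIso_genericSubι_top (E := E)
    exact ⟨r, ⟨asIso (genericSubι E ⊤) ≪≫ e⟩⟩
  push Not at h0
  obtain ⟨i₀, hi₀⟩ := h0
  obtain ⟨u, hu⟩ := hX.mul_inv_cancel hi₀
  obtain _ | r := r
  · exact i₀.elim0
  -- As `c i₀` is invertible, the kernel has a frame obtained from the other members of `s`.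
  let t : Fin r → Γ(E, ⊤) := fun i ↦ s (i₀.succAbove i) - (c (i₀.succAbove i) * u) • s i₀
  have ht : ∀ i, t i ∈ genericSections E W ⊤ := fun i x hx ↦ by
    rw [hmem, stalkMap_germ]
    have : g.app ⊤ (t i) = 0 := by
      simp only [t, map_sub, Scheme.Modules.Hom.app_smul, hc, smul_smul]
      rw [mul_assoc, mul_comm u, hu, mul_one, sub_self]
    rw [this, map_zero]
  choose t' ht' using fun i ↦ exists_genericSubι_app_eq (ht i)
  refine ⟨r, IsFrame.nonempty_iso (s := t') fun x ↦ ?_⟩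
  let γ : Γ(X, ⊤) → X.presheaf.stalk x := X.presheaf.germ ⊤ x (Opens.mem_top x)
  have key : ∀ a : Fin r → X.presheaf.stalk x, stalkMap (genericSubι E W) x
      (∑ i, a i • (genericSub E W).presheaf.germ ⊤ x (Opens.mem_top x) (t' i)) =
      ∑ i, (i₀.insertNth (-∑ i, a i * γ (c (i₀.succAbove i) * u)) a : Fin (r + 1) → _) i •
        E.presheaf.germ ⊤ x (Opens.mem_top x) (s i) := fun a ↦ by
    rw [Fin.sum_univ_succAbove _ i₀]
    simp only [map_sum, stalkMap_smul, stalkMap_germ, ht', Fin.insertNth_apply_same,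
      Fin.insertNth_apply_succAbove, t, map_sub, germ_smul, smul_sub, Finset.sum_sub_distrib,
      neg_smul, Finset.sum_smul, smul_smul, γ]
    abel
  constructor
  · intro a a' h
    have h1 := congrArg (stalkMap (genericSubι E W) x) h
    dsimp only at h1
    rw [key, key] at h1
    have h2 := (hs x).1 h1
    funext i
    simpa using congrFun h2 (i₀.succAbove i)
  · intro e
    obtain ⟨a, ha⟩ := (hs x).2 (stalkMap (genericSubι E W) x e)
    refine ⟨fun i ↦ a (i₀.succAbove i), genericSubι_stalk_injective x ?_⟩
    dsimp only at ha ⊢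
    rw [key, ← ha]
    have h1 := (hmem x _).1 ((range_stalkMap_genericSubι x _).1 ⟨e, rfl⟩)
    rw [← ha, hgerm] at h1
    have h2 : ∑ i, a i * γ (c i) = 0 :=
      (smul_unitSection_bijective x).1 (h1.trans (zero_smul _ _).symm)
    rw [Fin.sum_univ_succAbove _ i₀] at h2
    have h3 : a i₀ = -∑ i, a (i₀.succAbove i) * γ (c (i₀.succAbove i) * u) := by
      have h4 : γ (c i₀) * γ u = 1 := by rw [← map_mul, hu, map_one]
      have h5 := congrArg (· * γ u) h2
      simp only [add_mul, mul_assoc, h4, mul_one, zero_mul, Finset.sum_mul] at h5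
      rw [eq_neg_iff_add_eq_zero, ← h5]
      simp [γ]
    refine Finset.sum_congr rfl fun i _ ↦ ?_
    congr 1
    rw [← h3]
    exact congrFun (Fin.insertNth_self_removeNth i₀ a) i

end Frames

/-! ### Generic subrepresentations and subobjects of quiver sheaves -/

section Subobjects

variable {X : Scheme.{0}} [IsIntegral X] {f : X ⟶ Spec (.of ℂ)} {I : Type} [Quiver.{0} I]
  [Fintype I] [∀ i j : I, Fintype (i ⟶ j)] {T : Twist f I} {o : I}

namespace QuiverSheaf

/-- The map of generic stalks `e ↦ φ_a (m ⊗ e)` given by a germ `m` of `M_a`. -/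
def genericAct (F : QuiverSheaf T o) {i j : I} (a : DArrow i j) (m : genericStalk (T.M a)) :
    genericStalk (F.E i) →ₗ[X.functionField] genericStalk (F.E j) :=
  genericMap (F.φ a) ∘ₗ stalkTmulₗ (T.M a) (F.E i) (genericPoint X) m

lemma genericAct_apply (F : QuiverSheaf T o) {i j : I} (a : DArrow i j) (m : genericStalk (T.M a))
    (e : genericStalk (F.E i)) :
    F.genericAct a m e = stalkMap (F.φ a) (genericPoint X) (stalkTmul m e) := rfl

lemma genericMap_genericAct {F' F : QuiverSheaf T o} (ι : F' ⟶ F) {i j : I} (a : DArrow i j)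
    (m : genericStalk (T.M a)) (e : genericStalk (F'.E i)) :
    genericMap (ι.app j) (F'.genericAct a m e) = F.genericAct a m (genericMap (ι.app i) e) := by
  have h := congrArg (fun g ↦ stalkMap g (genericPoint X) (stalkTmul m e)) (ι.comm a)
  simp only [stalkMap_comp, stalkMap_tensorMap] at h
  exact h

/-- Subrepresentations of the representation of the doubled quiver on the generic stalks. -/
def IsSubrep (F : QuiverSheaf T o)
    (W : ∀ i, Submodule X.functionField (genericStalk (F.E i))) : Prop :=
  ∀ i j (a : DArrow i j) (m : genericStalk (T.M a)), ∀ w ∈ W i, F.genericAct a m w ∈ W j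

section Sub

variable [IsLocallyNoetherian X] (F : QuiverSheaf T o)
  {W : ∀ i, Submodule X.functionField (genericStalk (F.E i))} (hW : F.IsSubrep W)
  (ho : ∃ r, Nonempty (genericSub (F.E o) (W o) ≅ freeSheaf X r))

include hW in
/-- The maps `φ_a` restrict to the sections which generically lie in a subrepresentation. -/
lemma exists_sub_map {i j : I} (a : DArrow i j) :
    ∃ g : tensor (T.M a) (genericSub (F.E i) (W i)) ⟶ genericSub (F.E j) (W j),
      g ≫ genericSubι (F.E j) (W j) =
        tensorMap (T.M a) (genericSubι (F.E i) (W i)) ≫ F.φ a := by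
  refine exists_genericSub_lift _ fun e ↦ ?_
  refine stalk_tensor_induction (p := fun e ↦ stalkMap
    (tensorMap (T.M a) (genericSubι (F.E i) (W i)) ≫ F.φ a) (genericPoint X) e ∈ W j)
    (by rw [map_zero]; exact Submodule.zero_mem _)
    (fun s t hs ht ↦ by rw [map_add]; exact Submodule.add_mem _ hs ht) (fun m t ↦ ?_) e
  dsimp only
  rw [stalkMap_comp, stalkMap_tensorMap]
  refine hW i j a m _ ?_
  rw [← toGeneric_genericPoint (F.E i) (stalkMap _ _ t)]
  exact (range_stalkMap_genericSubι (genericPoint X) _).1 ⟨t, rfl⟩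

/-- The quiver sheaf of all local sections which generically lie in a subrepresentation. -/
def sub : QuiverSheaf T o where
  E i := genericSub (F.E i) (W i)
  coherent i := isCoherent_genericSub _ (F.coherent i) _
  φ a := (F.exists_sub_map hW a).choose
  moment i hi U κ e m m' hκ := by
    refine genericSubι_injective U ?_
    have hφ : ∀ {i j : I} (a : DArrow i j) (m : Γ(T.M a, U)) (e : Γ(genericSub (F.E i) (W i), U)),
        (genericSubι (F.E j) (W j)).app U ((F.exists_sub_map hW a).choose.app U (tmul m e)) =
          (F.φ a).app U (tmul m ((genericSubι (F.E i) (W i)).app U e)) := fun {i j} a m e ↦ by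
      have h := congrArg (fun g ↦ g.app U (tmul m e)) (F.exists_sub_map hW a).choose_spec
      refine h.trans ?_
      rw [← tensorMap_tmul]
      rfl
    rw [map_sum, map_zero, ← F.moment i hi U κ ((genericSubι (F.E i) (W i)).app U e) m m' hκ]
    refine Finset.sum_congr rfl fun j _ ↦ ?_
    rw [map_sum]
    refine Finset.sum_congr rfl fun a _ ↦ ?_
    rw [map_zsmul, hφ, hφ]
  framed := ho

/-- The inclusion of the subobject attached to a subrepresentation. -/
def subι : F.sub hW ho ⟶ F where
  app i := genericSubι (F.E i) (W i)
  comm a := (F.exists_sub_map hW a).choose_spec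

end Sub

lemma comp_app {F G H : QuiverSheaf T o} (g : F ⟶ G) (h : G ⟶ H) (i : I) :
    (g ≫ h).app i = g.app i ≫ h.app i := rfl

lemma mono_of_app {F G : QuiverSheaf T o} (g : F ⟶ G) (h : ∀ i, Mono (g.app i)) : Mono g :=
  ⟨fun u v huv ↦ Hom.ext (funext fun i ↦ by
    have := h i
    rw [← cancel_mono (g.app i)]
    exact congrArg (fun w : _ ⟶ G ↦ w.app i) huv)⟩

lemma isIso_of_app {F G : QuiverSheaf T o} (g : F ⟶ G) (h : ∀ i, IsIso (g.app i)) : IsIso g := by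
  refine ⟨⟨fun i ↦ inv (g.app i), fun {i j} a ↦ ?_⟩, Hom.ext (funext fun i ↦ ?_),
    Hom.ext (funext fun i ↦ ?_)⟩
  · rw [IsIso.comp_inv_eq, Category.assoc, g.comm, ← Category.assoc, ← tensorMap_comp,
      IsIso.inv_hom_id, tensorMap_id, Category.id_comp]
  · exact IsIso.hom_inv_id _
  · exact IsIso.inv_hom_id _

lemma isIso_app {F G : QuiverSheaf T o} (g : F ⟶ G) [IsIso g] (i : I) : IsIso (g.app i) :=
  ⟨(inv g).app i, congrArg (fun w : F ⟶ F ↦ w.app i) (IsIso.hom_inv_id g),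
    congrArg (fun w : G ⟶ G ↦ w.app i) (IsIso.inv_hom_id g)⟩

lemma stalkMap_zero {E E' : X.Modules} (x : X) (e : E.presheaf.stalk x) :
    stalkMap (0 : E ⟶ E') x e = 0 := by
  obtain ⟨U, hx, t, rfl⟩ := E.presheaf.exists_germ_eq e
  rw [stalkMap_germ, Scheme.Modules.Hom.zero_app]
  exact map_zero _

lemma tensorMap_zero (M E E' : X.Modules) : tensorMap M (0 : E ⟶ E') = 0 :=
  tensor_hom_ext fun x m e ↦ by
    rw [stalkMap_tensorMap, stalkMap_zero, stalkMap_zero]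
    exact map_zero (stalkTmulₗ M E' x m)

/-- The zero morphism. -/
def zeroHom (F G : QuiverSheaf T o) : F ⟶ G where
  app i := 0
  comm a := by rw [tensorMap_zero, Limits.comp_zero, Limits.zero_comp]

lemma isZero_iff {F : QuiverSheaf T o} : Limits.IsZero F ↔ ∀ i, Limits.IsZero (F.E i) := by
  refine ⟨fun h i ↦ ?_, fun h ↦ ⟨fun G ↦ ⟨⟨⟨F.zeroHom G⟩, fun g ↦ ?_⟩⟩,
    fun G ↦ ⟨⟨⟨G.zeroHom F⟩, fun g ↦ ?_⟩⟩⟩⟩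
  · exact (Limits.IsZero.iff_id_eq_zero _).2
      (congrArg (fun w : F ⟶ F ↦ w.app i) (h.eq_of_src (𝟙 F) (F.zeroHom F)))
  · exact Hom.ext (funext fun i ↦ (h i).eq_of_src _ _)
  · exact Hom.ext (funext fun i ↦ (h i).eq_of_tgt _ _)

/-- Subobjects of a quiver sheaf with torsion-free components and framing of rank one are given by
injective homomorphisms: the generic kernel defines a subobject of the source, as its framing is a
free sheaf. -/
theorem stalkMap_injective_of_mono [IsLocallyNoetherian X] (hX : IsField Γ(X, ⊤))
    {F' F : QuiverSheaf T o} (ι : F' ⟶ F) [Mono ι]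
    (htf : ∀ i x, Function.Injective (toGeneric (F.E i) x)) (hr : rank (F.E o) = 1)
    (i : I) (x : X) : Function.Injective (stalkMap (ι.app i) x) := by
  let W : ∀ i, Submodule X.functionField (genericStalk (F'.E i)) :=
    fun i ↦ LinearMap.ker (genericMap (ι.app i))
  have hW : F'.IsSubrep W := fun i j a m w hw ↦ by
    rw [LinearMap.mem_ker, genericMap_genericAct, LinearMap.mem_ker.1 hw, map_zero]
  obtain ⟨r', ⟨e'⟩⟩ := F'.framed
  obtain ⟨r, ⟨e⟩⟩ := F.framed
  have hr1 : r = 1 := by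
    obtain ⟨s, hs⟩ := exists_frame_of_iso e
    rw [← hr, hs.rank_eq, Fintype.card_fin]
  subst hr1
  -- The framing of the target is the structure sheaf.
  obtain ⟨p, hp⟩ : ∃ p : F.E o ⟶ structureSheaf X, ∀ x, Function.Injective (stalkMap p x) := by
    obtain ⟨h, hh⟩ := exists_freeι_comp (r := 1) fun _ ↦ 𝟙 (structureSheaf X)
    have h1 : h ≫ freeι X 0 = 𝟙 _ := freeSheaf_hom_ext fun i ↦ by
      rw [Subsingleton.elim i 0, ← Category.assoc, hh, Category.id_comp, Category.comp_id]
    refine ⟨e.hom ≫ h, fun x s t hst ↦ ?_⟩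
    have h2 := congrArg (stalkMap (freeι X 0 ≫ e.inv) x) hst
    rw [← stalkMap_comp, ← stalkMap_comp, Category.assoc, ← Category.assoc h, h1, Category.id_comp,
      Iso.hom_inv_id, stalkMap_id, stalkMap_id] at h2
    exact h2
  have hker : W o = LinearMap.ker (genericMap (ι.app o ≫ p)) := by
    ext t
    simp only [W, LinearMap.mem_ker]
    refine ⟨fun h ↦ ?_, fun h ↦ hp _ ?_⟩
    · exact (stalkMap_comp _ _ _ _).trans ((congrArg _ h).trans (map_zero _))
    · exact (stalkMap_comp _ _ _ _).symm.trans (h.trans (map_zero _).symm)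
  have ho : ∃ r, Nonempty (genericSub (F'.E o) (W o) ≅ freeSheaf X r) :=
    hker ▸ exists_iso_genericSub_ker hX e' (ι.app o ≫ p)
  have hzero : F'.subι hW ho ≫ ι = zeroHom _ _ := Hom.ext (funext fun i ↦ by
    refine hom_ext_stalk fun x t ↦ htf i x ?_
    rw [comp_app, stalkMap_comp, toGeneric_stalkMap]
    have h1 : toGeneric (F'.E i) x (stalkMap ((F'.subι hW ho).app i) x t) ∈ W i :=
      (range_stalkMap_genericSubι x _).1 ⟨t, rfl⟩
    refine (LinearMap.mem_ker.1 h1).trans ?_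
    rw [show (zeroHom (F'.sub hW ho) F).app i = 0 from rfl, stalkMap_zero, map_zero])
  have hsub : F'.subι hW ho = zeroHom _ _ := by
    rw [← cancel_mono ι, hzero]
    exact Hom.ext (funext fun i ↦ Limits.zero_comp.symm)
  rw [injective_iff_map_eq_zero]
  intro t ht
  have h1 : toGeneric (F'.E i) x t ∈ W i := by
    rw [LinearMap.mem_ker]
    refine (toGeneric_stalkMap (ι.app i) x t).symm.trans ?_
    rw [ht, map_zero]
  obtain ⟨t', rfl⟩ := (range_stalkMap_genericSubι x _).2 h1
  have h2 : genericSubι (F'.E i) (W i) = 0 := congrArg (fun w : F'.sub hW ho ⟶ F' ↦ w.app i) hsub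
  rw [h2, stalkMap_zero]

end QuiverSheaf

end Subobjects

/-! ### Generation by the framing and bounds for degrees -/

section Generation

attribute [local instance] genericModule

variable {X : Scheme.{0}} [IsIntegral X]

section Poles

variable [hdvr : ∀ x : {x : X // IsClosed {x}}, IsDiscreteValuationRing (X.presheaf.stalk x.1)]

lemma smul_mem_stalkLattice_of_le {M : X.Modules} {x : {x : X // IsClosed {x}}} {m : genericStalk M}
    {r α : X.functionField} (hr : r ≠ 0) (hm : r • m ∈ stalkLattice M x.1) (hα : α ≠ 0)
    (h : ordZ (X.presheaf.stalk x.1) r ≤ ordZ (X.presheaf.stalk x.1) α) :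
    α • m ∈ stalkLattice M x.1 := by
  obtain ⟨u, hu⟩ := exists_algebraMap_eq_of_ordZ_nonneg (X.presheaf.stalk x.1) (f := α * r⁻¹) (by
    rw [ordZ_mul _ hα (inv_ne_zero hr), ordZ_inv]
    lia)
  have h1 : α • m = u • (r • m) := by
    change _ = algebraMap (X.presheaf.stalk x.1) X.functionField u • (r • m)
    rw [hu, smul_smul, inv_mul_cancel_right₀ hr]
  rw [h1]
  exact Submodule.smul_mem _ _ hm

/-- A rational section of a locally free sheaf has poles of bounded order, and only at finitely
many points. -/
lemma exists_pole_bound (f : X ⟶ Spec (.of ℂ)) [SmoothOfRelativeDimension 1 f] [IsProper f]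
    {M : X.Modules} (hM : IsLocallyFree M) (m : genericStalk M) :
    ∃ c : {x : X // IsClosed {x}} → ℕ, (Function.support c).Finite ∧
      ∀ x (α : X.functionField), α ≠ 0 → (c x : ℤ) ≤ ordZ (X.presheaf.stalk x.1) α →
        α • m ∈ stalkLattice M x.1 := by
  classical
  have hloc : ∀ x : X, ∃ (U : X.Opens) (_ : x ∈ U) (g : Γ(X, U)), genericPoint X ∈ X.basicOpen g ∧
      ∀ (y : X) (hy : y ∈ U), algebraMap (X.presheaf.stalk y) X.functionField
        (X.presheaf.germ U y hy g) • m ∈ stalkLattice M y := fun x ↦ by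
    obtain ⟨_, ⟨U, hU, rfl⟩, hx, -⟩ := X.isBasis_affineOpens.exists_subset_of_mem_open
      (Set.mem_univ x) isOpen_univ
    obtain ⟨g, t, hg, h⟩ := exists_smul_germ_eq hU (hM.localizesOn hU) (genericPoint_mem hx) m
    refine ⟨U, hx, g, hg, fun y hy ↦ ⟨M.presheaf.germ U y hy t, ?_⟩⟩
    refine (toGeneric_germ M y hy t).trans ?_
    rw [← h]
    congr 1
    exact (ConcreteCategory.congr_hom (X.presheaf.germ_stalkSpecializes (U := U) hy
      ((genericPoint_spec X).specializes trivial)) g).symm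
  have hne : ∀ (U : X.Opens) (g : Γ(X, U)) (_ : genericPoint X ∈ X.basicOpen g) (x : X)
      (hx : x ∈ U), X.presheaf.germ U x hx g ≠ 0 := fun U g hg x hx h0 ↦ by
    obtain ⟨V, hV, i, i', h⟩ := TopCat.Presheaf.germ_eq X.presheaf x hx hx g 0
      (by rw [h0, map_zero])
    have h1 := (isUnit_germ_of_mem_basicOpen (X.basicOpen_le g hg) hg).ne_zero
    refine h1 ?_
    rw [← germ_res_ring i.le (genericPoint X) (genericPoint_mem hV)]
    change X.presheaf.germ V _ _ (X.presheaf.map i.op g) = 0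
    rw [h, map_zero, map_zero]
  choose U hU g hg hmem using hloc
  let η := genericPoint X
  let B : X.Opens := X.basicOpen (g η)
  refine ⟨fun x ↦ if x.1 ∈ B then 0 else
    (ordZ (X.presheaf.stalk x.1) (algebraMap (X.presheaf.stalk x.1) X.functionField
      (X.presheaf.germ (U x.1) x.1 (hU x.1) (g x.1)))).toNat, ?_, fun x α hα h ↦ ?_⟩
  · refine (finite_notMem f (hg η)).subset fun x hx hxB ↦ hx ?_
    exact if_pos hxB
  · dsimp only at h
    split_ifs at h with hxB
    · have hxU : x.1 ∈ U η := X.basicOpen_le _ hxB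
      have h1 := hne _ _ (hg η) _ hxU
      refine smul_mem_stalkLattice_of_le
        ((map_ne_zero_iff _ (IsFractionRing.injective _ _)).2 h1) (hmem η x.1 hxU) hα ?_
      rwa [ordZ_unit _ (isUnit_germ_of_mem_basicOpen hxU hxB)]
    · have h1 := hne _ _ (hg x.1) _ (hU x.1)
      refine smul_mem_stalkLattice_of_le
        ((map_ne_zero_iff _ (IsFractionRing.injective _ _)).2 h1) (hmem x.1 x.1 (hU x.1)) hα ?_
      exact (Int.self_le_toNat _).trans h

lemma IsFrame.mem_stalkLattice {E : X.Modules} {ι : Type} [Fintype ι] {s : ι → Γ(E, ⊤)}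
    (hs : IsFrame s) (i : ι) (x : X) : hs.genericBasis i ∈ stalkLattice E x :=
  ⟨E.presheaf.germ ⊤ x (Opens.mem_top x) (s i),
    (toGeneric_germ E x _ _).trans (hs.genericBasis_apply i).symm⟩

open Classical in
/-- If the rational sections of `E` with small poles span the generic stalk, then the degree of a
torsion-free subsheaf of `E` is bounded: a basis of its generic stalk is completed to one of the
generic stalk of `E` by such rational sections. -/
lemma degree_le_of_span_eq_top (f : X ⟶ Spec (.of ℂ)) [SmoothOfRelativeDimension 1 f] [IsProper f]
    {E' E : X.Modules} (hE' : IsCoherent E') (hE : IsCoherent E)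
    (htf : ∀ x, Function.Injective (toGeneric E' x)) (g : E' ⟶ E)
    (hg : Function.Injective (genericMap g)) {P : Set (genericStalk E)}
    (hP : Submodule.span X.functionField P = ⊤) (n : {x : X // IsClosed {x}} → ℕ)
    (hn : (Function.support n).Finite)
    (hpole : ∀ w ∈ P, ∀ x (a : X.functionField), a ≠ 0 → (n x : ℤ) ≤ ordZ (X.presheaf.stalk x.1) a →
      a • w ∈ stalkLattice E x.1) :
    degree E' ≤ degree E + rank E * (∑ᶠ x, n x : ℕ) := by
  have hfin : Module.Finite X.functionField (genericStalk E) := hE.finite_stalk _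
  have hfin' : Module.Finite X.functionField (genericStalk E') := hE'.finite_stalk _
  let b' := Module.finBasis X.functionField (genericStalk E')
  have hli : LinearIndependent X.functionField (genericMap g ∘ b') :=
    b'.linearIndependent.map' _ (LinearMap.ker_eq_bot.2 hg)
  let S := Set.range (genericMap g ∘ b')
  have hS : LinearIndepOn X.functionField id S := hli.linearIndepOn_id
  let B := hS.extend (Set.subset_union_left (t := P))
  have hSB : S ⊆ B := hS.subset_extend _
  have hBP : B ⊆ S ∪ P := hS.extend_subset _
  have hBspan : ⊤ ≤ Submodule.span X.functionField (Set.range ((↑) : B → genericStalk E)) := by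
    rw [Subtype.range_coe, hS.span_extend_eq_span, ← hP]
    exact Submodule.span_mono Set.subset_union_right
  let bB : Module.Basis B X.functionField (genericStalk E) :=
    .mk (hS.linearIndepOn_extend _) hBspan
  have hB : Finite B := Module.Finite.finite_basis bB
  let q := (B \ S : Set (genericStalk E))
  have : Finite q := (Set.toFinite B).subset Set.sdiff_subset
  have : Fintype q := Fintype.ofFinite q
  let e : Fin (Module.finrank X.functionField (genericStalk E')) ⊕ q ≃ B :=
    ((Equiv.ofInjective _ hli.injective).sumCongr (Equiv.refl q)).trans
      (Equiv.Set.sumDiffSubset hSB)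
  let b := bB.reindex e.symm
  have hbB : ∀ y : B, bB y = y.1 := Module.Basis.mk_apply _ _
  have hcard : Fintype.card q ≤ rank E := by
    rw [rank, Module.finrank_eq_card_basis b, Fintype.card_sum]
    exact Nat.le_add_left _ _
  refine (degree_le_degree_add f hE' hE (fun x ↦ (Submodule.eq_bot_iff _).2 fun t ht ↦
    htf x.1 (ht.trans (map_zero _).symm)) g b' b (fun i ↦ ?_) n hn fun x i a ha h ↦ ?_).trans ?_
  · rw [Module.Basis.reindex_apply, Equiv.symm_symm, hbB]
    exact congrArg Subtype.val (Equiv.Set.sumDiffSubset_apply_inl hSB _)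
  · have h1 : b (.inr i) = i.1 := by
      rw [Module.Basis.reindex_apply, Equiv.symm_symm, hbB]
      exact congrArg Subtype.val (Equiv.Set.sumDiffSubset_apply_inr hSB _)
    rw [h1]
    exact hpole _ ((hBP i.2.1).resolve_left i.2.2) x a ha h
  · gcongr

end Poles

variable {f : X ⟶ Spec (.of ℂ)} {I : Type} [Quiver.{0} I]
  [Fintype I] [∀ i j : I, Fintype (i ⟶ j)] {T : Twist f I} {o : I}

namespace QuiverSheaf

/-- The representation of the doubled quiver on the generic stalks is generated by the framing. -/
def IsGenericallyGenerated (F : QuiverSheaf T o) : Prop :=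
  ∀ W, F.IsSubrep W → W o = ⊤ → ∀ i, W i = ⊤

/-- As the `M_a` are line bundles, it suffices to consider one nonzero germ of each of them. -/
lemma isSubrep_iff (F : QuiverSheaf T o) {m : ∀ (i j : I) (a : DArrow i j), genericStalk (T.M a)}
    (hm : ∀ i j a, m i j a ≠ 0) (W : ∀ i, Submodule X.functionField (genericStalk (F.E i))) :
    F.IsSubrep W ↔ ∀ i j (a : DArrow i j), ∀ w ∈ W i, F.genericAct a (m i j a) w ∈ W j := by
  refine ⟨fun h i j a ↦ h i j a _, fun h i j a m' w hw ↦ ?_⟩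
  obtain ⟨c, rfl⟩ := exists_smul_eq_of_finrank_eq_one (T.isLineBundle a).2 (hm i j a) m'
  have h1 : F.genericAct a (c • m i j a) w = c • F.genericAct a (m i j a) w := by
    simp only [genericAct, map_smul, LinearMap.comp_smul, LinearMap.smul_apply]
  rw [h1]
  exact Submodule.smul_mem _ _ (h i j a w hw)

omit [Fintype I] [∀ i j : I, Fintype (i ⟶ j)] in
lemma exists_twist_ne_zero (T : Twist f I) :
    ∃ m : ∀ (i j : I) (a : DArrow i j), genericStalk (T.M a), ∀ i j a, m i j a ≠ 0 := by
  have hm : ∀ i j (a : DArrow i j), ∃ m : genericStalk (T.M a), m ≠ 0 := fun i j a ↦ by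
    have : Nontrivial (genericStalk (T.M a)) :=
      Module.nontrivial_of_finrank_pos (R := X.functionField) (T.isLineBundle a).2.ge
    exact exists_ne 0
  choose m hm using hm
  exact ⟨m, hm⟩

/-- A quiver sheaf is a stable quasimap if and only if it is locally free and generically generated
by its framing. -/
theorem isStableQuasimap_iff [DecidableEq I] (F : QuiverSheaf T o) :
    (F.IsStableQuasimap fun _ ↦ 1) ↔
      (∀ i, IsLocallyFree (F.E i)) ∧ F.IsGenericallyGenerated := by
  have key : ∀ (b : ∀ i, Module.Basis (Fin (rank (F.E i))) X.functionField (genericStalk (F.E i)))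
      (m : ∀ (i j : I) (a : DArrow i j), genericStalk (T.M a)) (_ : ∀ i j a, m i j a ≠ 0),
      IsThetaStable o (fun _ ↦ 1) (fun i j a ↦ (F.genericRep b m i j a).map
        (algebraMap X.functionField (AlgebraicClosure X.functionField)) :
        Rep I _ (AlgebraicClosure X.functionField)) ↔ F.IsGenericallyGenerated := fun b m hm ↦ by
    have h1 : F.genericRep b m = fun i j a ↦
        LinearMap.toMatrix (b i) (b j) (F.genericAct a (m i j a)) := by
      funext i j a
      ext r s
      rw [LinearMap.toMatrix_apply]
      rfl
    rw [isThetaStable_map_iff, h1, isGenerated_toMatrix_iff]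
    exact forall_congr' fun W ↦ by rw [F.isSubrep_iff hm]
  refine and_congr_right fun _ ↦ ⟨fun h ↦ ?_, fun h b m hm ↦ (key b m hm).2 h⟩
  have hfin : ∀ i, Module.Finite X.functionField (genericStalk (F.E i)) :=
    fun i ↦ (F.coherent i).finite_stalk _
  obtain ⟨m, hm⟩ := exists_twist_ne_zero T
  exact (key (fun i ↦ Module.finBasis _ _) m hm).1 (h _ m hm)

/-- The vector `w` of the generic stalk at the vertex `i` is obtained from the framing vector `e` by
applying `n` arrows. -/
inductive IsPath (F : QuiverSheaf T o)
    (m : ∀ (i j : I) (a : DArrow i j), genericStalk (T.M a)) (e : genericStalk (F.E o)) :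
    ℕ → ∀ i, genericStalk (F.E i) → Prop
  | nil : IsPath F m e 0 o e
  | cons {n : ℕ} {i j : I} {w : genericStalk (F.E i)} (a : DArrow i j) (h : IsPath F m e n i w) :
      IsPath F m e (n + 1) j (F.genericAct a (m i j a) w)

/-- The span of the vectors obtained from the framing vector by applying at most `n` arrows. -/
def pathSpan (F : QuiverSheaf T o) (m : ∀ (i j : I) (a : DArrow i j), genericStalk (T.M a))
    (e : genericStalk (F.E o)) (n : ℕ) (i : I) : Submodule X.functionField (genericStalk (F.E i)) :=
  Submodule.span _ {w | ∃ k ≤ n, IsPath F m e k i w}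

lemma pathSpan_mono (F : QuiverSheaf T o)
    (m : ∀ (i j : I) (a : DArrow i j), genericStalk (T.M a)) (e : genericStalk (F.E o)) {n n' : ℕ}
    (h : n ≤ n') (i : I) : F.pathSpan m e n i ≤ F.pathSpan m e n' i :=
  Submodule.span_mono fun _ ⟨k, hk, hw⟩ ↦ ⟨k, hk.trans h, hw⟩

/-- A quiver sheaf which is generically generated by its framing is so by paths whose length is at
most the total rank: the dimension of the span of the paths of length at most `n` is strictly
increasing in `n` until it is stationary. -/
lemma pathSpan_eq_top {F : QuiverSheaf T o} (hF : F.IsGenericallyGenerated)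
    {m : ∀ (i j : I) (a : DArrow i j), genericStalk (T.M a)} (hm : ∀ i j a, m i j a ≠ 0)
    {e : genericStalk (F.E o)} (he : e ≠ 0) (hr : rank (F.E o) = 1) {N : ℕ}
    (hN : ∑ i, rank (F.E i) ≤ N) (i : I) : F.pathSpan m e N i = ⊤ := by
  have hfin : ∀ i, Module.Finite X.functionField (genericStalk (F.E i)) :=
    fun i ↦ (F.coherent i).finite_stalk _
  obtain ⟨n, hn, hstat⟩ : ∃ n ≤ N, ∀ i, F.pathSpan m e n i = F.pathSpan m e (n + 1) i := by
    by_contra! hcon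
    have hlt : ∀ n ≤ N + 1, n ≤ ∑ i, Module.finrank X.functionField (F.pathSpan m e n i) := by
      intro n
      induction n with
      | zero => exact fun _ ↦ Nat.zero_le _
      | succ n ih =>
        intro hn
        refine (Nat.succ_le_succ (ih (by lia))).trans (Nat.succ_le_of_lt ?_)
        obtain ⟨i, hi⟩ := hcon n (by lia)
        refine Finset.sum_lt_sum
          (fun i _ ↦ Submodule.finrank_mono (F.pathSpan_mono m e n.le_succ i))
          ⟨i, Finset.mem_univ i, Submodule.finrank_lt_finrank_of_lt
            (lt_of_le_of_ne (F.pathSpan_mono m e n.le_succ i) hi)⟩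
    have h1 := hlt (N + 1) le_rfl
    have h2 : ∑ i, Module.finrank X.functionField (F.pathSpan m e (N + 1) i) ≤ ∑ i, rank (F.E i) :=
      Finset.sum_le_sum fun i _ ↦ Submodule.finrank_le _
    lia
  refine top_le_iff.1 ((hF (F.pathSpan m e n) ((F.isSubrep_iff hm _).2 fun i j a w hw ↦ ?_)
    ?_ i).ge.trans (F.pathSpan_mono m e hn i))
  · rw [hstat j]
    induction hw using Submodule.span_induction with
    | mem w hw =>
      obtain ⟨k, hk, hw⟩ := hw
      exact Submodule.subset_span ⟨k + 1, by lia, hw.cons a⟩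
    | zero => rw [map_zero]; exact Submodule.zero_mem _
    | add w w' _ _ hw hw' => rw [map_add]; exact Submodule.add_mem _ hw hw'
    | smul c w _ hw => rw [map_smul]; exact Submodule.smul_mem _ _ hw
  · refine eq_top_iff.2 fun w _ ↦ ?_
    obtain ⟨c, rfl⟩ := exists_smul_eq_of_finrank_eq_one hr he w
    exact Submodule.smul_mem _ _ (Submodule.subset_span ⟨0, Nat.zero_le _, .nil⟩)

section Bounds

variable [hdvr : ∀ x : {x : X // IsClosed {x}}, IsDiscreteValuationRing (X.presheaf.stalk x.1)]

/-- Each arrow adds at most `c x` to the order of the pole at `x`. -/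
lemma IsPath.smul_mem {F : QuiverSheaf T o}
    {m : ∀ (i j : I) (a : DArrow i j), genericStalk (T.M a)} {e : genericStalk (F.E o)}
    {x : {x : X // IsClosed {x}}} (he : e ∈ stalkLattice (F.E o) x.1) {c : ℕ}
    (hc : ∀ i j a (α : X.functionField), α ≠ 0 → (c : ℤ) ≤ ordZ (X.presheaf.stalk x.1) α →
      α • m i j a ∈ stalkLattice (T.M a) x.1)
    {n : ℕ} {i : I} {w : genericStalk (F.E i)} (h : IsPath F m e n i w) (α : X.functionField)
    (hα : α ≠ 0) (hn : (n * c : ℕ) ≤ ordZ (X.presheaf.stalk x.1) α) :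
    α • w ∈ stalkLattice (F.E i) x.1 := by
  induction h generalizing α with
  | nil =>
    exact smul_mem_stalkLattice_of_le one_ne_zero (by rwa [one_smul]) hα
        (by rw [ordZ_one]; simpa using hn)
  | @cons n i j w a h ih =>
    obtain ⟨β, hβ, hord⟩ := exists_ordZ_eq (X.presheaf.stalk x.1) (K := X.functionField) c
    obtain ⟨t, ht⟩ := ih (α * β⁻¹) (mul_ne_zero hα (inv_ne_zero hβ)) (by
      rw [ordZ_mul _ hα (inv_ne_zero hβ), ordZ_inv, hord]
      push_cast at hn ⊢
      linarith)
    obtain ⟨t', ht'⟩ := hc i j a β hβ hord.ge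
    refine ⟨stalkMap (F.φ a) x.1 (stalkTmul t' t), ?_⟩
    change toGeneric _ _ t = _ at ht
    change toGeneric _ _ t' = _ at ht'
    change toGeneric _ _ _ = _
    rw [toGeneric_stalkMap, toGeneric_stalkTmul, ht, ht', ← genericAct_apply, map_smul]
    have h1 : F.genericAct a (β • m i j a) w = β • F.genericAct a (m i j a) w := by
      simp only [genericAct, map_smul, LinearMap.comp_smul, LinearMap.smul_apply]
    rw [h1, smul_smul, inv_mul_cancel_right₀ hβ]

/-- There are rational sections `m` of the line bundles `M_a` with poles of order at most `c x` at
`x`. -/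
lemma exists_twist_bound [SmoothOfRelativeDimension 1 f] [IsProper f] (T : Twist f I) :
    ∃ (m : ∀ (i j : I) (a : DArrow i j), genericStalk (T.M a)) (c : {x : X // IsClosed {x}} → ℕ),
      (∀ i j a, m i j a ≠ 0) ∧ (Function.support c).Finite ∧
      ∀ x i j a (α : X.functionField), α ≠ 0 → (c x : ℤ) ≤ ordZ (X.presheaf.stalk x.1) α →
        α • m i j a ∈ stalkLattice (T.M a) x.1 := by
  obtain ⟨m, hm⟩ := exists_twist_ne_zero T
  choose c hfin hc using fun i j (a : DArrow i j) ↦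
    exists_pole_bound f (T.isLineBundle a).1 (m i j a)
  refine ⟨m, fun x ↦ ∑ i, ∑ j, ∑ a : DArrow i j, c i j a x, hm, ?_, fun x i j a α hα h ↦
    hc i j a x α hα (le_trans (Nat.cast_le.2 ?_) h)⟩
  · refine (Set.finite_iUnion fun i ↦ Set.finite_iUnion fun j ↦ Set.finite_iUnion fun a ↦
      hfin i j a).subset fun x hx ↦ ?_
    obtain ⟨i, -, hi⟩ := Finset.exists_ne_zero_of_sum_ne_zero hx
    obtain ⟨j, -, hj⟩ := Finset.exists_ne_zero_of_sum_ne_zero hi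
    obtain ⟨a, -, ha⟩ := Finset.exists_ne_zero_of_sum_ne_zero hj
    simp only [Set.mem_iUnion]
    exact ⟨i, j, a, ha⟩
  · refine le_trans ?_ (Finset.single_le_sum (f := fun i ↦ ∑ j, ∑ a : DArrow i j, c i j a x)
      (fun _ _ ↦ Nat.zero_le _) (Finset.mem_univ i))
    refine le_trans ?_ (Finset.single_le_sum (f := fun j ↦ ∑ a : DArrow i j, c i j a x)
      (fun _ _ ↦ Nat.zero_le _) (Finset.mem_univ j))
    exact Finset.single_le_sum (f := fun a : DArrow i j ↦ c i j a x)
      (fun _ _ ↦ Nat.zero_le _) (Finset.mem_univ a)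

/-- The poles of the vectors obtained from the framing bound the degrees of the torsion-free
subsheaves of the components of a generically generated quiver sheaf. -/
theorem degree_le_of_isGenericallyGenerated [SmoothOfRelativeDimension 1 f] [IsProper f]
    {F : QuiverSheaf T o} (hF : F.IsGenericallyGenerated) (hr : rank (F.E o) = 1)
    {m : ∀ (i j : I) (a : DArrow i j), genericStalk (T.M a)} (hm : ∀ i j a, m i j a ≠ 0)
    {c : {x : X // IsClosed {x}} → ℕ} (hfin : (Function.support c).Finite)
    (hc : ∀ x i j a (α : X.functionField), α ≠ 0 → (c x : ℤ) ≤ ordZ (X.presheaf.stalk x.1) α →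
      α • m i j a ∈ stalkLattice (T.M a) x.1)
    {N : ℕ} (hN : ∑ i, rank (F.E i) ≤ N) {i : I} {E' : X.Modules} (hE' : IsCoherent E')
    (htf : ∀ x, Function.Injective (toGeneric E' x)) (g : E' ⟶ F.E i)
    (hg : Function.Injective (genericMap g)) :
    degree E' ≤ degree (F.E i) + rank (F.E i) * (∑ᶠ x, N * c x : ℕ) := by
  obtain ⟨r, ⟨e⟩⟩ := F.framed
  obtain ⟨s, hs⟩ := exists_frame_of_iso e
  have hr1 : r = 1 := by rw [← hr, hs.rank_eq, Fintype.card_fin]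
  subst hr1
  refine degree_le_of_span_eq_top f hE' (F.coherent i) htf g hg
    (pathSpan_eq_top hF hm (hs.genericBasis.ne_zero 0) hr hN i) (fun x ↦ N * c x)
    (hfin.subset fun x hx h ↦ hx (by simp [h])) ?_
  rintro w ⟨k, hk, hw⟩ x α hα h
  refine hw.smul_mem (hs.mem_stalkLattice 0 x.1) (hc x) α hα (le_trans ?_ h)
  exact_mod_cast Nat.mul_le_mul_right _ hk

/-- The degrees of the components of a generically generated quiver sheaf are bounded below: apply
the bound for torsion-free subsheaves to the zero subsheaf. -/
theorem le_degree_of_isGenericallyGenerated [SmoothOfRelativeDimension 1 f] [IsProper f]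
    [IsLocallyNoetherian X]
    {F : QuiverSheaf T o} (hF : F.IsGenericallyGenerated) (hr : rank (F.E o) = 1)
    {m : ∀ (i j : I) (a : DArrow i j), genericStalk (T.M a)} (hm : ∀ i j a, m i j a ≠ 0)
    {c : {x : X // IsClosed {x}} → ℕ} (hfin : (Function.support c).Finite)
    (hc : ∀ x i j a (α : X.functionField), α ≠ 0 → (c x : ℤ) ≤ ordZ (X.presheaf.stalk x.1) α →
      α • m i j a ∈ stalkLattice (T.M a) x.1)
    {N : ℕ} (hN : ∑ i, rank (F.E i) ≤ N) {i : I}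
    (htf : ∀ x, Function.Injective (toGeneric (F.E i) x)) :
    0 ≤ degree (F.E i) + rank (F.E i) * (∑ᶠ x, N * c x : ℕ) := by
  have hcoh := isCoherent_genericSub (F.E i) (F.coherent i) ⊥
  have hz : ∀ x (e : (genericSub (F.E i) ⊥).presheaf.stalk x), e = 0 := fun x e ↦ by
    rw [← stalkMap_id _ x e, (genericSub_bot_isZero htf).eq_of_src (𝟙 _) 0, stalkMap_zero]
  have : Subsingleton (genericStalk (genericSub (F.E i) ⊥)) :=
    ⟨fun s t ↦ (hz _ s).trans (hz _ t).symm⟩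
  refine (degree_nonneg_of_subsingleton f hcoh).trans
    (degree_le_of_isGenericallyGenerated hF hr hm hfin hc hN hcoh (fun x s t _ ↦ ?_)
      (genericSubι (F.E i) ⊥) fun s t _ ↦ Subsingleton.elim _ _)
  exact (hz _ s).trans (hz _ t).symm

end Bounds

end QuiverSheaf

end Generation

/-! ### Stability and generation by the framing -/

section Stability

variable {X : Scheme.{0}} [IsIntegral X]

/-- In the right half plane, arguments are compared through slopes. -/
lemma arg_lt_arg {z w : ℂ} (hz : 0 < z.re) (hw : 0 < w.re) (h : z.im * w.re < w.im * z.re) :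
    z.arg < w.arg := by
  have h1 : ∀ u : ℂ, 0 < u.re → u.arg = Real.arctan (u.im / u.re) := fun u hu ↦ by
    rw [← Complex.tan_arg, Real.arctan_tan] <;>
      have := abs_lt.1 (Complex.abs_arg_lt_pi_div_two_iff.2 (.inl hu))
    exacts [this.1, this.2]
  rw [h1 z hz, h1 w hw]
  exact Real.arctan_strictMono ((div_lt_div_iff₀ hz hw).2 h)

lemma subsingleton_of_rank_eq_zero {E : X.Modules} (hE : IsCoherent E) (h : rank E = 0) :
    Subsingleton (genericStalk E) := by
  have : Module.Finite X.functionField (genericStalk E) := hE.finite_stalk _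
  exact Module.finrank_zero_iff.1 h

lemma stalk_eq_zero_of_rank_eq_zero {E : X.Modules} (hE : IsCoherent E) (h : rank E = 0)
    (htf : ∀ x, Function.Injective (toGeneric E x)) (x : X) (e : E.presheaf.stalk x) : e = 0 := by
  have := subsingleton_of_rank_eq_zero hE h
  exact htf x (Subsingleton.elim _ _)

lemma eq_zero_of_isZero {E : X.Modules} (h : Limits.IsZero E) (x : X) (e : E.presheaf.stalk x) :
    e = 0 := by
  rw [← stalkMap_id E x e, h.eq_of_src (𝟙 E) 0, QuiverSheaf.stalkMap_zero]

lemma rank_eq_zero_of_isZero {E : X.Modules} (h : Limits.IsZero E) : rank E = 0 := by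
  have : Subsingleton (genericStalk E) :=
    ⟨fun s t ↦ (eq_zero_of_isZero h _ s).trans (eq_zero_of_isZero h _ t).symm⟩
  exact Module.finrank_zero_of_subsingleton

lemma genericMap_injective {E' E : X.Modules} {g : E' ⟶ E}
    (h : Function.Injective (stalkMap g (genericPoint X))) : Function.Injective (genericMap g) := h

lemma toGeneric_injective_of_stalkMap {E' E : X.Modules} (g : E' ⟶ E) {x : X}
    (h : Function.Injective (stalkMap g x)) (htf : Function.Injective (toGeneric E x)) :
    Function.Injective (toGeneric E' x) := fun s t hst ↦ by
  refine h (htf ?_)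
  rw [toGeneric_stalkMap, toGeneric_stalkMap, hst]

lemma range_genericMap_genericSubι (E : X.Modules)
    (W : Submodule X.functionField (genericStalk E)) :
    LinearMap.range (genericMap (genericSubι E W)) = W := by
  ext e
  have h := range_stalkMap_genericSubι (W := W) (genericPoint X) e
  rw [toGeneric_genericPoint] at h
  exact h

lemma rank_genericSub (E : X.Modules) (W : Submodule X.functionField (genericStalk E)) :
    rank (genericSub E W) = Module.finrank X.functionField W := by
  have h := LinearMap.finrank_range_of_inj
    (genericMap_injective (genericSubι_stalk_injective (E := E) (W := W) (genericPoint X)))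
  rw [range_genericMap_genericSubι] at h
  exact h.symm

lemma rank_le_of_injective {E' E : X.Modules} (hE : IsCoherent E) (g : E' ⟶ E)
    (h : Function.Injective (genericMap g)) : rank E' ≤ rank E := by
  have : Module.Finite X.functionField (genericStalk E) := hE.finite_stalk _
  exact LinearMap.finrank_le_finrank_of_injective h

section Bijective

variable [hdvr : ∀ x : {x : X // IsClosed {x}}, IsDiscreteValuationRing (X.presheaf.stalk x.1)]

lemma degree_le_of_bijective (f : X ⟶ Spec (.of ℂ)) [SmoothOfRelativeDimension 1 f] [IsProper f]
    {E' E : X.Modules} (hE' : IsCoherent E') (hE : IsCoherent E)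
    (htf : ∀ x, Function.Injective (toGeneric E' x)) (g : E' ⟶ E)
    (hg : Function.Bijective (genericMap g)) : degree E' ≤ degree E := by
  have hfin : Module.Finite X.functionField (genericStalk E') := hE'.finite_stalk _
  let b' := Module.finBasis X.functionField (genericStalk E')
  let b := (b'.map (LinearEquiv.ofBijective _ hg)).reindex (Equiv.sumEmpty _ Empty).symm
  have h := degree_le_degree_add f hE' hE (fun x ↦ (Submodule.eq_bot_iff _).2 fun t ht ↦
    htf x.1 (ht.trans (map_zero _).symm)) g b' b (fun i ↦ by simp [b]) (fun _ ↦ 0)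
    (by simp) fun x i ↦ i.elim
  simpa using h

end Bijective

variable {f : X ⟶ Spec (.of ℂ)} {I : Type} [Quiver.{0} I]
  [Fintype I] [∀ i j : I, Fintype (i ⟶ j)] {T : Twist f I} {o : I} [DecidableEq I]

namespace QuiverSheaf

lemma Z_re (τ : ℝ) (F : QuiverSheaf T o) :
    (Z τ F).re = ((∑ i ∈ Finset.univ.erase o, rank (F.E i) : ℕ) : ℝ) := by
  simp [Z]

lemma Z_im (τ : ℝ) (F : QuiverSheaf T o) :
    (Z τ F).im = ((∑ i ∈ Finset.univ.erase o, degree (F.E i) : ℤ) : ℝ) + τ * rank (F.E o) := by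
  simp [Z]

lemma not_isZero_of_rank {F : QuiverSheaf T o} (hr : rank (F.E o) = 1) : ¬ Limits.IsZero F :=
  fun h ↦ one_ne_zero (hr.symm.trans (rank_eq_zero_of_isZero (isZero_iff.1 h o)))

lemma toGeneric_injective_framing (F : QuiverSheaf T o) (x : X) :
    Function.Injective (toGeneric (F.E o) x) := by
  obtain ⟨r, ⟨e⟩⟩ := F.framed
  obtain ⟨s, hs⟩ := exists_frame_of_iso e
  exact hs.toGeneric_injective x

variable [hdvr : ∀ x : {x : X // IsClosed {x}}, IsDiscreteValuationRing (X.presheaf.stalk x.1)]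
  [IsLocallyNoetherian X]

/-- The components of a semistable quiver sheaf are torsion-free: the torsion subsheaves form a
subobject, which has phase `π / 2` unless it is zero, while the quiver sheaf has smaller phase if
some unframed component has positive rank. If they all have rank zero, they are torsion sheaves of
degree zero. -/
lemma toGeneric_injective_of_isSemistable [SmoothOfRelativeDimension 1 f] [IsProper f]
    {F : QuiverSheaf T o} {τ : ℝ} (hF : F.IsSemistable τ) (hr : rank (F.E o) = 1)
    (h : (∃ i, i ≠ o ∧ rank (F.E i) ≠ 0) ∨ ∀ i, i ≠ o → degree (F.E i) = 0) (i : I) (x : X) :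
    Function.Injective (toGeneric (F.E i) x) := by
  by_cases hio : i = o
  · subst hio
    exact F.toGeneric_injective_framing x
  by_cases hR : ∃ i, i ≠ o ∧ rank (F.E i) ≠ 0
  swap
  · have hdeg := h.resolve_left hR i hio
    push Not at hR
    have := subsingleton_of_rank_eq_zero (F.coherent i) (hR i hio)
    have hz := stalk_eq_zero_of_degree_le f (F.coherent i) hdeg.le x
    exact fun s t _ ↦ (hz s).trans (hz t).symm
  by_contra hinj
  rw [injective_iff_map_eq_zero] at hinj
  push Not at hinj
  obtain ⟨t, ht, ht0⟩ := hinj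
  have hW : F.IsSubrep fun _ ↦ ⊥ := fun i j a m w hw ↦ by
    rw [Submodule.mem_bot] at hw ⊢
    rw [hw, map_zero]
  have ho0 := genericSub_bot_isZero F.toGeneric_injective_framing
  let G := F.sub hW ⟨0, nonempty_iso_freeSheaf_zero ho0⟩
  let ι : G ⟶ F := F.subι hW _
  have hss : ∀ j, Subsingleton (genericStalk (G.E j)) := fun j ↦
    subsingleton_of_rank_eq_zero (G.coherent j)
      ((rank_genericSub (F.E j) ⊥).trans (finrank_bot _ _))
  have hGrank : ∀ j, rank (G.E j) = 0 := fun j ↦ by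
    have := hss j
    exact Module.finrank_zero_of_subsingleton
  have hne : ¬ ∀ y (e : (G.E i).presheaf.stalk y), e = 0 := fun hz ↦ by
    obtain ⟨t', ht'⟩ := (range_stalkMap_genericSubι (W := ⊥) x t).2
      (by rw [ht]; exact Submodule.zero_mem _)
    exact ht0 (ht'.symm.trans ((congrArg _ (hz x t')).trans (map_zero _)))
  have hle := hF.2 G ι (mono_of_app ι fun j ↦ inferInstanceAs (Mono (genericSubι (F.E j) ⊥)))
    (fun hiso ↦ by
      have := isIso_app ι o
      have h1 := rank_le_of_injective (G.coherent o) (inv (ι.app o))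
        (stalkMap_bijective_of_isIso (inv (ι.app o)) (genericPoint X)).1
      rw [hr, hGrank] at h1
      exact absurd h1 (by lia))
    (fun hzero ↦ hne fun y e ↦ eq_zero_of_isZero (isZero_iff.1 hzero i) y e)
  have hG : (Z τ G).arg = Real.pi / 2 := by
    rw [Complex.arg_eq_pi_div_two_iff, Z_re, Z_im]
    simp only [hGrank, Finset.sum_const_zero, Nat.cast_zero, mul_zero, add_zero, true_and]
    refine Int.cast_pos.2 (Finset.sum_pos' (fun j _ ↦ ?_) ⟨i, by simpa using hio, ?_⟩)
    · have := hss j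
      exact degree_nonneg_of_subsingleton f (G.coherent j)
    · have := hss i
      by_contra! hdeg
      exact hne (stalk_eq_zero_of_degree_le f (G.coherent i) hdeg)
  have hZ : 0 < (Z τ F).re := by
    rw [Z_re]
    obtain ⟨j, hj, hrj⟩ := hR
    exact Nat.cast_pos.2 (Finset.sum_pos' (fun _ _ ↦ Nat.zero_le _)
      ⟨j, by simpa using hj, Nat.pos_of_ne_zero hrj⟩)
  have h2 := (abs_lt.1 (Complex.abs_arg_lt_pi_div_two_iff.2 (.inl hZ))).2
  rw [hG] at hle
  linarith

/-- The subrepresentation generated by the framing. -/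
def generatedSub (F : QuiverSheaf T o) (i : I) : Submodule X.functionField (genericStalk (F.E i)) :=
  ⨅ W : {W // F.IsSubrep W ∧ W o = ⊤}, W.1 i

omit [DecidableEq I] hdvr [IsLocallyNoetherian X] in
lemma isSubrep_generatedSub (F : QuiverSheaf T o) : F.IsSubrep F.generatedSub :=
  fun i j a m w hw ↦ (Submodule.mem_iInf _).2 fun W ↦
    W.2.1 i j a m w ((Submodule.mem_iInf _).1 hw W)

omit [DecidableEq I] hdvr [IsLocallyNoetherian X] in
lemma generatedSub_framing (F : QuiverSheaf T o) : F.generatedSub o = ⊤ :=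
  iInf_eq_top.2 fun W ↦ W.2.2

omit [DecidableEq I] hdvr [IsLocallyNoetherian X] in
lemma generatedSub_le {F : QuiverSheaf T o}
    {W : ∀ i, Submodule X.functionField (genericStalk (F.E i))} (hW : F.IsSubrep W) (ho : W o = ⊤)
    (i : I) : F.generatedSub i ≤ W i :=
  iInf_le (fun W : {W // F.IsSubrep W ∧ W o = ⊤} ↦ W.1 i) ⟨W, hW, ho⟩

omit [DecidableEq I] hdvr in
/-- A subrepresentation of the subobject generated by the framing is a subrepresentation of the
ambient quiver sheaf. -/
lemma isGenericallyGenerated_sub (F : QuiverSheaf T o)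
    (ho : ∃ r, Nonempty (genericSub (F.E o) (F.generatedSub o) ≅ freeSheaf X r)) :
    (F.sub F.isSubrep_generatedSub ho).IsGenericallyGenerated := by
  intro W hW hWo i
  let ι := F.subι F.isSubrep_generatedSub ho
  have hrange : ∀ i, LinearMap.range (genericMap (ι.app i)) = F.generatedSub i := fun i ↦
    range_genericMap_genericSubι _ _
  have h1 := generatedSub_le (F := F) (W := fun i ↦ (W i).map (genericMap (ι.app i)))
    (fun i j a m w hw ↦ by
      obtain ⟨w, hw, rfl⟩ := hw
      exact ⟨_, hW i j a m w hw, genericMap_genericAct ι a m w⟩)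
    (by rw [hWo, Submodule.map_top, hrange, generatedSub_framing]) i
  refine eq_top_iff.2 fun t _ ↦ ?_
  obtain ⟨w, hw, hwt⟩ := h1 ((hrange i).le ⟨t, rfl⟩)
  have : w = t := genericSubι_stalk_injective (genericPoint X) hwt
  exact this ▸ hw

/-- For `τ` large the subobject generated by the framing destabilizes unless it has full rank: its
degrees are bounded below in terms of the poles of the twists only, and its total rank `R'` is
smaller than `R`, so that its slope `(D' + τ) / R'` exceeds `(D + τ) / R`. -/
lemma isGenericallyGenerated_of_isSemistable [SmoothOfRelativeDimension 1 f] [IsProper f]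
    {F : QuiverSheaf T o} {τ : ℝ} (hF : F.IsSemistable τ) (hr : rank (F.E o) = 1)
    (htf : ∀ i x, Function.Injective (toGeneric (F.E i) x))
    {m : ∀ (i j : I) (a : DArrow i j), genericStalk (T.M a)} (hm : ∀ i j a, m i j a ≠ 0)
    {c : {x : X // IsClosed {x}} → ℕ} (hfin : (Function.support c).Finite)
    (hc : ∀ x i j a (α : X.functionField), α ≠ 0 → (c x : ℤ) ≤ ordZ (X.presheaf.stalk x.1) α →
      α • m i j a ∈ stalkLattice (T.M a) x.1)
    {N : ℕ} (hN : ∑ i, rank (F.E i) ≤ N) {R : ℕ} (hR : ∑ i ∈ Finset.univ.erase o, rank (F.E i) = R)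
    {D : ℤ} (hD : ∑ i ∈ Finset.univ.erase o, degree (F.E i) = D)
    (hτ : (R + 1 : ℝ) * (|(D : ℝ)| + R * (∑ᶠ x, N * c x : ℕ)) < τ) :
    F.IsGenericallyGenerated := by
  intro W hW hWo i₀
  have hle := generatedSub_le hW hWo i₀
  refine top_le_iff.1 (le_trans ?_ hle)
  by_contra hcon
  have ho : ∃ r, Nonempty (genericSub (F.E o) (F.generatedSub o) ≅ freeSheaf X r) := by
    rw [generatedSub_framing]
    obtain ⟨r, ⟨e⟩⟩ := F.framed
    have := isIso_genericSubι_top (E := F.E o)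
    exact ⟨r, ⟨asIso (genericSubι (F.E o) ⊤) ≪≫ e⟩⟩
  let G := F.sub F.isSubrep_generatedSub ho
  let ι : G ⟶ F := F.subι F.isSubrep_generatedSub ho
  have hfd : ∀ i, Module.Finite X.functionField (genericStalk (F.E i)) :=
    fun i ↦ (F.coherent i).finite_stalk _
  have hinj : ∀ i x, Function.Injective (stalkMap (ι.app i) x) :=
    fun i x ↦ genericSubι_stalk_injective x
  have hrank : ∀ i, rank (G.E i) = Module.finrank X.functionField (F.generatedSub i) :=
    fun i ↦ rank_genericSub _ _
  have hrank_le : ∀ i, rank (G.E i) ≤ rank (F.E i) :=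
    fun i ↦ rank_le_of_injective (F.coherent i) (ι.app i) (hinj i _)
  have hrank_lt : rank (G.E i₀) < rank (F.E i₀) := by
    rw [hrank]
    exact Submodule.finrank_lt fun h ↦ hcon h.ge
  have hro : rank (G.E o) = 1 := by rw [hrank, generatedSub_framing, finrank_top]; exact hr
  have hi₀ : i₀ ≠ o := fun h ↦ by
    subst h
    lia
  have htfG : ∀ i x, Function.Injective (toGeneric (G.E i) x) :=
    fun i x ↦ toGeneric_injective_of_stalkMap (ι.app i) (hinj i x) (htf i x)
  set C := (∑ᶠ x, N * c x : ℕ) with hC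
  have hdeg : ∀ i, 0 ≤ degree (G.E i) + rank (G.E i) * C := fun i ↦
    le_degree_of_isGenericallyGenerated (F.isGenericallyGenerated_sub ho) hro hm hfin hc
      ((Finset.sum_le_sum fun i _ ↦ hrank_le i).trans hN) (htfG i)
  have hphase := hF.2 G ι (mono_of_app ι fun i ↦ inferInstanceAs (Mono (genericSubι (F.E i) _)))
    (fun hiso ↦ by
      have := isIso_app ι i₀
      have h1 := rank_le_of_injective (G.coherent i₀) (inv (ι.app i₀))
        (stalkMap_bijective_of_isIso (inv (ι.app i₀)) (genericPoint X)).1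
      lia)
    (not_isZero_of_rank hro)
  obtain ⟨R', hR'⟩ : ∃ R', ∑ i ∈ Finset.univ.erase o, rank (G.E i) = R' := ⟨_, rfl⟩
  obtain ⟨D', hD'⟩ : ∃ D', ∑ i ∈ Finset.univ.erase o, degree (G.E i) = D' := ⟨_, rfl⟩
  have hRR : R' + 1 ≤ R := by
    rw [← hR, ← hR']
    exact Finset.sum_lt_sum (fun i _ ↦ hrank_le i) ⟨i₀, by simpa using hi₀, hrank_lt⟩
  have hDD : 0 ≤ D' + R' * C := by
    have h1 := Finset.sum_nonneg fun i (_ : i ∈ Finset.univ.erase o) ↦ hdeg i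
    rw [Finset.sum_add_distrib, hD', ← Finset.sum_mul, ← Nat.cast_sum, hR'] at h1
    exact h1
  have hRR' : (R' : ℝ) + 1 ≤ R := by exact_mod_cast hRR
  have hDD' : (0 : ℝ) ≤ D' + R' * C := by exact_mod_cast hDD
  have hC0 : (0 : ℝ) ≤ C := Nat.cast_nonneg _
  have hR0 : (0 : ℝ) ≤ R' := Nat.cast_nonneg _
  have habs := le_abs_self (D : ℝ)
  have habs' := neg_abs_le (D : ℝ)
  have hFre : (Z τ F).re = R := by rw [Z_re, hR]
  have hFim : (Z τ F).im = D + τ := by rw [Z_im, hD, hr, Nat.cast_one, mul_one]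
  have hGre : (Z τ G).re = R' := by rw [Z_re, hR']
  have hGim : (Z τ G).im = D' + τ := by rw [Z_im, hD', hro, Nat.cast_one, mul_one]
  have hRC : (R' : ℝ) * C ≤ R * C := by gcongr; linarith
  have hprod : 0 ≤ (R : ℝ) * (|(D : ℝ)| + R * C) := by positivity
  have hτD : 0 < D' + τ := by nlinarith [abs_nonneg (D : ℝ)]
  refine absurd hphase (not_le.2 ?_)
  obtain h0 | h0 := hR0.eq_or_lt
  -- The subobject has phase `π / 2` if all its unframed components have rank zero.
  · have h1 : (Z τ G).arg = Real.pi / 2 := by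
      rw [Complex.arg_eq_pi_div_two_iff, hGre, hGim]
      exact ⟨h0.symm, hτD⟩
    rw [h1]
    refine (abs_lt.1 (Complex.abs_arg_lt_pi_div_two_iff.2 (.inl ?_))).2
    rw [hFre]
    linarith
  · refine arg_lt_arg (by rw [hFre]; linarith) (by rwa [hGre]) ?_
    rw [hFre, hFim, hGre, hGim]
    have hτ0 : 0 ≤ D + τ := by nlinarith [abs_nonneg (D : ℝ)]
    have h1 : (D + τ) * R' ≤ (D + τ) * (R - 1) := by gcongr; linarith
    have h2 : (R : ℝ) * -(R * C) ≤ R * D' := by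
      refine mul_le_mul_of_nonneg_left ?_ (by linarith)
      linarith
    have h3 : D * ((R : ℝ) - 1) ≤ |(D : ℝ)| * (R + 1) := by
      have h4 : D * ((R : ℝ) - 1) ≤ |(D : ℝ)| * (R - 1) :=
        mul_le_mul_of_nonneg_right habs (by linarith)
      nlinarith [abs_nonneg (D : ℝ)]
    have h5 : 0 ≤ (R : ℝ) * C := by positivity
    nlinarith

/-- A torsion-free quiver sheaf which is generically generated by its framing is stable for large
`τ`. The slope of a subobject without framing does not involve `τ` and is bounded. A subobject with
framing has full rank, hence smaller degree. -/
lemma isStable_of_isGenericallyGenerated [SmoothOfRelativeDimension 1 f] [IsProper f]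
    (hX : IsField Γ(X, ⊤)) {F : QuiverSheaf T o} {τ : ℝ} (hF : F.IsGenericallyGenerated)
    (hr : rank (F.E o) = 1) (htf : ∀ i x, Function.Injective (toGeneric (F.E i) x))
    {m : ∀ (i j : I) (a : DArrow i j), genericStalk (T.M a)} (hm : ∀ i j a, m i j a ≠ 0)
    {c : {x : X // IsClosed {x}} → ℕ} (hfin : (Function.support c).Finite)
    (hc : ∀ x i j a (α : X.functionField), α ≠ 0 → (c x : ℤ) ≤ ordZ (X.presheaf.stalk x.1) α →
      α • m i j a ∈ stalkLattice (T.M a) x.1)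
    {N : ℕ} (hN : ∑ i, rank (F.E i) ≤ N) {R : ℕ} (hR : ∑ i ∈ Finset.univ.erase o, rank (F.E i) = R)
    {D : ℤ} (hD : ∑ i ∈ Finset.univ.erase o, degree (F.E i) = D)
    (hτ : (R + 1 : ℝ) * (|(D : ℝ)| + R * (∑ᶠ x, N * c x : ℕ)) < τ) :
    F.IsStable τ := by
  refine ⟨not_isZero_of_rank hr, fun F' ι hι hiso hne ↦ ?_⟩
  have hinj := stalkMap_injective_of_mono hX ι htf hr
  have hginj : ∀ i, Function.Injective (genericMap (ι.app i)) := fun i ↦ hinj i _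
  have htf' : ∀ i x, Function.Injective (toGeneric (F'.E i) x) :=
    fun i x ↦ toGeneric_injective_of_stalkMap (ι.app i) (hinj i x) (htf i x)
  have hfd : ∀ i, Module.Finite X.functionField (genericStalk (F.E i)) :=
    fun i ↦ (F.coherent i).finite_stalk _
  have hrank_le : ∀ i, rank (F'.E i) ≤ rank (F.E i) :=
    fun i ↦ rank_le_of_injective (F.coherent i) (ι.app i) (hginj i)
  set C := (∑ᶠ x, N * c x : ℕ) with hC
  obtain ⟨R', hR'⟩ : ∃ R', ∑ i ∈ Finset.univ.erase o, rank (F'.E i) = R' := ⟨_, rfl⟩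
  obtain ⟨D', hD'⟩ : ∃ D', ∑ i ∈ Finset.univ.erase o, degree (F'.E i) = D' := ⟨_, rfl⟩
  have hRR : R' ≤ R := by
    rw [← hR, ← hR']
    exact Finset.sum_le_sum fun i _ ↦ hrank_le i
  have hC0 : (0 : ℝ) ≤ C := Nat.cast_nonneg _
  have hR0 : (0 : ℝ) ≤ R := Nat.cast_nonneg _
  have hFre : (Z τ F).re = R := by rw [Z_re, hR]
  have hFim : (Z τ F).im = D + τ := by rw [Z_im, hD, hr, Nat.cast_one, mul_one]
  have hF're : (Z τ F').re = R' := by rw [Z_re, hR']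
  obtain hro | hro : rank (F'.E o) = 0 ∨ rank (F'.E o) = 1 := by
    have := hrank_le o
    lia
  · have hF'im : (Z τ F').im = D' := by rw [Z_im, hD', hro, Nat.cast_zero, mul_zero, add_zero]
    have hpos : 1 ≤ R' := by
      by_contra! h0
      have h1 : ∀ i, rank (F'.E i) = 0 := fun i ↦ by
        by_cases hi : i = o
        · rw [hi, hro]
        · have h2 := Finset.single_le_sum (f := fun i ↦ rank (F'.E i)) (fun _ _ ↦ Nat.zero_le _)
            (show i ∈ Finset.univ.erase o by simpa using hi)
          lia
      exact hne (isZero_iff.2 fun i ↦ isZero_of_stalk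
        (stalk_eq_zero_of_rank_eq_zero (F'.coherent i) (h1 i) (htf' i)))
    have hDD : D' ≤ D + R * C := by
      have h1 := Finset.sum_le_sum fun i (_ : i ∈ Finset.univ.erase o) ↦
        degree_le_of_isGenericallyGenerated hF hr hm hfin hc hN (F'.coherent i) (htf' i) (ι.app i)
          (hginj i)
      rw [Finset.sum_add_distrib, hD, hD', ← Finset.sum_mul, ← Nat.cast_sum, hR] at h1
      exact h1
    have hDD' : (D' : ℝ) ≤ D + R * C := by exact_mod_cast hDD
    have hRR' : (R' : ℝ) ≤ R := by exact_mod_cast hRR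
    have hpos' : (1 : ℝ) ≤ R' := by exact_mod_cast hpos
    have habs := le_abs_self (D : ℝ)
    have habs' := neg_abs_le (D : ℝ)
    refine arg_lt_arg (by rw [hF're]; linarith) (by rw [hFre]; linarith) ?_
    rw [hFre, hFim, hF're, hF'im]
    have h1 : D' * (R : ℝ) ≤ (|(D : ℝ)| + R * C) * R :=
      mul_le_mul_of_nonneg_right (by linarith) hR0
    have h2 : (0 : ℝ) ≤ R * C := by positivity
    have h3 : (|(D : ℝ)| + R * C) * R < D + τ := by linarith
    have h4 : 0 ≤ (|(D : ℝ)| + R * C) * R := by positivity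
    calc D' * (R : ℝ) < D + τ := by linarith
      _ = (D + τ) * 1 := (mul_one _).symm
      _ ≤ (D + τ) * R' := mul_le_mul_of_nonneg_left hpos' (by linarith)
  -- The image contains the framing generically, so it is of full rank.
  · have hF'im : (Z τ F').im = D' + τ := by rw [Z_im, hD', hro, Nat.cast_one, mul_one]
    have htop := hF (fun i ↦ LinearMap.range (genericMap (ι.app i)))
      (fun i j a m w hw ↦ by
        obtain ⟨w, rfl⟩ := hw
        exact ⟨_, genericMap_genericAct ι a m w⟩)
      (Submodule.eq_top_of_finrank_eq (by
        rw [LinearMap.finrank_range_of_inj (hginj o)]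
        exact hro.trans hr.symm))
    have hbij : ∀ i, Function.Bijective (genericMap (ι.app i)) := fun i ↦
      ⟨hginj i, LinearMap.range_eq_top.1 (htop i)⟩
    have hRR' : R' = R := by
      rw [← hR, ← hR']
      exact Finset.sum_congr rfl fun i _ ↦ (LinearEquiv.ofBijective _ (hbij i)).finrank_eq
    have hdeg : ∀ i, degree (F'.E i) ≤ degree (F.E i) := fun i ↦
      degree_le_of_bijective f (F'.coherent i) (F.coherent i) (htf' i) (ι.app i) (hbij i)
    have hisoo : IsIso (ι.app o) := by
      refine isIso_of_degree_le f (F'.coherent o) (F.coherent o) (htf' o) (htf o) _ (hbij o) ?_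
      obtain ⟨r, ⟨e⟩⟩ := F.framed
      obtain ⟨r', ⟨e'⟩⟩ := F'.framed
      obtain ⟨s, hs⟩ := exists_frame_of_iso e
      obtain ⟨s', hs'⟩ := exists_frame_of_iso e'
      have h1 : r = r' := by
        have h2 := hs.rank_eq
        have h3 := hs'.rank_eq
        rw [Fintype.card_fin] at h2 h3
        rw [← h2, ← h3, hr, hro]
      subst h1
      exact degree_le_of_bijective f (F.coherent o) (F'.coherent o) (htf o) (e ≪≫ e'.symm).hom
        (stalkMap_bijective_of_isIso _ _)
    obtain ⟨i₀, hi₀⟩ : ∃ i, ¬ IsIso (ι.app i) := by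
      by_contra! h
      exact hiso (isIso_of_app ι h)
    have hi₀o : i₀ ≠ o := fun h ↦ hi₀ (h ▸ hisoo)
    have hlt : degree (F'.E i₀) < degree (F.E i₀) := by
      by_contra! h
      exact hi₀ (isIso_of_degree_le f (F'.coherent i₀) (F.coherent i₀) (htf' i₀) (htf i₀) _
        (hbij i₀) h)
    have hRpos : 0 < R := by
      by_contra! h0
      have h1 : rank (F.E i₀) = 0 := by
        have h2 := Finset.single_le_sum (f := fun i ↦ rank (F.E i)) (fun _ _ ↦ Nat.zero_le _)
          (show i₀ ∈ Finset.univ.erase o by simpa using hi₀o)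
        lia
      have hz := stalk_eq_zero_of_rank_eq_zero (F.coherent i₀) h1 (htf i₀)
      exact hi₀ (isIso_of_stalkMap_bijective fun x ↦ ⟨hinj i₀ x, fun e ↦
        ⟨0, (map_zero _).trans (hz x e).symm⟩⟩)
    have hDD : D' < D := by
      rw [← hD, ← hD']
      exact Finset.sum_lt_sum (fun i _ ↦ hdeg i) ⟨i₀, by simpa using hi₀o, hlt⟩
    have hRpos' : (0 : ℝ) < R := Nat.cast_pos.2 hRpos
    have hDD' : (D' : ℝ) < D := Int.cast_lt.2 hDD
    refine arg_lt_arg (by rwa [hF're, hRR']) (by rwa [hFre]) ?_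
    rw [hFre, hFim, hF're, hF'im, hRR']
    exact mul_lt_mul_of_pos_right (by linarith) hRpos'

end QuiverSheaf

end Stability

end TwistedQuiver

end

/-! ### Comparison of the notions of stability -/

theorem mainTheorem2
    {X : Scheme.{0}} [IsIntegral X] (f : X ⟶ Spec (.of ℂ)) [IsProper f]
    [SmoothOfRelativeDimension 1 f]
    {I : Type} [Quiver.{0} I] [Fintype I] [DecidableEq I] [∀ i j : I, Fintype (i ⟶ j)]
    (o : I) (T : Twist f I) (v : I → ℕ) (d : I → ℤ) (hv : v o = 1)
    (hvd : (∃ i, i ≠ o ∧ v i ≠ 0) ∨ ∀ i, i ≠ o → d i = 0) :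
    ∃ τ₀ : ℝ, 0 < τ₀ ∧ ∀ τ : ℝ, τ₀ ≤ τ → ∀ F : QuiverSheaf T o, F.HasType v d →
      List.TFAE [F.IsSemistable τ, F.IsStable τ, F.IsStableQuasimap fun _ ↦ 1] := by
  have hdvr := fun x : {x : X // IsClosed {x}} ↦ isDiscreteValuationRing_stalk f x.1 x.2
  have := isLocallyNoetherian_curve f
  have hX := isField_of_universallyClosed ℂ f
  have hpid : ∀ x : X, IsPrincipalIdealRing (X.presheaf.stalk x) := fun x ↦ by
    obtain hx | rfl := isClosed_or_eq_genericPoint f x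
    · have := hdvr ⟨x, hx⟩
      infer_instance
    · exact inferInstanceAs (IsPrincipalIdealRing X.functionField)
  obtain ⟨m, c, hm, hfin, hc⟩ := QuiverSheaf.exists_twist_bound T
  -- The degrees of the components of a generically generated quiver sheaf are at least `-C` times
  -- their ranks.
  set R := ∑ i ∈ Finset.univ.erase o, v i
  set D := ∑ i ∈ Finset.univ.erase o, d i
  set C := ∑ᶠ x, (∑ i, v i) * c x
  refine ⟨(R + 1 : ℝ) * (|(D : ℝ)| + R * C) + 1, by positivity, fun τ hτ F hF ↦ ?_⟩
  have hτ' : (R + 1 : ℝ) * (|(D : ℝ)| + R * C) < τ := by linarith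
  have hr : rank (F.E o) = 1 := (hF o).1.trans hv
  have hN : ∑ i, rank (F.E i) ≤ ∑ i, v i := Finset.sum_le_sum fun i _ ↦ (hF i).1.le
  have hR : ∑ i ∈ Finset.univ.erase o, rank (F.E i) = R := Finset.sum_congr rfl fun i _ ↦ (hF i).1
  have hD : ∑ i ∈ Finset.univ.erase o, degree (F.E i) = D := Finset.sum_congr rfl fun i _ ↦ (hF i).2
  tfae_have 1 → 3 := fun h ↦ by
    have htf := QuiverSheaf.toGeneric_injective_of_isSemistable h hr <| hvd.imp
      (fun ⟨i, hi, hvi⟩ ↦ ⟨i, hi, (hF i).1 ▸ hvi⟩) fun hd i hi ↦ (hF i).2.trans (hd i hi)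
    exact F.isStableQuasimap_iff.2
      ⟨fun i ↦ isLocallyFree_of_torsionFree (F.coherent i) hpid (htf i),
        QuiverSheaf.isGenericallyGenerated_of_isSemistable h hr htf hm hfin hc hN hR hD hτ'⟩
  tfae_have 3 → 2 := fun h ↦ by
    obtain ⟨hfree, hgen⟩ := F.isStableQuasimap_iff.1 h
    exact QuiverSheaf.isStable_of_isGenericallyGenerated hX hgen hr
      (fun i ↦ toGeneric_injective_of_isLocallyFree (hfree i)) hm hfin hc hN hR hD hτ'
  tfae_have 2 → 1 := fun h ↦ ⟨h.1, fun F' ι hι hiso hne ↦ (h.2 F' ι hι hiso hne).le⟩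
  tfae_finish
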